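/- Let $M$ be an $n$-dimensional smooth manifold-with-boundary ($n\ge 1$; Hausdorff, second countable), with interior $\mathring M$, equipped with a smooth free action of the circle group $S^1$ on an open neighbourhood $U_M$ of the boundary $\partial M$. Let $c\colon M\to M_{\mathrm{cut}}=M/{\sim}$ be the quotient, with the quotient topology, by the relation in which distinct points are equivalent iff both lie in $\partial M$ and they are in the same $S^1$-orbit. An \emph{invariant boundary defining function} is a smooth $f\colon M\to\mathbb R_{\ge 0}$ with $f^{-1}(0)=\partial M$ and $df\neq 0$ at every point of $\partial M$, which is $S^1$-invariant on some $S^1$-invariant open neighbourhood of $\partial M$ in $U_M$. Let $\mathcal F_M$ be the set of functions $h\colon M_{\mathrm{cut}}\to\mathbb R$ such that $h\circ c$ is smooth on $\mathring M$ and such that, for some (equivalently, every) invariant boundary defining function $f$, there are an $S^1$-invariant open neighbourhood $V$ of $\partial M$ in $U_M$ and a smooth $H\colon V\times\mathbb C\to\mathbb R$ with $H(a\cdot x,z)=H(x,az)$ for all $a\in S^1$, $(x,z)\in V\times\mathbb C$, and $h(c(x))=H(x,\sqrt{f(x)})$ for all $x\in V$. A \emph{distribution} on a manifold $N$ is a smooth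 sub-bundle $E$ of $TN$. The Lie bracket of sections of $E$ induces a two-form $\Omega\colon E\times E\to TN/E$, $\Omega(u,v)=[u,v]+E$. The distribution $E$ is \emph{involutive} if $\Omega=0$, and it is \emph{contact} if it has codimension one and $\Omega$ is non-degenerate. The space $M_{\mathrm{cut}}$ is Hausdorff and second countable and carries an $n$-dimensional smooth manifold structure whose set of real valued smooth functions is $\mathcal F_M$; equip $M_{\mathrm{cut}}$ with this (necessarily unique) structure. Let $E$ be a distribution on $M$ that - contains the tangent spaces to the $S^1$-orbits along $\partial M$, - is $S^1$-invariant near $\partial M$ (that is, on some $S^1$-invariant open neighbourhood of $\partial M$ in $U_M$), and - is transverse to $\partial M$ (that is, $E_x+T_x\partial M=T_xM$ for all $x\in\partial M$). Then there exists a unique distribution $E_{\mathrm{cut}}$ on $M_{\mathrm{cut}}$ whose preimage under $c|_{\mathring M}\colon\mathring M\to c(\mathring M)$ is $E|_{\mathring M}$, i.e. $(d_xc)^{-1}\big((E_{\mathrm{cut}})_{c(x)}\big)=E_x$ for all $x\in\mathring M$. Moreover, $E$ is involutive iff $E_{\mathrm{cut}}$ is involutive, and $E$ is a contact distribution iff $E_{\mathrm{cut}}$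 is a contact distribution. -/

import Mathlib

open scoped Manifold ContDiff

noncomputable section

/-! ### Distributions on manifolds (possibly with boundary) -/

section Distributions

variable {V : Type*} [NormedAddCommGroup V] [NormedSpace ℝ V] {H : Type*} [TopologicalSpace H]
  (I : ModelWithCorners ℝ V H) {N : Type*} [TopologicalSpace N] [ChartedSpace H N]
  [IsManifold I ∞ N]

/-- The vector field `X` is smooth on the set `W`. -/
def SmoothFieldOn (X : ∀ x : N, TangentSpace I x) (W : Set N) : Prop :=
  ContMDiffOn I I.tangent ∞ (fun x ↦ (⟨x, X x⟩ : TangentBundle I N)) W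

/-- A distribution on `N`: a smooth sub-bundle of the tangent bundle, that is, a family of subspaces
of the tangent spaces that has a smooth frame near every point. -/
def IsDistribution (E : ∀ x : N, Submodule ℝ (TangentSpace I x)) : Prop :=
  ∀ x₀ : N, ∃ (W : Set N) (k : ℕ) (X : Fin k → ∀ x : N, TangentSpace I x),
    IsOpen W ∧ x₀ ∈ W ∧ (∀ i, SmoothFieldOn I (X i) W) ∧
      ∀ x ∈ W, LinearIndependent ℝ (fun i ↦ X i x) ∧
        Submodule.span ℝ (Set.range fun i ↦ X i x) = E x

/-- `X` is a smooth section of `E` over the set `W`. -/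
def IsSectionOn (E : ∀ x : N, Submodule ℝ (TangentSpace I x)) (X : ∀ x : N, TangentSpace I x)
    (W : Set N) : Prop :=
  SmoothFieldOn I X W ∧ ∀ x ∈ W, X x ∈ E x

/-- The two-form `Ω : E × E → TN / E` given by `Ω (u, v) = [u, v] + E` vanishes: the Lie bracket of
any two local sections of `E` is again in `E`. -/
def IsInvolutive (E : ∀ x : N, Submodule ℝ (TangentSpace I x)) : Prop :=
  ∀ (W : Set N) (X Y : ∀ x : N, TangentSpace I x), IsOpen W →
    IsSectionOn I E X W → IsSectionOn I E Y W →
      ∀ x ∈ W, VectorField.mlieBracket I X Y x ∈ E x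

/-- `E` has codimension one, and the two-form `Ω : E × E → TN / E` given by `Ω (u, v) = [u, v] + E`
is non-degenerate: a vector `u ∈ E x` with `Ω (u, v) = 0` for all `v ∈ E x` is zero. The vectors
`u` and `v` are represented by local sections `X` and `Y` of `E`. -/
def IsContact (E : ∀ x : N, Submodule ℝ (TangentSpace I x)) : Prop :=
  (∀ x : N, Module.finrank ℝ (TangentSpace I x ⧸ E x) = 1) ∧
    ∀ (x : N), ∀ u ∈ E x,
      (∀ (W : Set N) (X Y : ∀ x : N, TangentSpace I x), IsOpen W → x ∈ W →
        IsSectionOn I E X W → IsSectionOn I E Y W → X x = u →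
          VectorField.mlieBracket I X Y x ∈ E x) →
      u = 0

end Distributions

/-! ### Circle actions near the boundary -/

/-- A smooth free action of the circle group on an open neighbourhood `U` of the boundary of the
manifold-with-boundary `M`. The values of `act a` outside `U` are irrelevant. -/
structure FreeCircleActionNearBoundary (n : ℕ) [NeZero n] (M : Type*) [TopologicalSpace M]
    [ChartedSpace (EuclideanHalfSpace n) M] where
  U : Set M
  isOpen_U : IsOpen U
  boundary_subset : (𝓡∂ n).boundary M ⊆ U
  act : Circle → M → M
  act_mem : ∀ a, ∀ x ∈ U, act a x ∈ U
  one_act : ∀ x ∈ U, act 1 x = x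
  mul_act : ∀ a b, ∀ x ∈ U, act (a * b) x = act a (act b x)
  smooth : ContMDiffOn ((𝓡 1).prod (𝓡∂ n)) (𝓡∂ n) ∞ (fun p : Circle × M ↦ act p.1 p.2)
    (Set.univ ×ˢ U)
  free : ∀ a, ∀ x ∈ U, act a x = x → a = 1

namespace FreeCircleActionNearBoundary

variable {n : ℕ} [NeZero n] {M : Type*} [TopologicalSpace M]
  [ChartedSpace (EuclideanHalfSpace n) M] (A : FreeCircleActionNearBoundary n M)

/-- `V` is a circle-invariant open neighbourhood of the boundary, contained in `U`. -/
structure IsInvariantNhd (V : Set M) : Prop where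
  isOpen : IsOpen V
  boundary_subset : (𝓡∂ n).boundary M ⊆ V
  subset_U : V ⊆ A.U
  act_mem : ∀ a, ∀ x ∈ V, A.act a x ∈ V

/-- Distinct points are equivalent iff both are in the boundary and they are in the same orbit. -/
def cutSetoid : Setoid M where
  r x y := x = y ∨
    (x ∈ (𝓡∂ n).boundary M ∧ y ∈ (𝓡∂ n).boundary M ∧ ∃ a, A.act a x = y)
  iseqv := by
    refine ⟨fun x ↦ Or.inl rfl, ?_, ?_⟩
    · rintro x y (rfl | ⟨hx, hy, a, rfl⟩)
      · exact Or.inl rfl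
      · refine Or.inr ⟨hy, hx, a⁻¹, ?_⟩
        rw [← A.mul_act _ _ _ (A.boundary_subset hx), inv_mul_cancel,
          A.one_act _ (A.boundary_subset hx)]
    · rintro x y z (rfl | ⟨hx, hy, a, rfl⟩) hyz
      · exact hyz
      · rcases hyz with rfl | ⟨-, hz, b, rfl⟩
        · exact Or.inr ⟨hx, hy, a, rfl⟩
        · exact Or.inr ⟨hx, hz, b * a, A.mul_act _ _ _ (A.boundary_subset hx)⟩

/-- The cut space, with the quotient topology. -/
def Cut : Type _ := Quotient A.cutSetoid

instance : TopologicalSpace A.Cut := inferInstanceAs (TopologicalSpace (Quotient A.cutSetoid))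

/-- The quotient map from `M` to the cut space. -/
def c (x : M) : A.Cut := Quotient.mk A.cutSetoid x

/-- Invariant boundary defining functions. -/
structure IsInvariantBoundaryDefining (f : M → ℝ) : Prop where
  smooth : ContMDiff (𝓡∂ n) 𝓘(ℝ, ℝ) ∞ f
  nonneg : ∀ x, 0 ≤ f x
  eq_zero_iff : ∀ x, f x = 0 ↔ x ∈ (𝓡∂ n).boundary M
  mfderiv_ne_zero : ∀ x ∈ (𝓡∂ n).boundary M, mfderiv (𝓡∂ n) 𝓘(ℝ, ℝ) f x ≠ 0
  invariant : ∃ V, A.IsInvariantNhd V ∧ ∀ a, ∀ x ∈ V, f (A.act a x) = f x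

/-- The real valued functions on the cut space that the smooth cutting construction declares to be
smooth. (They do not depend on the choice of the invariant boundary defining function.) -/
def cutFunctions : Set (A.Cut → ℝ) :=
  {h | ContMDiffOn (𝓡∂ n) 𝓘(ℝ, ℝ) ∞ (fun x ↦ h (A.c x)) ((𝓡∂ n).interior M) ∧
    ∃ f : M → ℝ, A.IsInvariantBoundaryDefining f ∧
      ∃ (V : Set M) (H : M × ℂ → ℝ), A.IsInvariantNhd V ∧
        ContMDiffOn ((𝓡∂ n).prod 𝓘(ℝ, ℂ)) 𝓘(ℝ, ℝ) ∞ H (V ×ˢ Set.univ) ∧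
        (∀ a : Circle, ∀ x ∈ V, ∀ z : ℂ, H (A.act a x, z) = H (x, (a : ℂ) * z)) ∧
        ∀ x ∈ V, h (A.c x) = H (x, ((√(f x) : ℝ) : ℂ))}

/-- A smooth structure on the cut space (with its quotient topology) is the one that is given by the
smooth cutting construction: its real valued smooth functions are exactly the members of
`cutFunctions`. -/
def IsCutStructure [ChartedSpace (EuclideanSpace ℝ (Fin n)) A.Cut] : Prop :=
  ∀ h : A.Cut → ℝ, ContMDiff (𝓡 n) 𝓘(ℝ, ℝ) ∞ h ↔ h ∈ A.cutFunctions

/-- `E` contains the tangent spaces to the circle orbits along the boundary. -/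
def ContainsOrbitTangents (E : ∀ x : M, Submodule ℝ (TangentSpace (𝓡∂ n) x)) : Prop :=
  ∀ x ∈ (𝓡∂ n).boundary M, ∀ (a : Circle) (v : TangentSpace (𝓡 1) a),
    mfderiv (𝓡 1) (𝓡∂ n) (fun b : Circle ↦ A.act b x) a v ∈ E (A.act a x)

/-- `E` is circle-invariant near the boundary. -/
def InvariantNearBoundary (E : ∀ x : M, Submodule ℝ (TangentSpace (𝓡∂ n) x)) : Prop :=
  ∃ V, A.IsInvariantNhd V ∧ ∀ a, ∀ x ∈ V,
    (E x).map (mfderiv (𝓡∂ n) (𝓡∂ n) (A.act a) x).toLinearMap = E (A.act a x)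

/-- The distribution `E'` on the cut space pulls back to `E` on the interior of `M`. -/
def AgreesOnInterior [ChartedSpace (EuclideanSpace ℝ (Fin n)) A.Cut]
    (E : ∀ x : M, Submodule ℝ (TangentSpace (𝓡∂ n) x))
    (E' : ∀ y : A.Cut, Submodule ℝ (TangentSpace (𝓡 n) y)) : Prop :=
  ∀ x ∈ (𝓡∂ n).interior M,
    (E' (A.c x)).comap (mfderiv (𝓡∂ n) (𝓡 n) A.c x).toLinearMap = E x

end FreeCircleActionNearBoundary

/-- The tangent space to the boundary at a boundary point `x`, as a subspace of the tangent space of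
`M`. The tangent space of `M` at `x` is `ℝⁿ` by means of the preferred chart at `x`, which has
values in the half-space where the coordinate of index `0` is non-negative. -/
def boundaryTangent {n : ℕ} [NeZero n] {M : Type*} [TopologicalSpace M]
    [ChartedSpace (EuclideanHalfSpace n) M] (x : M) : Submodule ℝ (TangentSpace (𝓡∂ n) x) :=
  LinearMap.ker (EuclideanSpace.proj (𝕜 := ℝ) (0 : Fin n) :
    EuclideanSpace ℝ (Fin n) →L[ℝ] ℝ).toLinearMap

/-- `E` is transverse to the boundary. -/
def TransverseToBoundary {n : ℕ} [NeZero n] {M : Type*} [TopologicalSpace M]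
    [ChartedSpace (EuclideanHalfSpace n) M]
    (E : ∀ x : M, Submodule ℝ (TangentSpace (𝓡∂ n) x)) : Prop :=
  ∀ x ∈ (𝓡∂ n).boundary M, E x ⊔ boundaryTangent x = ⊤

end

/-! Near a boundary orbit, M is equivariantly S¹ × {(y, t) : t ≥ 0} with y ∈ ℝⁿ⁻² (`exists_tube`),
and the cut space gets coordinates (y, z) with z = √t·e^{iθ}. Then t = |z|², and collapsing the
circles over t = 0 produces the points z = 0. In a tube an invariant boundary defining function is t
times a positive smooth function (`exists_pos_factor`, by Hadamard's lemma). Hence the change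
between two such coordinate systems comes from a smooth equivariant map on M × ℂ evaluated at z =
√f, and it is smooth across z = 0 (`contDiffAt_coordChange`). The smooth functions of the resulting
atlas are exactly 𝓕_M (`contMDiff_stdCut_iff`): the equivariant H is found by a partition of unity
and averaging over the circle. Maps into a manifold are smooth as soon as they pull back smooth
functions to smooth functions (`contMDiff_of_contMDiff_comp`), so every structure with these
functions is this one.

A distribution is locally the kernel of a form α with values in a space K that is embedded as a
fixed complement, with α the identity on K. Near the boundary E contains the orbit direction and a
direction transverse to ∂M, so K can be taken inside the y-directions. Invariance removes the
dependence on θ, and α(∂_θ) = 0 at t = 0 allows division by t, so that α = t g dθ + β + k dt with g,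
β, k smooth in (y, t) (`exists_boundaryForm`). In cut coordinates t dθ = ⟨iz, dz⟩ and dt = 2⟨z, dz⟩
are smooth across z = 0. So α descends to a smooth form, still the identity on K, and its kernel is
E_cut (`hasForm_cut`). Uniqueness holds because the image of the interior is dense
(`IsCutStructure.distributionClosure_eq`).

If X and Y take values in ker α, then α([X, Y]) = −dα(X, Y) (`IsForm.apply_lieBracketWithin`), so Ω
is the restriction of −dα to the kernels. Its vanishing is a closed condition and c is a
diffeomorphism from the interior onto its image, so involutivity passes in both directions by
density. Non-degeneracy is not a closed condition and is computed at the centre of a tube on both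
sides. In codimension one both computations give the same criterion: g(0) ≠ 0, and the derivative of
β in the y-directions is non-degenerate on ker β (`nondegenerate_boundary_iff`,
`nondegenerate_cut_iff`). -/

set_option linter.unusedSectionVars false

/-! ### Integrals that depend smoothly on a parameter -/

noncomputable section

section ParametricIntegral
open MeasureTheory Set Filter Topology

universe u
variable {E : Type u} [NormedAddCommGroup E] [NormedSpace ℝ E] {S : Set E} {a b : ℝ}

/-- The interval is compact, so the modulus of continuity at `x` is uniform in `s`. -/
theorem eventually_dist_lt_of_continuousOn_prod {F : Type*} [NormedAddCommGroup F]
    {G : ℝ × E → F} (hG : ContinuousOn G (Icc a b ×ˢ S)) {x : E} (hx : x ∈ S) {ε : ℝ}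
    (hε : 0 < ε) : ∀ᶠ x' in 𝓝[S] x, ∀ s ∈ Icc a b, ‖G (s, x') - G (s, x)‖ < ε := by
  have hc : ContinuousOn (Function.uncurry fun (y : E) (s : ℝ) ↦ G (s, y)) (S ×ˢ Icc a b) :=
    hG.comp continuous_swap.continuousOn fun p hp ↦ ⟨hp.2, hp.1⟩
  obtain ⟨v, hv, h⟩ := isCompact_Icc.mem_uniformity_of_prod hc hx (Metric.dist_mem_uniformity hε)
  filter_upwards [hv] with y hy s hs
  simpa [dist_eq_norm] using h y hy s hs

theorem continuousOn_slice {F : Type*} [NormedAddCommGroup F]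
    {G : ℝ × E → F} (hG : ContinuousOn G (Icc a b ×ˢ S)) {x : E} (hx : x ∈ S) :
    ContinuousOn (fun s ↦ G (s, x)) (Icc a b) :=
  hG.comp (by fun_prop) fun s hs ↦ ⟨hs, hx⟩

theorem intervalIntegrable_slice {F : Type*} [NormedAddCommGroup F] (hab : a ≤ b)
    {G : ℝ × E → F} (hG : ContinuousOn G (Icc a b ×ˢ S)) {x : E} (hx : x ∈ S) :
    IntervalIntegrable (fun s ↦ G (s, x)) volume a b :=
  (continuousOn_slice hG hx).intervalIntegrable_of_Icc hab

theorem continuousOn_intervalIntegral_param {F : Type*} [NormedAddCommGroup F] [NormedSpace ℝ F]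
    (hab : a ≤ b) {G : ℝ × E → F} (hG : ContinuousOn G (Icc a b ×ˢ S)) :
    ContinuousOn (fun x ↦ ∫ s in a..b, G (s, x)) S := by
  intro x hx
  rw [ContinuousWithinAt, Metric.tendsto_nhds]
  intro ε hε
  have hδ : 0 < ε / (2 * (b - a + 1)) := by
    have : 0 ≤ b - a := sub_nonneg.2 hab
    positivity
  filter_upwards [eventually_dist_lt_of_continuousOn_prod hG hx hδ, self_mem_nhdsWithin]
    with y hy hyS
  rw [dist_eq_norm, ← intervalIntegral.integral_sub (intervalIntegrable_slice hab hG hyS)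
    (intervalIntegrable_slice hab hG hx)]
  have h0 : 0 ≤ b - a := sub_nonneg.2 hab
  calc _ ≤ ε / (2 * (b - a + 1)) * |b - a| :=
        intervalIntegral.norm_integral_le_of_norm_le_const fun s hs ↦
          (hy s (Ioc_subset_Icc_self (by rwa [uIoc_of_le hab] at hs))).le
    _ < ε := by
        rw [abs_of_nonneg h0, div_mul_eq_mul_div, div_lt_iff₀ (by positivity)]
        nlinarith

/-- The parameter set is convex but need not be open. On its intersection with a small ball the mean
value inequality bounds the increment of `G (s, ·)` minus its linear part, uniformly in `s`, and the
bound is integrated. -/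
theorem hasFDerivWithinAt_intervalIntegral_param {F : Type*} [NormedAddCommGroup F]
    [NormedSpace ℝ F] [CompleteSpace F] (hS : Convex ℝ S) (hab : a ≤ b) {G : ℝ × E → F}
    {G' : ℝ × E → E →L[ℝ] F} (hG : ContinuousOn G (Icc a b ×ˢ S))
    (hG' : ContinuousOn G' (Icc a b ×ˢ S))
    (hd : ∀ s ∈ Icc a b, ∀ x ∈ S, HasFDerivWithinAt (fun x ↦ G (s, x)) (G' (s, x)) S x)
    {x : E} (hx : x ∈ S) :
    HasFDerivWithinAt (fun x ↦ ∫ s in a..b, G (s, x)) (∫ s in a..b, G' (s, x)) S x := by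
  rw [hasFDerivWithinAt_iff_isLittleO, Asymptotics.isLittleO_iff]
  intro ε hε
  have h0 : 0 ≤ b - a := sub_nonneg.2 hab
  have hδ : 0 < ε / (b - a + 1) := by positivity
  obtain ⟨r, hr, hball⟩ := Metric.mem_nhdsWithin_iff.1
    (eventually_dist_lt_of_continuousOn_prod hG' hx hδ)
  filter_upwards [inter_mem_nhdsWithin S (Metric.ball_mem_nhds x hr)] with y hy
  have hi := intervalIntegrable_slice hab hG' hx
  rw [ContinuousLinearMap.intervalIntegral_apply hi,
    ← intervalIntegral.integral_sub (intervalIntegrable_slice hab hG hy.1)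
    (intervalIntegrable_slice hab hG hx), ← intervalIntegral.integral_sub]
  · calc _ ≤ (ε / (b - a + 1) * ‖y - x‖) * |b - a| := by
          refine intervalIntegral.norm_integral_le_of_norm_le_const fun s hs ↦ ?_
          have hs' : s ∈ Icc a b := Ioc_subset_Icc_self (by rwa [uIoc_of_le hab] at hs)
          refine (hS.inter (convex_ball x r)).norm_image_sub_le_of_norm_hasFDerivWithin_le'
            (f := fun x ↦ G (s, x)) (f' := fun x ↦ G' (s, x)) (φ := G' (s, x))
            (fun z hz ↦ (hd s hs' z hz.1).mono inter_subset_left) (fun z hz ↦ ?_)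
            ⟨hx, Metric.mem_ball_self hr⟩ hy
          exact (hball ⟨hz.2, hz.1⟩ s hs').le
      _ ≤ ε * ‖y - x‖ := by
          rw [abs_of_nonneg h0]
          have : ε / (b - a + 1) * (b - a) ≤ ε := by
            rw [div_mul_eq_mul_div, div_le_iff₀ (by positivity)]
            nlinarith
          nlinarith [norm_nonneg (y - x)]
  · exact (intervalIntegrable_slice hab hG hy.1).sub (intervalIntegrable_slice hab hG hx)
  · exact ((continuousOn_slice hG' hx).clm_apply continuousOn_const).intervalIntegrable_of_Icc hab

/-- The target is quantified inside the induction because the step applies the hypothesis to the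
derivative, whose target is `E →L[ℝ] F`. This is also why `E` and `F` share a universe. -/
theorem contDiffOn_nat_intervalIntegral_param (hS : Convex ℝ S) (hu : UniqueDiffOn ℝ S)
    (hab : a < b) (k : ℕ) : ∀ {F : Type u} [NormedAddCommGroup F] [NormedSpace ℝ F]
    [CompleteSpace F] {G : ℝ × E → F}, ContDiffOn ℝ k G (Icc a b ×ˢ S) →
    ContDiffOn ℝ k (fun x ↦ ∫ s in a..b, G (s, x)) S := by
  induction k with
  | zero =>
    intro F _ _ _ G hG
    exact contDiffOn_zero.2 (continuousOn_intervalIntegral_param hab.le hG.continuousOn)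
  | succ k ih =>
    intro F _ _ _ G hG
    have hu' : UniqueDiffOn ℝ (Icc a b ×ˢ S) := (uniqueDiffOn_Icc hab).prod hu
    obtain ⟨-, G', hG', hd⟩ := (contDiffOn_succ_iff_hasFDerivWithinAt_of_uniqueDiffOn
      (n := (k : WithTop ℕ∞)) hu').1 (by exact_mod_cast hG)
    have hG'' : ContDiffOn ℝ k (fun p ↦ (G' p).comp (ContinuousLinearMap.inr ℝ ℝ E))
        (Icc a b ×ˢ S) := hG'.clm_comp contDiffOn_const
    have := (contDiffOn_succ_iff_hasFDerivWithinAt_of_uniqueDiffOn (n := (k : WithTop ℕ∞)) hu).2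
      ⟨by simp, _, ih hG'', fun x hx ↦ hasFDerivWithinAt_intervalIntegral_param hS hab.le
        hG.continuousOn hG''.continuousOn (fun s hs y hy ↦ ?_) hx⟩
    · exact_mod_cast this
    · exact (hd (s, y) ⟨hs, hy⟩).comp y (hasFDerivAt_prodMk_right s y).hasFDerivWithinAt
        fun z hz ↦ ⟨hs, hz⟩

theorem contDiffOn_intervalIntegral_param (hS : Convex ℝ S) (hu : UniqueDiffOn ℝ S) (hab : a < b)
    {F : Type u} [NormedAddCommGroup F] [NormedSpace ℝ F] [CompleteSpace F] {G : ℝ × E → F}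
    (hG : ContDiffOn ℝ ∞ G (Icc a b ×ˢ S)) :
    ContDiffOn ℝ ∞ (fun x ↦ ∫ s in a..b, G (s, x)) S :=
  contDiffOn_infty.2 fun k ↦
    contDiffOn_nat_intervalIntegral_param hS hu hab k (hG.of_le (by exact_mod_cast le_top))

end ParametricIntegral

/-! ### Hadamard's lemma at a wall -/

section Hadamard
open MeasureTheory Set Filter Topology

universe u
variable {Y : Type u} [NormedAddCommGroup Y] [NormedSpace ℝ Y]

theorem uniqueDiffOn_inter_halfSpace {E : Type*} [NormedAddCommGroup E] [NormedSpace ℝ E]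
    (l : E →L[ℝ] ℝ) (hl : l ≠ 0) {D : Set E} (hD : IsOpen D) :
    UniqueDiffOn ℝ (D ∩ {v | 0 ≤ l v}) := by
  rw [inter_comm]
  refine UniqueDiffOn.inter ?_ hD
  refine uniqueDiffOn_convex ?_ ?_
  · exact (convex_halfSpace_ge l.isLinear 0)
  · obtain ⟨v, hv⟩ : ∃ v, l v ≠ 0 := by
      by_contra! h
      exact hl (ContinuousLinearMap.ext h)
    have hv' : (l v)⁻¹ • v ∈ {v | 0 < l v} := by simp [hv]
    exact ⟨_, interior_mono (fun w (hw : 0 < l w) ↦ hw.le)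
      ((isOpen_lt continuous_const l.continuous).interior_eq.symm ▸ hv')⟩

/-- Hadamard's lemma on the half space. -/
theorem exists_contDiffOn_eq_smul_of_vanishing {F : Type u} [NormedAddCommGroup F]
    [NormedSpace ℝ F] [CompleteSpace F] {D : Set (Y × ℝ)} (hD : IsOpen D) (hDc : Convex ℝ D)
    (h0 : ∀ d ∈ D, 0 ≤ d.2 → (d.1, (0 : ℝ)) ∈ D) {f : Y × ℝ → F}
    (hf : ContDiffOn ℝ ∞ f (D ∩ {d | 0 ≤ d.2})) (hf0 : ∀ d ∈ D, d.2 = 0 → f d = 0) :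
    ∃ g : Y × ℝ → F, ContDiffOn ℝ ∞ g (D ∩ {d | 0 ≤ d.2}) ∧
      (∀ d ∈ D ∩ {d | 0 ≤ d.2}, f d = d.2 • g d) ∧
      ∀ d ∈ D, d.2 = 0 → g d = fderivWithin ℝ f (D ∩ {d | 0 ≤ d.2}) d (0, 1) := by
  set S : Set (Y × ℝ) := D ∩ {d | 0 ≤ d.2} with hSdef
  have hS : Convex ℝ S :=
    hDc.inter (convex_halfSpace_ge (ContinuousLinearMap.snd ℝ Y ℝ).isLinear 0)
  have hu : UniqueDiffOn ℝ S := uniqueDiffOn_inter_halfSpace (ContinuousLinearMap.snd ℝ Y ℝ)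
    (fun h ↦ by simpa using congr($h ((0 : Y), (1 : ℝ)))) hD
  set f' : Y × ℝ → F := fun d ↦ fderivWithin ℝ f S d (0, 1)
  have hf' : ContDiffOn ℝ ∞ f' S :=
    (hf.fderivWithin hu (by simp)).clm_apply contDiffOn_const
  have hmem : ∀ s ∈ Icc (0 : ℝ) 1, ∀ d ∈ S, (d.1, s * d.2) ∈ S := by
    intro s hs d hd
    refine ⟨?_, mul_nonneg hs.1 hd.2⟩
    have := hDc (h0 d hd.1 hd.2) hd.1 (sub_nonneg.2 hs.2) hs.1 (by ring)
    convert this using 1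
    ext <;> simp [← add_smul]
  -- The quotient is the mean of the normal derivative over the segment from the foot `(d.1, 0)` to
  -- `d`; the fundamental theorem of calculus gives `f d = d.2 • g d`.
  refine ⟨fun d ↦ ∫ s in (0 : ℝ)..1, f' (d.1, s * d.2), ?_, ?_, ?_⟩
  · refine contDiffOn_intervalIntegral_param hS hu zero_lt_one
      (G := fun p : ℝ × (Y × ℝ) ↦ f' (p.2.1, p.1 * p.2.2)) ?_
    exact hf'.comp (by fun_prop) fun p hp ↦ hmem p.1 hp.1 p.2 hp.2
  · intro d hd
    have hderiv : ∀ s ∈ Icc (0 : ℝ) 1, HasDerivWithinAt (fun s : ℝ ↦ f (d.1, s * d.2))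
        (d.2 • f' (d.1, s * d.2)) (Icc 0 1) s := by
      intro s hs
      have h1 := ((hf.differentiableOn (by simp)) _ (hmem s hs d hd)).hasFDerivWithinAt
      have h2 : HasDerivWithinAt (fun s : ℝ ↦ (d.1, s * d.2)) ((0 : Y), d.2) (Icc 0 1) s := by
        refine HasDerivWithinAt.prodMk (hasDerivWithinAt_const _ _ _) ?_
        simpa using (hasDerivWithinAt_id s (Icc 0 1)).mul_const d.2
      have h3 := h1.comp_hasDerivWithinAt s h2 (fun r hr ↦ hmem r hr d hd)
      rw [show ((0 : Y), d.2) = d.2 • ((0 : Y), (1 : ℝ)) by simp, map_smul] at h3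
      exact h3
    have hcont : ContinuousOn (fun s : ℝ ↦ f' (d.1, s * d.2)) (Icc 0 1) :=
      hf'.continuousOn.comp (by fun_prop) fun s hs ↦ hmem s hs d hd
    have := intervalIntegral.integral_eq_sub_of_hasDeriv_right_of_le zero_le_one
      (f := fun s : ℝ ↦ f (d.1, s * d.2)) (f' := fun s ↦ d.2 • f' (d.1, s * d.2))
      (fun s hs ↦ (hderiv s hs).continuousWithinAt)
      (fun s hs ↦ (hderiv s (Ioo_subset_Icc_self hs)).mono_of_mem_nhdsWithin
        (mem_nhdsWithin_of_mem_nhds (Icc_mem_nhds hs.1 hs.2)))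
      ((hcont.const_smul d.2).intervalIntegrable_of_Icc zero_le_one)
    rw [intervalIntegral.integral_smul] at this
    rw [this]
    simp [hf0 (d.1, 0) (h0 d hd.1 hd.2) rfl]
  · rintro ⟨y, t⟩ hd (rfl : t = 0)
    simp [f']

end Hadamard
end

/-! ### Inverse functions up to the boundary -/

noncomputable section

section BoundaryInverse
open Set Filter Topology

variable {E : Type*} [NormedAddCommGroup E] [NormedSpace ℝ E] [CompleteSpace E]

/-- An inverse of a smooth map with invertible derivatives is smooth, also within sets. -/
theorem contDiffOn_of_leftInverse {E' : Type*} [NormedAddCommGroup E'] [NormedSpace ℝ E']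
    [CompleteSpace E'] {f : E → E'} {g : E' → E}
    {s : Set E} {t : Set E'} (hs : UniqueDiffOn ℝ s) (ht : UniqueDiffOn ℝ t)
    (hf : ContDiffOn ℝ ∞ f s) (hg : ContinuousOn g t) (hgt : MapsTo g t s)
    (hfg : ∀ y ∈ t, f (g y) = y)
    (hinv : ∀ x ∈ s, ∃ e : E ≃L[ℝ] E', (e : E →L[ℝ] E') = fderivWithin ℝ f s x) :
    ContDiffOn ℝ ∞ g t := by
  have hd : ∀ y ∈ t, HasFDerivWithinAt g (fderivWithin ℝ f s (g y)).inverse t y := by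
    intro y hy
    obtain ⟨e, he⟩ := hinv _ (hgt hy)
    rw [← he, ContinuousLinearMap.inverse_equiv]
    refine HasFDerivWithinAt.of_local_left_inverse (t := s) ?_ ?_ hy
      (eventually_of_mem self_mem_nhdsWithin hfg)
    · exact tendsto_nhdsWithin_iff.2 ⟨hg y hy, eventually_of_mem self_mem_nhdsWithin hgt⟩
    · rw [he]
      exact (hf.differentiableOn (by simp) _ (hgt hy)).hasFDerivWithinAt
  -- By `hd` the derivative of `g` is operator inversion after the derivative of `f` after `g`, so
  -- order `k` for `g` gives order `k` for its derivative, hence order `k + 1` for `g`.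
  refine contDiffOn_infty.2 fun k ↦ ?_
  induction k with
  | zero => exact contDiffOn_zero.2 hg
  | succ k ih =>
    have := (contDiffOn_succ_iff_hasFDerivWithinAt_of_uniqueDiffOn (n := (k : WithTop ℕ∞)) ht).2
      ⟨by simp, _, fun y hy ↦ ?_, hd⟩
    · exact_mod_cast this
    · obtain ⟨e, he⟩ := hinv _ (hgt hy)
      have h1 : ContDiffAt ℝ k ContinuousLinearMap.inverse (fderivWithin ℝ f s (g y)) := by
        rw [← he]
        exact contDiffAt_map_inverse e
      refine ContDiffAt.comp_contDiffWithinAt (f := fun z ↦ fderivWithin ℝ f s (g z)) y h1 ?_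
      exact ((hf.fderivWithin hs (m := k) (by exact_mod_cast le_top)) _ (hgt hy)).comp y (ih y hy) hgt

/-- The inverse function theorem at a boundary point of a half space. -/
theorem exists_openPartialHomeomorph_halfSpace (l : E →L[ℝ] ℝ) (e : E) (he : l e = 1) {O : Set E}
    (hO : IsOpen O) (h0 : (0 : E) ∈ O) {G : E → E} (hG : ContDiffOn ℝ ∞ G (O ∩ {v | 0 ≤ l v}))
    (hd : HasFDerivWithinAt G (ContinuousLinearMap.id ℝ E) (O ∩ {v | 0 ≤ l v}) 0)
    (hpos : ∀ v ∈ O, 0 ≤ l v → 0 ≤ l (G v)) (hzero : ∀ v ∈ O, l v = 0 → l (G v) = 0) :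
    ∃ Φ : OpenPartialHomeomorph E E, (0 : E) ∈ Φ.source ∧ Φ.source ⊆ O ∧
      (∀ v ∈ Φ.source, 0 ≤ l v → Φ v = G v) ∧ (∀ v ∈ Φ.source, 0 ≤ l (Φ v) ↔ 0 ≤ l v) ∧
      ContDiffOn ℝ ∞ Φ.symm (Φ.target ∩ {v | 0 ≤ l v}) := by
  set S : Set E := {v | 0 ≤ l v} with hSdef
  have hl : l ≠ 0 := fun h ↦ by simp [h] at he
  have hSc : Convex ℝ S := convex_halfSpace_ge l.isLinear 0
  have hu : UniqueDiffOn ℝ (O ∩ S) := uniqueDiffOn_inter_halfSpace l hl hO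
  have h0S : (0 : E) ∈ O ∩ S := ⟨h0, by simp [S]⟩
  set K : ℝ := 1 + ‖l‖ * ‖e‖ with hK
  have hKpos : 0 < K := by positivity
  -- A retraction onto the half space along `e`, with Lipschitz constant `K`; it serves to extend
  -- `G` across the wall.
  set ret : E → E := fun v ↦ v - min (l v) 0 • e with hret
  have hretS : ∀ v, ret v ∈ S := by
    intro v
    simp only [hret, S, mem_ofPred_eq, map_sub, map_smul, he, smul_eq_mul, mul_one]
    linarith [min_le_left (l v) 0]
  have hretid : ∀ v ∈ S, ret v = v := fun v hv ↦ by
    simp [hret, min_eq_right (show 0 ≤ l v from hv)]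
  have hretL : ∀ v w, ‖ret v - ret w‖ ≤ K * ‖v - w‖ := by
    intro v w
    have h1 : ret v - ret w = (v - w) - (min (l v) 0 - min (l w) 0) • e := by
      simp only [hret, sub_smul]; abel
    have h2 : |min (l v) 0 - min (l w) 0| ≤ ‖l‖ * ‖v - w‖ :=
      calc _ ≤ |l v - l w| := by
            simpa using abs_min_sub_min_le_max (l v) 0 (l w) 0
        _ = ‖l (v - w)‖ := by rw [map_sub, Real.norm_eq_abs]
        _ ≤ _ := l.le_opNorm _
    rw [h1]
    refine (norm_sub_le _ _).trans ?_
    rw [norm_smul, Real.norm_eq_abs]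
    have := mul_le_mul_of_nonneg_right h2 (norm_nonneg e)
    rw [hK]; nlinarith
  have hd0 : fderivWithin ℝ G (O ∩ S) 0 = ContinuousLinearMap.id ℝ E := hd.fderivWithin (hu 0 h0S)
  have hcont := hG.continuousOn_fderivWithin hu (by simp) 0 h0S
  -- The bound `1 / (2 * K)` on the derivative of `G - id` becomes the Lipschitz constant 1/2 after
  -- composition with `ret`.
  have hc : 0 < 1 / (2 * K) := by positivity
  obtain ⟨r, hr, hball⟩ := Metric.mem_nhdsWithin_iff.1
    (hcont (Metric.ball_mem_nhds _ hc))
  obtain ⟨r', hr', hball'⟩ := Metric.isOpen_iff.1 hO 0 h0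
  set ρ : ℝ := min r r' with hρ
  have hρpos : 0 < ρ := lt_min hr hr'
  have hsub : Metric.ball (0 : E) ρ ⊆ O :=
    (Metric.ball_subset_ball (min_le_right _ _)).trans hball'
  have hbd : ∀ v ∈ Metric.ball (0 : E) ρ ∩ S,
      ‖fderivWithin ℝ G (O ∩ S) v - ContinuousLinearMap.id ℝ E‖ ≤ 1 / (2 * K) := by
    intro v hv
    have := hball ⟨Metric.ball_subset_ball (min_le_left _ _) hv.1, hsub hv.1, hv.2⟩
    rw [mem_preimage, Metric.mem_ball, hd0, dist_eq_norm] at this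
    exact this.le
  have hmv : ∀ v ∈ Metric.ball (0 : E) ρ ∩ S, ∀ w ∈ Metric.ball (0 : E) ρ ∩ S,
      ‖(G w - w) - (G v - v)‖ ≤ 1 / (2 * K) * ‖w - v‖ := by
    intro v hv w hw
    have := ((convex_ball (0 : E) ρ).inter hSc).norm_image_sub_le_of_norm_hasFDerivWithin_le'
      (f := G) (fun z hz ↦ ((hG.differentiableOn (by simp) z
        ⟨hsub hz.1, hz.2⟩).hasFDerivWithinAt).mono (inter_subset_inter_left _ hsub)) hbd hv hw
    convert this using 2
    simp; abel
  set B : Set E := Metric.ball (0 : E) (ρ / K) with hB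
  have hretB : ∀ v ∈ B, ret v ∈ Metric.ball (0 : E) ρ ∩ S := by
    intro v hv
    refine ⟨?_, hretS v⟩
    have h1 := hretL v 0
    rw [hretid 0 h0S.2, sub_zero, sub_zero] at h1
    rw [hB, mem_ball_zero_iff, lt_div_iff₀ hKpos] at hv
    rw [mem_ball_zero_iff]
    linarith
  -- The extension is the identity plus a map with Lipschitz constant 1/2 on `B`, so it is
  -- invertible there; on the half space it is `G`.
  set G' : E → E := fun v ↦ v + (G (ret v) - ret v) with hG'
  have happ : ApproximatesLinearOn G' ((ContinuousLinearEquiv.refl ℝ E : E ≃L[ℝ] E) : E →L[ℝ] E) B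
      (1 / 2 : NNReal) := by
    intro v hv w hw
    have h1 := hmv _ (hretB w hw) _ (hretB v hv)
    have h2 := hretL v w
    have h3 : G' v - G' w - (ContinuousLinearEquiv.refl ℝ E : E →L[ℝ] E) (v - w) =
        (G (ret v) - ret v) - (G (ret w) - ret w) := by
      simp [hG']; abel
    rw [h3]
    refine h1.trans ?_
    calc 1 / (2 * K) * ‖ret v - ret w‖ ≤ 1 / (2 * K) * (K * ‖v - w‖) := by gcongr
      _ = ((1 / 2 : NNReal) : ℝ) * ‖v - w‖ := by
        push_cast
        field_simp
  have : Nontrivial E := ⟨⟨e, 0, fun h ↦ by simp [h] at he⟩⟩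
  have hN : (1 / 2 : NNReal) <
      ‖((ContinuousLinearEquiv.refl ℝ E).symm : E →L[ℝ] E)‖₊⁻¹ := by
    have : ‖((ContinuousLinearEquiv.refl ℝ E).symm : E →L[ℝ] E)‖₊ = 1 := by
      simp
    rw [this, inv_one]
    exact NNReal.half_lt_self one_ne_zero
  set Φ := happ.toOpenPartialHomeomorph G' B (Or.inr hN) Metric.isOpen_ball with hΦ
  have hBρ : B ⊆ Metric.ball 0 ρ := by
    refine Metric.ball_subset_ball (div_le_self hρpos.le ?_)
    rw [hK]
    have := mul_nonneg (norm_nonneg l) (norm_nonneg e)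
    linarith
  have hΦG : ∀ v ∈ B, v ∈ S → Φ v = G v := fun v _ hvS ↦ by
    change G' v = G v
    simp [hG', hretid v hvS]
  have hΦS : ∀ v ∈ B, Φ v ∈ S ↔ v ∈ S := by
    intro v hv
    refine ⟨fun h ↦ ?_, fun h ↦ by rw [hΦG v hv h]; exact hpos v (hsub (hBρ hv)) h⟩
    -- Off the half space `ret v` lies on the wall, which `G` preserves, so the extension keeps the
    -- negative value `l v`.
    by_contra hvS
    have hlt : l v < 0 := not_le.1 hvS
    have hl0 : l (ret v) = 0 := by simp [hret, he, min_eq_left hlt.le]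
    have h2 := hzero _ (hsub (hretB v hv).1) hl0
    have : l (Φ v) = l v := by
      change l (G' v) = l v
      simp [hG', h2, hl0]
    exact hvS (show 0 ≤ l v by rw [← this]; exact h)
  refine ⟨Φ, Metric.mem_ball_self (by positivity), hBρ.trans hsub, hΦG, hΦS, ?_⟩
  have hmaps : MapsTo Φ.symm (Φ.target ∩ S) (B ∩ S) := fun w hw ↦ by
    have h1 := Φ.map_target hw.1
    exact ⟨h1, (hΦS _ h1).1 (by rw [Φ.right_inv hw.1]; exact hw.2)⟩
  have huB : UniqueDiffOn ℝ (B ∩ S) := uniqueDiffOn_inter_halfSpace l hl Metric.isOpen_ball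
  refine contDiffOn_of_leftInverse (f := G) (s := B ∩ S)
    huB (uniqueDiffOn_inter_halfSpace l hl Φ.open_target)
    (hG.mono (inter_subset_inter_left _ (hBρ.trans hsub)))
    (Φ.continuousOn_symm.mono inter_subset_left) hmaps (fun w hw ↦ ?_) fun x hx ↦ ?_
  · rw [← hΦG _ (hmaps hw).1 (hmaps hw).2, Φ.right_inv hw.1]
  · have h1 : fderivWithin ℝ G (B ∩ S) x = fderivWithin ℝ G (O ∩ S) x :=
      ((hG.differentiableOn (by simp) x ⟨hsub (hBρ hx.1), hx.2⟩).hasFDerivWithinAt.mono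
        (inter_subset_inter_left _ (hBρ.trans hsub))).fderivWithin (huB x hx)
    have h2 := hbd x ⟨hBρ hx.1, hx.2⟩
    have h3 : ‖1 - fderivWithin ℝ G (O ∩ S) x‖ < 1 := by
      rw [norm_sub_rev]
      refine lt_of_le_of_lt h2 ?_
      rw [div_lt_one (by positivity)]
      have := mul_nonneg (norm_nonneg l) (norm_nonneg e)
      rw [hK]; linarith
    have h4 := isUnit_one_sub_of_norm_lt_one h3
    rw [sub_sub_cancel] at h4
    obtain ⟨u, hu⟩ := h4
    exact ⟨ContinuousLinearEquiv.unitsEquiv ℝ E u, by rw [h1, ← hu]; rfl⟩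

end BoundaryInverse
end

/-! ### The circle action and the boundary -/

noncomputable section

open Set Filter Topology

theorem mem_boundary_iff_extChartAt_eq_zero {n : ℕ} [NeZero n] {M : Type*} [TopologicalSpace M]
    [ChartedSpace (EuclideanHalfSpace n) M] [IsManifold (𝓡∂ n) ∞ M] {x y : M}
    (hy : y ∈ (chartAt (EuclideanHalfSpace n) x).source) :
    y ∈ (𝓡∂ n).boundary M ↔ extChartAt (𝓡∂ n) x y 0 = 0 := by
  have h0 : 0 ≤ extChartAt (𝓡∂ n) x y 0 := (chartAt (EuclideanHalfSpace n) x y).2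
  have := ModelWithCorners.isInteriorPoint_iff_of_mem_atlas (I := 𝓡∂ n) (n := ∞) (by simp)
    (chart_mem_atlas (EuclideanHalfSpace n) x) hy
  rw [← ModelWithCorners.compl_interior, mem_compl_iff, ModelWithCorners.interior, mem_ofPred_eq,
    this]
  have h1 : (extChartAt (𝓡∂ n) x y ∈ interior (range (𝓡∂ n))) ↔ 0 < extChartAt (𝓡∂ n) x y 0 := by
    rw [interior_range_modelWithCornersEuclideanHalfSpace]; rfl
  constructor
  · intro h
    by_contra hne
    exact h (OpenPartialHomeomorph.mem_interior_extend_target _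
      ((chartAt (EuclideanHalfSpace n) x).map_source hy) (h1.2 (lt_of_le_of_ne h0 (Ne.symm hne))))
  · intro h h2
    exact (h1.1 (OpenPartialHomeomorph.interior_extend_target_subset_interior_range _ h2)).ne' h

theorem zero_le_extChartAt_zero {n : ℕ} [NeZero n] {M : Type*} [TopologicalSpace M]
    [ChartedSpace (EuclideanHalfSpace n) M] (x y : M) : 0 ≤ extChartAt (𝓡∂ n) x y 0 :=
  (chartAt (EuclideanHalfSpace n) x y).2

namespace FreeCircleActionNearBoundary

variable {n : ℕ} [NeZero n] {M : Type*} [TopologicalSpace M]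
  [ChartedSpace (EuclideanHalfSpace n) M] (A : FreeCircleActionNearBoundary n M)

theorem contMDiffAt_act_prod (a : Circle) {x : M} (hx : x ∈ A.U) :
    ContMDiffAt ((𝓡 1).prod (𝓡∂ n)) (𝓡∂ n) ∞ (fun p : Circle × M ↦ A.act p.1 p.2) (a, x) :=
  A.smooth.contMDiffAt ((isOpen_univ.prod A.isOpen_U).mem_nhds ⟨mem_univ _, hx⟩)

theorem contMDiffAt_act (a : Circle) {x : M} (hx : x ∈ A.U) :
    ContMDiffAt (𝓡∂ n) (𝓡∂ n) ∞ (A.act a) x :=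
  (A.contMDiffAt_act_prod a hx).comp x (contMDiffAt_const.prodMk contMDiffAt_id)

theorem act_inv_act (a : Circle) {x : M} (hx : x ∈ A.U) : A.act a⁻¹ (A.act a x) = x := by
  rw [← A.mul_act _ _ _ hx, inv_mul_cancel, A.one_act _ hx]

theorem act_act_inv (a : Circle) {x : M} (hx : x ∈ A.U) : A.act a (A.act a⁻¹ x) = x := by
  rw [← A.mul_act _ _ _ hx, mul_inv_cancel, A.one_act _ hx]

theorem eq_of_act_eq {a b : Circle} {x : M} (hx : x ∈ A.U) (h : A.act a x = A.act b x) :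
    a = b := by
  have h1 : A.act (b⁻¹ * a) x = x := by rw [A.mul_act _ _ _ hx, h, A.act_inv_act b hx]
  have := A.free _ x hx h1
  rwa [inv_mul_eq_one, eq_comm] at this

theorem mfderiv_act_inv_comp [IsManifold (𝓡∂ n) ∞ M] (a : Circle) {x : M} (hx : x ∈ A.U) :
    (mfderiv (𝓡∂ n) (𝓡∂ n) (A.act a⁻¹) (A.act a x)).comp
      (mfderiv (𝓡∂ n) (𝓡∂ n) (A.act a) x) =
      ContinuousLinearMap.id ℝ (TangentSpace (𝓡∂ n) x) := by
  have h : A.act a⁻¹ ∘ A.act a =ᶠ[𝓝 x] id :=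
    eventually_of_mem (A.isOpen_U.mem_nhds hx) fun y hy ↦ A.act_inv_act a hy
  have := h.mfderiv_eq (I := 𝓡∂ n) (I' := 𝓡∂ n)
  rw [mfderiv_comp x ((A.contMDiffAt_act _ (A.act_mem a x hx)).mdifferentiableAt (by simp))
    ((A.contMDiffAt_act a hx).mdifferentiableAt (by simp)), mfderiv_id] at this
  exact this

theorem mfderiv_act_surjective [IsManifold (𝓡∂ n) ∞ M] (a : Circle) {x : M} (hx : x ∈ A.U) :
    Function.Surjective (mfderiv (𝓡∂ n) (𝓡∂ n) (A.act a) x) := by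
  intro v
  have h := A.mfderiv_act_inv_comp a⁻¹ (A.act_mem a x hx)
  rw [inv_inv, A.act_inv_act a hx] at h
  exact ⟨_, congr($h v)⟩

/-- The derivative of `act a` is onto, and a map with surjective derivative cannot carry an interior
point to the boundary. -/
theorem act_mem_interior [IsManifold (𝓡∂ n) ∞ M] (a : Circle) {x : M} (hx : x ∈ A.U)
    (h : x ∈ (𝓡∂ n).interior M) : A.act a x ∈ (𝓡∂ n).interior M :=
  ((A.contMDiffAt_act a hx).mdifferentiableAt
    (by simp)).isInteriorPoint_of_surjective_mfderiv (A.mfderiv_act_surjective a hx) h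

theorem act_mem_boundary_iff [IsManifold (𝓡∂ n) ∞ M] (a : Circle) {x : M} (hx : x ∈ A.U) :
    A.act a x ∈ (𝓡∂ n).boundary M ↔ x ∈ (𝓡∂ n).boundary M := by
  rw [← ModelWithCorners.compl_interior, mem_compl_iff, mem_compl_iff, not_iff_not]
  refine ⟨fun h ↦ ?_, A.act_mem_interior a hx⟩
  have := A.act_mem_interior a⁻¹ (A.act_mem a x hx) h
  rwa [A.act_inv_act a hx] at this

/-- Compactness of the circle makes the neighbourhoods on which `act a` stays in `W` uniform in `a`.
-/
theorem isOpen_forall_act_mem {W : Set M} (hW : IsOpen W) :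
    IsOpen {x | x ∈ A.U ∧ ∀ a, A.act a x ∈ W} := by
  rw [isOpen_iff_mem_nhds]
  rintro x ⟨hx, hxW⟩
  have : ∀ᶠ y in 𝓝 x, ∀ a ∈ (univ : Set Circle), A.act a y ∈ W := by
    refine isCompact_univ.eventually_forall_of_forall_eventually fun a _ ↦ ?_
    exact ((A.contMDiffAt_act_prod a hx).continuousAt.comp
      (f := fun z : M × Circle ↦ (z.2, z.1)) (x := (x, a))
      continuous_swap.continuousAt).preimage_mem_nhds (hW.mem_nhds (hxW a))
  filter_upwards [this, A.isOpen_U.mem_nhds hx] with y hy hyU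
  exact ⟨hyU, fun a ↦ hy a (mem_univ _)⟩

/-- The points whose whole orbit lies in `W` form such a neighbourhood; it contains the boundary
because the action preserves the boundary. -/
theorem exists_isInvariantNhd [IsManifold (𝓡∂ n) ∞ M] {W : Set M} (hW : IsOpen W)
    (hbW : (𝓡∂ n).boundary M ⊆ W) : ∃ V, A.IsInvariantNhd V ∧ V ⊆ W := by
  refine ⟨{x | x ∈ A.U ∧ ∀ a, A.act a x ∈ W}, ⟨A.isOpen_forall_act_mem hW, fun x hx ↦ ?_,
    fun x hx ↦ hx.1, fun a x hx ↦ ⟨A.act_mem a x hx.1, fun b ↦ ?_⟩⟩, fun x hx ↦ ?_⟩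
  · have := A.boundary_subset hx
    exact ⟨this, fun a ↦ hbW ((A.act_mem_boundary_iff a this).2 hx)⟩
  · rw [← A.mul_act _ _ _ hx.1]
    exact hx.2 _
  · simpa [A.one_act x hx.1] using hx.2 1

theorem isInvariantNhd_U : A.IsInvariantNhd A.U :=
  ⟨A.isOpen_U, A.boundary_subset, Subset.rfl, A.act_mem⟩

theorem IsInvariantNhd.inter {A : FreeCircleActionNearBoundary n M} {V W : Set M}
    (hV : A.IsInvariantNhd V) (hW : A.IsInvariantNhd W) : A.IsInvariantNhd (V ∩ W) :=
  ⟨hV.isOpen.inter hW.isOpen, subset_inter hV.boundary_subset hW.boundary_subset,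
    inter_subset_left.trans hV.subset_U, fun a x hx ↦ ⟨hV.act_mem a x hx.1, hW.act_mem a x hx.2⟩⟩

theorem contMDiffAt_exp_act_prod (s : ℝ) {x : M} (hx : x ∈ A.U) :
    ContMDiffAt (𝓘(ℝ, ℝ).prod (𝓡∂ n)) (𝓡∂ n) ∞
      (fun p : ℝ × M ↦ A.act (Circle.exp p.1) p.2) (s, x) :=
  (A.contMDiffAt_act_prod (Circle.exp s) hx).comp (s, x)
    ((contMDiff_circleExp.contMDiffAt.comp (s, x) contMDiffAt_fst).prodMk contMDiffAt_snd)

theorem contMDiff_exp_act {x : M} (hx : x ∈ A.U) :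
    ContMDiff 𝓘(ℝ, ℝ) (𝓡∂ n) ∞ (fun s : ℝ ↦ A.act (Circle.exp s) x) := fun s ↦
  (A.contMDiffAt_exp_act_prod s hx).comp s (contMDiffAt_id.prodMk contMDiffAt_const)

/-- The generating vector field of a free circle action does not vanish. -/
theorem deriv_extChartAt_exp_act_ne_zero [IsManifold (𝓡∂ n) ∞ M] {x : M} (hx : x ∈ A.U) :
    deriv (fun s : ℝ ↦ extChartAt (𝓡∂ n) x (A.act (Circle.exp s) x)) 0 ≠ 0 := by
  intro h0
  set γ : ℝ → M := fun s ↦ A.act (Circle.exp s) x with hγ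
  have hγs := A.contMDiff_exp_act hx
  have hγ0 : γ 0 = x := by simp [hγ, A.one_act x hx]
  have hchart : ∀ y ∈ (chartAt (EuclideanHalfSpace n) x).source,
      MDifferentiableAt (𝓡∂ n) 𝓘(ℝ, EuclideanSpace ℝ (Fin n)) (extChartAt (𝓡∂ n) x) y :=
    fun y hy ↦ (contMDiffAt_extChartAt' (n := ∞) hy).mdifferentiableAt (by simp)
  have hm : ∀ s : ℝ, γ s ∈ (chartAt (EuclideanHalfSpace n) x).source →
      deriv (fun s ↦ extChartAt (𝓡∂ n) x (γ s)) s =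
        mfderiv (𝓡∂ n) 𝓘(ℝ, EuclideanSpace ℝ (Fin n)) (extChartAt (𝓡∂ n) x) (γ s)
          (mfderiv 𝓘(ℝ, ℝ) (𝓡∂ n) γ s (1 : ℝ)) := by
    intro s hs
    have := mfderiv_comp s (hchart _ hs) (hγs.mdifferentiableAt (by simp) (x := s))
    rw [mfderiv_eq_fderiv] at this
    exact congr($this (1 : ℝ))
  have hx0 : γ 0 ∈ (chartAt (EuclideanHalfSpace n) x).source := by
    rw [hγ0]; exact mem_chart_source _ x
  have hz : mfderiv 𝓘(ℝ, ℝ) (𝓡∂ n) γ 0 (1 : ℝ) = 0 := by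
    have h1 := hm 0 hx0
    rw [h0] at h1
    have h2 := (isInvertible_mfderiv_extChartAt (I := 𝓡∂ n) (x := x) (y := γ 0)
      (by rw [extChartAt_source]; exact hx0)).injective
    exact h2 (h1.symm.trans (map_zero _).symm)
  -- Since `γ r` is `exp s` applied to `γ (r - s)`, vanishing of the velocity at time 0 spreads to
  -- every time `s`.
  have hall : ∀ s, mfderiv 𝓘(ℝ, ℝ) (𝓡∂ n) γ s (1 : ℝ) = 0 := by
    intro s
    obtain ⟨τ, hτ⟩ : ∃ τ : ℝ → ℝ, τ = fun r ↦ r - s := ⟨_, rfl⟩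
    have hτs : τ s = 0 := by simp [hτ]
    have h1 : γ = A.act (Circle.exp s) ∘ γ ∘ τ := by
      ext r
      simp only [hγ, hτ, Function.comp]
      rw [← A.mul_act _ _ _ hx, ← Circle.exp_add, add_sub_cancel]
    have hsub : MDifferentiableAt 𝓘(ℝ, ℝ) 𝓘(ℝ, ℝ) τ s := by
      rw [hτ]
      exact (differentiableAt_id.sub_const s).mdifferentiableAt
    have hγ' : MDifferentiableAt 𝓘(ℝ, ℝ) (𝓡∂ n) γ (τ s) := hγs.mdifferentiableAt (by simp)
    have hact : MDifferentiableAt (𝓡∂ n) (𝓡∂ n) (A.act (Circle.exp s)) ((γ ∘ τ) s) :=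
      (A.contMDiffAt_act _ (A.act_mem _ _ hx)).mdifferentiableAt (by simp)
    have h2 : mfderiv 𝓘(ℝ, ℝ) (𝓡∂ n) (A.act (Circle.exp s) ∘ γ ∘ τ) s (1 : ℝ) = 0 := by
      rw [mfderiv_comp s hact (hγ'.comp s hsub), mfderiv_comp s hγ' hsub, mfderiv_eq_fderiv]
      have h3 : (fderiv ℝ τ s) 1 = 1 := by simp [hτ]
      change mfderiv (𝓡∂ n) (𝓡∂ n) (A.act (Circle.exp s)) _
        (mfderiv 𝓘(ℝ, ℝ) (𝓡∂ n) γ (τ s) (fderiv ℝ τ s 1)) = 0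
      rw [h3, hτs]
      exact (congrArg _ hz).trans (map_zero _)
    rw [← h1] at h2
    exact h2
  obtain ⟨ε, hε, hball⟩ := Metric.mem_nhds_iff.1
    (hγs.continuous.continuousAt.preimage_mem_nhds
      ((chartAt (EuclideanHalfSpace n) x).open_source.mem_nhds hx0))
  -- Up to time `r` the curve stays in the chart and has velocity zero, so `γ r = γ 0`. As `0 < r ≤
  -- 1 < π`, this contradicts freeness.
  set r : ℝ := min (ε / 2) 1 with hr
  have hrpos : 0 < r := lt_min (by positivity) one_pos
  have hrball : r ∈ Metric.ball (0 : ℝ) ε := by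
    rw [mem_ball_zero_iff, Real.norm_of_nonneg hrpos.le]
    linarith [min_le_left (ε / 2) 1]
  have hdiff : ∀ s ∈ Metric.ball (0 : ℝ) ε,
      DifferentiableAt ℝ (fun s ↦ extChartAt (𝓡∂ n) x (γ s)) s := fun s hs ↦
    ((hchart _ (hball hs)).comp s (hγs.mdifferentiableAt (by simp))).differentiableAt
  have hconst : extChartAt (𝓡∂ n) x (γ r) = extChartAt (𝓡∂ n) x (γ 0) := by
    refine (convex_ball (0 : ℝ) ε).is_const_of_fderivWithin_eq_zero (𝕜 := ℝ)
      (f := fun s ↦ extChartAt (𝓡∂ n) x (γ s))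
      (fun s hs ↦ (hdiff s hs).differentiableWithinAt) (fun s hs ↦ ?_) hrball
      (Metric.mem_ball_self hε)
    rw [fderivWithin_of_isOpen Metric.isOpen_ball hs]
    ext
    rw [fderiv_apply_one_eq_deriv, hm s (hball hs), hall, map_zero]
    rfl
  have h3 : γ r = γ 0 := (extChartAt (𝓡∂ n) x).injOn (by rw [extChartAt_source]; exact hball hrball)
    (by rw [extChartAt_source]; exact hx0) hconst
  have h4 := A.eq_of_act_eq hx h3
  rw [Circle.exp_zero] at h4
  have h5 := Circle.arg_exp (x := r) (by linarith [Real.pi_pos])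
    (by linarith [min_le_right (ε / 2) 1, Real.pi_gt_three])
  rw [h4] at h5
  simp at h5
  exact hrpos.ne h5
end FreeCircleActionNearBoundary
end

/-! ### Slices transverse to the orbits -/

noncomputable section

open Set Filter Topology

/-- The space of the transversal boundary directions of a slice. -/
abbrev SliceSpace (n : ℕ) : Type := EuclideanSpace ℝ (Fin (n - 2))

/-- Splits ℝⁿ into the orbit direction `ξ`, the inward normal `e` and the common kernel of the
coordinate of index 0 and of the inner product with `ξ`. The dimension count yields `2 ≤ n`, which
is recorded because `n - 2` is a truncated subtraction. -/
theorem exists_continuousLinearEquiv_slice {n : ℕ} [NeZero n] {ξ : EuclideanSpace ℝ (Fin n)}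
    (hξ : ξ ≠ 0) (hξ0 : ξ 0 = 0) :
    2 ≤ n ∧ ∃ L : (ℝ × (SliceSpace n × ℝ)) ≃L[ℝ] EuclideanSpace ℝ (Fin n),
      (∀ s, L (s, 0) = s • ξ) ∧ ∀ v, L v 0 = v.2.2 := by
  set p : EuclideanSpace ℝ (Fin n) →ₗ[ℝ] ℝ :=
    (EuclideanSpace.proj (𝕜 := ℝ) (0 : Fin n) : EuclideanSpace ℝ (Fin n) →L[ℝ] ℝ).toLinearMap
    with hp
  set e : EuclideanSpace ℝ (Fin n) := EuclideanSpace.single 0 1 with he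
  have hpe : p e = 1 := by simp [hp, he]
  have hpξ : p ξ = 0 := by simpa [hp] using hξ0
  set q : EuclideanSpace ℝ (Fin n) →ₗ[ℝ] ℝ :=
    (‖ξ‖ ^ 2)⁻¹ • (innerSL ℝ ξ : EuclideanSpace ℝ (Fin n) →L[ℝ] ℝ).toLinearMap with hq
  have hqξ : q ξ = 1 := by
    have : ‖ξ‖ ≠ 0 := norm_ne_zero_iff.2 hξ
    simp [hq, this]
  set C : Submodule ℝ (EuclideanSpace ℝ (Fin n)) := LinearMap.ker p ⊓ LinearMap.ker q with hC
  have hmem : ∀ v, v - p v • e - q (v - p v • e) • ξ ∈ C := by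
    intro v
    simp [hC, hpe, hpξ, hqξ]
  let L : (ℝ × (C × ℝ)) ≃ₗ[ℝ] EuclideanSpace ℝ (Fin n) :=
    { toFun := fun v ↦ v.1 • ξ + v.2.1 + v.2.2 • e
      map_add' := fun v w ↦ by simp [add_smul]; abel
      map_smul' := fun c v ↦ by simp [mul_smul]
      invFun := fun v ↦ (q (v - p v • e), ⟨_, hmem v⟩, p v)
      left_inv := by
        rintro ⟨s, ⟨y, hy⟩, t⟩
        have h1 : p y = 0 := hy.1
        have h2 : q y = 0 := hy.2
        have h3 : p (s • ξ + y + t • e) = t := by simp [h1, hpe, hpξ]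
        have h4 : q (s • ξ + y + t • e - t • e) = s := by simp [h2, hqξ]
        simp only [h3, h4]
        ext <;> simp
      right_inv := fun v ↦ by simp }
  have hfin : Module.finrank ℝ C + 2 = n := by
    have := L.finrank_eq
    rw [Module.finrank_prod, Module.finrank_prod, finrank_euclideanSpace_fin,
      Module.finrank_self] at this
    omega
  have h2 : 2 ≤ n := by omega
  let K : SliceSpace n ≃ₗ[ℝ] C := LinearEquiv.ofFinrankEq _ _ (by
    rw [finrank_euclideanSpace_fin]; omega)
  let L' := ((LinearEquiv.refl ℝ ℝ).prodCongr (K.prodCongr (LinearEquiv.refl ℝ ℝ))).trans L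
  refine ⟨h2, L'.toContinuousLinearEquiv, fun s ↦ ?_, fun v ↦ ?_⟩
  · change s • ξ + (K 0 : EuclideanSpace ℝ (Fin n)) + (0 : ℝ) • e = _
    simp
  · change p (v.1 • ξ + (K v.2.1 : EuclideanSpace ℝ (Fin n)) + v.2.2 • e) = _
    have h1 : p (K v.2.1) = 0 := (K v.2.1).2.1
    simp [h1, hpe, hpξ]

namespace FreeCircleActionNearBoundary

variable {n : ℕ} [NeZero n] {M : Type*} [TopologicalSpace M]
  [ChartedSpace (EuclideanHalfSpace n) M] [IsManifold (𝓡∂ n) ∞ M]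
  (A : FreeCircleActionNearBoundary n M)

/-- Coordinates near a boundary point, adapted to the circle action. -/
theorem exists_local_slice {x₀ : M} (hx₀ : x₀ ∈ (𝓡∂ n).boundary M) :
    2 ≤ n ∧ ∃ (σ : SliceSpace n × ℝ → M) (N : Set (ℝ × (SliceSpace n × ℝ))) (O : Set M)
      (ψ : M → ℝ × (SliceSpace n × ℝ)), IsOpen N ∧ 0 ∈ N ∧ IsOpen O ∧ σ 0 = x₀ ∧ O ⊆ A.U ∧
      ContMDiffOn (𝓡∂ n) 𝓘(ℝ, ℝ × (SliceSpace n × ℝ)) ∞ ψ O ∧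
      (∀ x ∈ O, ψ x ∈ N ∧ 0 ≤ (ψ x).2.2 ∧ A.act (Circle.exp (ψ x).1) (σ (ψ x).2) = x) ∧
      ∀ v ∈ N, 0 ≤ v.2.2 → σ v.2 ∈ A.U ∧ (σ v.2 ∈ (𝓡∂ n).boundary M ↔ v.2.2 = 0) ∧
        A.act (Circle.exp v.1) (σ v.2) ∈ O ∧ ψ (A.act (Circle.exp v.1) (σ v.2)) = v ∧
        ContMDiffWithinAt 𝓘(ℝ, SliceSpace n × ℝ) (𝓡∂ n) ∞ σ {d | 0 ≤ d.2} v.2 := by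
  have hx₀U := A.boundary_subset hx₀
  set φ := extChartAt (𝓡∂ n) x₀ with hφ
  set p₀ := φ x₀ with hp₀
  have hp0 : p₀ 0 = 0 := (mem_boundary_iff_extChartAt_eq_zero (mem_chart_source _ x₀)).1 hx₀
  have hsrc : IsOpen φ.source := isOpen_extChartAt_source x₀
  have hbdry : ∀ y ∈ φ.source, y ∈ (𝓡∂ n).boundary M ↔ φ y 0 = 0 := fun y hy ↦
    mem_boundary_iff_extChartAt_eq_zero (by rwa [hφ, extChartAt_source] at hy)
  set γ : ℝ → M := fun s ↦ A.act (Circle.exp s) x₀ with hγ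
  have hγs := A.contMDiff_exp_act hx₀U
  have hγ0 : γ 0 = x₀ := by simp [hγ, A.one_act x₀ hx₀U]
  have hφγ : DifferentiableAt ℝ (fun s ↦ φ (γ s)) 0 := by
    have h1 : ContMDiffAt (𝓡∂ n) 𝓘(ℝ, EuclideanSpace ℝ (Fin n)) ∞ φ (γ 0) := by
      rw [hγ0]; exact contMDiffAt_extChartAt
    exact ((h1.comp 0 hγs.contMDiffAt).mdifferentiableAt (by simp)).differentiableAt
  set ξ : EuclideanSpace ℝ (Fin n) := deriv (fun s ↦ φ (γ s)) 0 with hξdef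
  have hξ : ξ ≠ 0 := A.deriv_extChartAt_exp_act_ne_zero hx₀U
  have hξ0 : ξ 0 = 0 := by
    have h1 := (EuclideanSpace.proj (𝕜 := ℝ) (0 : Fin n) :
      EuclideanSpace ℝ (Fin n) →L[ℝ] ℝ).hasFDerivAt.comp_hasDerivAt (0 : ℝ) hφγ.hasDerivAt
    have h2 : (fun s ↦ φ (γ s) 0) =ᶠ[𝓝 0] fun _ ↦ (0 : ℝ) := by
      have : ∀ᶠ s in 𝓝 (0 : ℝ), γ s ∈ φ.source :=
        hγs.continuous.continuousAt.preimage_mem_nhds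
          (hsrc.mem_nhds (by change γ 0 ∈ _; rw [hγ0]; exact mem_extChartAt_source x₀))
      filter_upwards [this] with s hs
      exact (hbdry _ hs).1 ((A.act_mem_boundary_iff _ hx₀U).2 hx₀)
    exact h1.unique ((hasDerivAt_const (0 : ℝ) (0 : ℝ)).congr_of_eventuallyEq h2)
  obtain ⟨hn, L, hLξ, hL0⟩ := exists_continuousLinearEquiv_slice hξ hξ0
  refine ⟨hn, ?_⟩
  set J : (SliceSpace n × ℝ) →L[ℝ] EuclideanSpace ℝ (Fin n) :=
    (L : (ℝ × (SliceSpace n × ℝ)) →L[ℝ] EuclideanSpace ℝ (Fin n)).comp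
      (ContinuousLinearMap.inr ℝ ℝ (SliceSpace n × ℝ)) with hJ
  have hJ0 : ∀ d, J d 0 = d.2 := fun d ↦ hL0 (0, d)
  -- An affine slice in the chart at `x₀`, transverse to the orbit; its last parameter is the chart
  -- coordinate of index 0, so the boundary is at parameter 0.
  set σ : SliceSpace n × ℝ → M := fun d ↦ φ.symm (p₀ + J d) with hσ
  set S' : Set (SliceSpace n × ℝ) := {d | 0 ≤ d.2} with hS'
  set S : Set (ℝ × (SliceSpace n × ℝ)) := {v | 0 ≤ v.2.2} with hS
  have hrange : ∀ d ∈ S', p₀ + J d ∈ range (𝓡∂ n) := by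
    intro d hd
    rw [range_modelWithCornersEuclideanHalfSpace, mem_ofPred_eq, PiLp.add_apply, hp0, hJ0, zero_add]
    exact hd
  have hσ0 : σ 0 = x₀ := by
    simp only [hσ, map_zero, add_zero]
    exact extChartAt_to_inv x₀
  have hσsm : ∀ d ∈ S', p₀ + J d ∈ φ.target →
      ContMDiffWithinAt 𝓘(ℝ, SliceSpace n × ℝ) (𝓡∂ n) ∞ σ S' d := by
    intro d _ hdt
    have h1 : ContMDiffWithinAt 𝓘(ℝ, EuclideanSpace ℝ (Fin n)) (𝓡∂ n) ∞ φ.symm (range (𝓡∂ n))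
        (p₀ + J d) := contMDiffWithinAt_extChartAt_symm_range x₀ hdt
    refine h1.comp (f := fun d ↦ p₀ + J d) d ?_ hrange
    exact ((contDiff_const.add J.contDiff).contMDiff).contMDiffAt.contMDiffWithinAt
  have htarget : ∀ᶠ d in 𝓝[S'] (0 : SliceSpace n × ℝ), p₀ + J d ∈ φ.target := by
    have h1 : Tendsto (fun d ↦ p₀ + J d) (𝓝[S'] 0) (𝓝[range (𝓡∂ n)] p₀) := by
      refine tendsto_nhdsWithin_iff.2 ⟨?_, eventually_of_mem self_mem_nhdsWithin hrange⟩
      have : Continuous fun d ↦ p₀ + J d := by fun_prop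
      simpa using (this.tendsto 0).mono_left nhdsWithin_le_nhds
    exact h1 (extChartAt_target_mem_nhdsWithin x₀)
  have h0S' : (0 : SliceSpace n × ℝ) ∈ S' := by simp [hS']
  have h0S : (0 : ℝ × (SliceSpace n × ℝ)) ∈ S := by simp [hS]
  have hσc : ContinuousWithinAt σ S' 0 :=
    (hσsm 0 h0S' (by rw [map_zero, add_zero]; exact mem_extChartAt_target x₀)).continuousWithinAt
  have hσU : ∀ᶠ d in 𝓝[S'] (0 : SliceSpace n × ℝ), σ d ∈ A.U :=
    hσc.preimage_mem_nhdsWithin (A.isOpen_U.mem_nhds (by rw [hσ0]; exact hx₀U))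
  have hsnd : Tendsto (fun v : ℝ × (SliceSpace n × ℝ) ↦ v.2) (𝓝[S] 0) (𝓝[S'] 0) :=
    tendsto_nhdsWithin_iff.2 ⟨(continuous_snd.tendsto 0).mono_left nhdsWithin_le_nhds,
      eventually_of_mem self_mem_nhdsWithin fun v hv ↦ hv⟩
  set F : ℝ × (SliceSpace n × ℝ) → M := fun v ↦ A.act (Circle.exp v.1) (σ v.2) with hF
  have hF0 : F 0 = x₀ := by simp [hF, hσ0, A.one_act x₀ hx₀U]
  have hFsm : ∀ v ∈ S, p₀ + J v.2 ∈ φ.target → σ v.2 ∈ A.U →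
      ContMDiffWithinAt 𝓘(ℝ, ℝ × (SliceSpace n × ℝ)) (𝓡∂ n) ∞ F S v := by
    intro v hv hvt hvU
    have h1 : ContMDiffWithinAt 𝓘(ℝ, ℝ × (SliceSpace n × ℝ)) (𝓡∂ n) ∞ (fun v ↦ σ v.2) S v :=
      (hσsm v.2 hv hvt).comp (f := fun v : ℝ × (SliceSpace n × ℝ) ↦ v.2) v
        (contDiff_snd.contMDiff.contMDiffAt.contMDiffWithinAt) fun w hw ↦ hw
    exact (A.contMDiffAt_exp_act_prod v.1 hvU).comp_contMDiffWithinAt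
      (f := fun v ↦ (v.1, σ v.2)) v
      ((contDiff_fst.contMDiff.contMDiffAt.contMDiffWithinAt).prodMk h1)
  have hFsrc : ∀ᶠ v in 𝓝[S] (0 : ℝ × (SliceSpace n × ℝ)), F v ∈ φ.source := by
    refine (hFsm 0 h0S ?_ ?_).continuousWithinAt.preimage_mem_nhdsWithin (hsrc.mem_nhds ?_)
    · rw [Prod.snd_zero, map_zero, add_zero]; exact mem_extChartAt_target x₀
    · simpa [hσ0] using hx₀U
    · rw [hF0]; exact mem_extChartAt_source x₀
  obtain ⟨O₀, hO₀, hO₀0, hO₀Q⟩ : ∃ O₀ : Set (ℝ × (SliceSpace n × ℝ)), IsOpen O₀ ∧ 0 ∈ O₀ ∧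
      ∀ v ∈ O₀ ∩ S, p₀ + J v.2 ∈ φ.target ∧ σ v.2 ∈ A.U ∧ F v ∈ φ.source := by
    have := (hsnd.eventually htarget).and ((hsnd.eventually hσU).and hFsrc)
    obtain ⟨O₀, h1, h2, h3⟩ := mem_nhdsWithin.1 this
    exact ⟨O₀, h1, h2, h3⟩
  -- The chart expression of `F`, corrected by an affine map so that its derivative at 0 is the
  -- identity.
  set G : ℝ × (SliceSpace n × ℝ) → ℝ × (SliceSpace n × ℝ) := fun v ↦ L.symm (φ (F v) - p₀) with hG
  set l : (ℝ × (SliceSpace n × ℝ)) →L[ℝ] ℝ :=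
    (ContinuousLinearMap.snd ℝ (SliceSpace n) ℝ).comp
      (ContinuousLinearMap.snd ℝ ℝ (SliceSpace n × ℝ)) with hl
  have hlL : ∀ w, l (L.symm w) = w 0 := fun w ↦ by
    have := hL0 (L.symm w)
    rw [L.apply_symm_apply] at this
    exact this.symm
  have hGl : ∀ v, l (G v) = φ (F v) 0 := fun v ↦ by
    simp only [hG]
    rw [hlL, PiLp.sub_apply, hp0, sub_zero]
  have hφσ : ∀ d, p₀ + J d ∈ φ.target → φ (σ d) = p₀ + J d := fun d hd ↦ φ.right_inv hd
  have hσb : ∀ d, p₀ + J d ∈ φ.target → (σ d ∈ (𝓡∂ n).boundary M ↔ d.2 = 0) := by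
    intro d hd
    rw [hbdry _ (φ.map_target hd), hφσ d hd, PiLp.add_apply, hp0, hJ0, zero_add]
  have hGsm : ContDiffOn ℝ ∞ G (O₀ ∩ S) := by
    intro v hv
    obtain ⟨h1, h2, h3⟩ := hO₀Q v hv
    have h4 : ContMDiffWithinAt 𝓘(ℝ, ℝ × (SliceSpace n × ℝ)) 𝓘(ℝ, EuclideanSpace ℝ (Fin n)) ∞
        (fun v ↦ φ (F v)) (O₀ ∩ S) v := by
      have h5 : ContMDiffAt (𝓡∂ n) 𝓘(ℝ, EuclideanSpace ℝ (Fin n)) ∞ φ (F v) :=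
        contMDiffAt_extChartAt' (by rwa [hφ, extChartAt_source] at h3)
      exact h5.comp_contMDiffWithinAt v ((hFsm v hv.2 h1 h2).mono inter_subset_right)
    exact L.symm.contDiff.contDiffAt.comp_contDiffWithinAt v
      (h4.contDiffWithinAt.sub contDiffWithinAt_const)
  have hGpos : ∀ v ∈ O₀, 0 ≤ l v → 0 ≤ l (G v) := fun v _ _ ↦ by
    rw [hGl]; exact zero_le_extChartAt_zero _ _
  have hGzero : ∀ v ∈ O₀, l v = 0 → l (G v) = 0 := by
    intro v hv hlv
    obtain ⟨h1, h2, h3⟩ := hO₀Q v ⟨hv, hlv.ge⟩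
    rw [hGl, ← hbdry _ h3]
    exact (A.act_mem_boundary_iff _ h2).2 ((hσb _ h1).2 hlv)
  have hl0 : l ≠ 0 := fun h ↦ by
    simpa [hl] using congr($h ((0 : ℝ), ((0 : SliceSpace n), (1 : ℝ))))
  have hu : UniqueDiffOn ℝ (O₀ ∩ S) := uniqueDiffOn_inter_halfSpace l hl0 hO₀
  have hGd : HasFDerivWithinAt G (ContinuousLinearMap.id ℝ _) (O₀ ∩ S) 0 := by
    have h1 := (hGsm.differentiableOn (by simp) 0 ⟨hO₀0, h0S⟩).hasFDerivWithinAt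
    set A' := fderivWithin ℝ G (O₀ ∩ S) 0 with hA'
    -- In the orbit direction the derivative is determined by `L.symm ξ = (1, 0)`; in the slice
    -- directions `G (0, d) = (0, d)` holds exactly.
    have h2 : ∀ s : ℝ, A' (s, 0) = (s, 0) := by
      intro s
      have h3 : HasDerivAt (fun s : ℝ ↦ G (s, 0)) (L.symm ξ) 0 := by
        have : (fun s : ℝ ↦ G (s, 0)) = fun s ↦ L.symm (φ (γ s) - p₀) := by
          funext s
          simp [hG, hF, hσ0, hγ]
        rw [this]
        exact L.symm.hasFDerivAt.comp_hasDerivAt (0 : ℝ) (hφγ.hasDerivAt.sub_const p₀)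
      have h4 : HasDerivWithinAt (fun s : ℝ ↦ ((s, 0) : ℝ × (SliceSpace n × ℝ)))
          ((1, 0) : ℝ × (SliceSpace n × ℝ)) ((fun s : ℝ ↦ ((s, 0) : ℝ × (SliceSpace n × ℝ))) ⁻¹'
            (O₀ ∩ S)) 0 :=
        (hasDerivAt_id (0 : ℝ)).hasDerivWithinAt.prodMk (hasDerivWithinAt_const _ _ _)
      have h5 := h1.comp_hasDerivWithinAt (0 : ℝ) h4 (fun s hs ↦ hs)
      have hmem : (fun s : ℝ ↦ ((s, 0) : ℝ × (SliceSpace n × ℝ))) ⁻¹' (O₀ ∩ S) ∈ 𝓝 (0 : ℝ) := by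
        have hc : Continuous fun s : ℝ ↦ ((s, 0) : ℝ × (SliceSpace n × ℝ)) := by fun_prop
        filter_upwards [hc.continuousAt.preimage_mem_nhds (hO₀.mem_nhds hO₀0)] with s hs
        exact ⟨hs, by simp [hS]⟩
      have h6 := (h5.hasDerivAt hmem).unique h3
      have h7 : L.symm ξ = (1, 0) := by
        rw [L.symm_apply_eq, hLξ, one_smul]
      rw [h7] at h6
      have : ((s, 0) : ℝ × (SliceSpace n × ℝ)) = s • (1, 0) := by simp
      rw [this, map_smul, h6]
    have h3 : A'.comp (ContinuousLinearMap.inr ℝ ℝ (SliceSpace n × ℝ)) =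
        ContinuousLinearMap.inr ℝ ℝ (SliceSpace n × ℝ) := by
      set R : Set (SliceSpace n × ℝ) := (fun d ↦ ((0, d) : ℝ × (SliceSpace n × ℝ))) ⁻¹' (O₀ ∩ S)
        with hR
      have h4 : HasFDerivWithinAt (fun d : SliceSpace n × ℝ ↦ G (0, d)) (A'.comp
          (ContinuousLinearMap.inr ℝ ℝ (SliceSpace n × ℝ))) R 0 :=
        h1.comp (0 : SliceSpace n × ℝ) (hasFDerivAt_prodMk_right (0 : ℝ) 0).hasFDerivWithinAt
          fun d hd ↦ hd
      have h5 : HasFDerivWithinAt (fun d : SliceSpace n × ℝ ↦ G (0, d))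
          (ContinuousLinearMap.inr ℝ ℝ (SliceSpace n × ℝ)) R 0 := by
        have h6 : ∀ d ∈ R, G (0, d) = ContinuousLinearMap.inr ℝ ℝ (SliceSpace n × ℝ) d := by
          intro d hd
          obtain ⟨h7, h8, -⟩ := hO₀Q _ hd
          simp only [hG, hF, Circle.exp_zero]
          rw [A.one_act _ h8, hφσ _ h7, add_sub_cancel_left, L.symm_apply_eq]
          rfl
        exact ((ContinuousLinearMap.inr ℝ ℝ (SliceSpace n × ℝ)).hasFDerivAt.hasFDerivWithinAt).congr
          h6 (h6 0 ⟨hO₀0, h0S⟩)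
      have hRu : UniqueDiffWithinAt ℝ R 0 := by
        have : R = ((fun d ↦ ((0, d) : ℝ × (SliceSpace n × ℝ))) ⁻¹' O₀) ∩
            {d | 0 ≤ ContinuousLinearMap.snd ℝ (SliceSpace n) ℝ d} := rfl
        rw [this]
        refine uniqueDiffOn_inter_halfSpace _ (fun h ↦ ?_) (hO₀.preimage (by fun_prop)) 0
          ⟨hO₀0, by simp⟩
        simpa using congr($h ((0 : SliceSpace n), (1 : ℝ)))
      exact hRu.eq h4 h5
    have h4 : A' = ContinuousLinearMap.id ℝ _ := by
      refine ContinuousLinearMap.ext fun v ↦ ?_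
      have : v = (v.1, 0) + (0, v.2) := by simp
      rw [this, map_add, h2, ContinuousLinearMap.id_apply]
      congr 1
      exact congr($h3 v.2)
    rw [← h4]
    exact h1
  obtain ⟨Φ, hΦ0, hΦO, hΦG, hΦS, hΦsm⟩ := exists_openPartialHomeomorph_halfSpace l (0, (0, 1)) rfl
    hO₀ hO₀0 hGsm hGd hGpos hGzero
  have hΦO' : ∀ v ∈ Φ.source ∩ S, v ∈ O₀ ∩ S := fun v hv ↦ ⟨hΦO hv.1, hv.2⟩
  set w : M → ℝ × (SliceSpace n × ℝ) := fun x ↦ L.symm (φ x - p₀) with hw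
  have hwS : ∀ x, w x ∈ S := fun x ↦ by
    change 0 ≤ l (w x)
    simp only [hw]
    rw [hlL, PiLp.sub_apply, hp0, sub_zero]
    exact zero_le_extChartAt_zero _ _
  have hwsm : ContMDiffOn (𝓡∂ n) 𝓘(ℝ, ℝ × (SliceSpace n × ℝ)) ∞ w φ.source := by
    have h1 : ContMDiffOn (𝓡∂ n) 𝓘(ℝ, EuclideanSpace ℝ (Fin n)) ∞ φ φ.source := by
      rw [hφ, extChartAt_source]; exact contMDiffOn_extChartAt
    exact (L.symm.contDiff.comp (contDiff_id.sub contDiff_const)).contMDiff.comp_contMDiffOn h1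
  set O : Set M := A.U ∩ (φ.source ∩ w ⁻¹' Φ.target) with hO
  have hmap : ∀ x ∈ O, Φ.symm (w x) ∈ Φ.source ∩ S := fun x hx ↦ by
    have := Φ.map_target hx.2.2
    exact ⟨this, (hΦS _ this).1 (by rw [Φ.right_inv hx.2.2]; exact hwS x)⟩
  refine ⟨σ, Φ.source, O, fun x ↦ Φ.symm (w x), Φ.open_source, hΦ0,
    A.isOpen_U.inter (hwsm.continuousOn.isOpen_inter_preimage hsrc Φ.open_target), hσ0,
    inter_subset_left, ?_, ?_, ?_⟩
  · exact hΦsm.contMDiffOn.comp (hwsm.mono fun x hx ↦ hx.2.1) fun x hx ↦ ⟨hx.2.2, hwS x⟩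
  · intro x hx
    obtain ⟨h1, h2⟩ := hmap x hx
    refine ⟨h1, h2, ?_⟩
    have h3 := hΦG _ h1 h2
    rw [Φ.right_inv hx.2.2] at h3
    have h4 := L.symm.injective h3
    exact (φ.injOn hx.2.1 (hO₀Q _ (hΦO' _ ⟨h1, h2⟩)).2.2 (sub_left_injective h4)).symm
  · intro v hv hvS
    obtain ⟨h1, h2, h3⟩ := hO₀Q v (hΦO' _ ⟨hv, hvS⟩)
    have h4 : w (F v) = Φ v := (hΦG v hv hvS).symm
    refine ⟨h2, hσb _ h1, ⟨A.act_mem _ _ h2, h3, ?_⟩, ?_, hσsm _ hvS h1⟩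
    · rw [mem_preimage, h4]; exact Φ.map_source hv
    · change Φ.symm (w (F v)) = v
      rw [h4, Φ.left_inv hv]
end FreeCircleActionNearBoundary
end

/-! ### Equivariant tubes around boundary orbits -/

noncomputable section

open Set Filter Topology

namespace FreeCircleActionNearBoundary

variable {n : ℕ} [NeZero n] {M : Type*} [TopologicalSpace M]
  [ChartedSpace (EuclideanHalfSpace n) M]
  (A : FreeCircleActionNearBoundary n M)

/-- An equivariant tubular neighbourhood of a circle orbit in the boundary: an equivariant
diffeomorphism from `Circle × (D ∩ {t ≥ 0})` onto an open subset of the manifold. -/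
structure Tube where
  two_le : 2 ≤ n
  D : Set (SliceSpace n × ℝ)
  isOpen_D : IsOpen D
  convex_D : Convex ℝ D
  proj_mem : ∀ d ∈ D, 0 ≤ d.2 → (d.1, (0 : ℝ)) ∈ D
  zero_mem : 0 ∈ D
  σ : SliceSpace n × ℝ → M
  contMDiffOn_σ : ContMDiffOn 𝓘(ℝ, SliceSpace n × ℝ) (𝓡∂ n) ∞ σ (D ∩ {d | 0 ≤ d.2})
  σ_mem : ∀ d ∈ D ∩ {d | 0 ≤ d.2}, σ d ∈ A.U
  σ_mem_boundary_iff : ∀ d ∈ D ∩ {d | 0 ≤ d.2}, σ d ∈ (𝓡∂ n).boundary M ↔ d.2 = 0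
  ang : M → Circle
  co : M → SliceSpace n × ℝ
  ang_act : ∀ a, ∀ d ∈ D ∩ {d | 0 ≤ d.2}, ang (A.act a (σ d)) = a
  co_act : ∀ a, ∀ d ∈ D ∩ {d | 0 ≤ d.2}, co (A.act a (σ d)) = d
  T : Set M
  isOpen_T : IsOpen T
  mem_T_iff : ∀ x, x ∈ T ↔ ∃ a, ∃ d ∈ D ∩ {d | 0 ≤ d.2}, A.act a (σ d) = x
  contMDiffOn_ang : ContMDiffOn (𝓡∂ n) 𝓘(ℝ, ℂ) ∞ (fun x ↦ (ang x : ℂ)) T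
  contMDiffOn_co : ContMDiffOn (𝓡∂ n) 𝓘(ℝ, SliceSpace n × ℝ) ∞ co T

/-- A slice theorem: local slice coordinates extend along the whole orbit once only the identity can
carry a point of the slice into the slice. Group elements near 1 are controlled by the local
coordinates. The remaining ones form a compact set and are excluded, for a small slice, by freeness
and the Hausdorff property. -/
theorem exists_tube [T2Space M] [IsManifold (𝓡∂ n) ∞ M] {V : Set M} (hV : A.IsInvariantNhd V)
    {x₀ : M} (hx₀ : x₀ ∈ (𝓡∂ n).boundary M) : ∃ τ : A.Tube, τ.σ 0 = x₀ ∧ τ.T ⊆ V := by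
  obtain ⟨hn, σ, N, O, ψ, hN, hN0, hO, hσ0, hOU, hψ, hψO, hψN⟩ := A.exists_local_slice hx₀
  have hx₀U := A.boundary_subset hx₀
  set S : Set (SliceSpace n × ℝ) := {d | 0 ≤ d.2} with hS
  have h0S : (0 : SliceSpace n × ℝ) ∈ S := by simp [hS]
  have hσc : Tendsto σ (𝓝[S] 0) (𝓝 x₀) := by
    have := (hψN 0 hN0 le_rfl).2.2.2.2.continuousWithinAt
    rwa [ContinuousWithinAt, Prod.snd_zero, hσ0] at this
  obtain ⟨δ, hδ, hball⟩ := Metric.isOpen_iff.1 hN 0 hN0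
  have hargc : ContinuousAt (fun a : Circle ↦ Complex.arg a) 1 :=
    (Complex.continuousAt_arg (by simp)).comp
      (f := fun a : Circle ↦ (a : ℂ)) (by fun_prop : Continuous fun a : Circle ↦ (a : ℂ)).continuousAt
  obtain ⟨Q, hQarg, hQ, hQ1⟩ := mem_nhds_iff.1
    (hargc.preimage_mem_nhds (Metric.ball_mem_nhds _ hδ))
  have hfar : ∀ᶠ p in 𝓝 (x₀, x₀), ∀ a ∈ Qᶜ, A.act a p.1 ≠ p.2 := by
    refine hQ.isClosed_compl.isCompact.eventually_forall_of_forall_eventually fun a ha ↦ ?_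
    have h1 : ContinuousAt (fun z : (M × M) × Circle ↦ A.act z.2 z.1.1) ((x₀, x₀), a) :=
      (A.contMDiffAt_act_prod a hx₀U).continuousAt.comp
        (f := fun z : (M × M) × Circle ↦ (z.2, z.1.1)) (x := ((x₀, x₀), a)) (by fun_prop)
    have h2 : ContinuousAt (fun z : (M × M) × Circle ↦ z.1.2) ((x₀, x₀), a) := by fun_prop
    refine (h1.prodMk h2).preimage_mem_nhds (isClosed_diagonal.isOpen_compl.mem_nhds
      fun (h : A.act a x₀ = x₀) ↦ ha ?_)
    rw [A.free a x₀ hx₀U h]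
    exact hQ1
  obtain ⟨r₁, hr₁, hr₁V⟩ := Metric.mem_nhdsWithin_iff.1
    (hσc (hV.isOpen.mem_nhds (hV.boundary_subset hx₀)))
  have hfar' : ∀ᶠ d in 𝓝[S ×ˢ S] ((0, 0) : (SliceSpace n × ℝ) × (SliceSpace n × ℝ)),
      ∀ a ∈ Qᶜ, A.act a (σ d.1) ≠ σ d.2 := by
    rw [nhdsWithin_prod_eq]
    have : Tendsto (Prod.map σ σ) (𝓝[S] 0 ×ˢ 𝓝[S] 0) (𝓝 (x₀, x₀)) := by
      rw [nhds_prod_eq]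
      exact hσc.prodMap hσc
    exact this.eventually hfar
  obtain ⟨r₂, hr₂, hr₂far⟩ := Metric.mem_nhdsWithin_iff.1 hfar'
  set ρ := min δ (min r₁ r₂) with hρ
  have hρpos : 0 < ρ := lt_min hδ (lt_min hr₁ hr₂)
  set D : Set (SliceSpace n × ℝ) := Metric.ball 0 ρ with hD
  have hDN : ∀ d ∈ D, ∀ s : ℝ, |s| < δ → (s, d) ∈ N := by
    intro d hd s hs
    refine hball ?_
    rw [mem_ball_zero_iff, Prod.norm_def]
    refine max_lt hs ?_
    rw [hD, mem_ball_zero_iff] at hd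
    exact hd.trans_le (min_le_left _ _)
  have hDN0 : ∀ d ∈ D, ((0 : ℝ), d) ∈ N := fun d hd ↦ hDN d hd 0 (by simpa using hδ)
  have hinj₀ : ∀ a, ∀ d ∈ D ∩ S, ∀ d' ∈ D ∩ S, A.act a (σ d) = σ d' → a = 1 ∧ d = d' := by
    intro a d hd d' hd' h
    by_cases ha : a ∈ Q
    · have harg : |Complex.arg a| < δ := by
        have := hQarg ha
        simpa [mem_preimage] using this
      have h1 := (hψN _ (hDN d hd.1 _ harg) hd.2).2.2.2.1
      have h2 := hψN _ (hDN0 d' hd'.1) hd'.2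
      have h3 := h2.2.2.2.1
      simp only [Circle.exp_arg, Circle.exp_zero] at h1 h3
      rw [A.one_act _ h2.1, ← h, h1, Prod.mk.injEq] at h3
      refine ⟨?_, h3.2⟩
      rw [← Circle.exp_arg a, h3.1, Circle.exp_zero]
    · exfalso
      refine @hr₂far (d, d') ⟨?_, hd.2, hd'.2⟩ a ha h
      rw [Metric.mem_ball, Prod.dist_eq]
      refine max_lt ?_ ?_
      · exact (Metric.mem_ball.1 hd.1).trans_le ((min_le_right _ _).trans (min_le_right _ _))
      · exact (Metric.mem_ball.1 hd'.1).trans_le ((min_le_right _ _).trans (min_le_right _ _))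
  have hσU : ∀ d ∈ D ∩ S, σ d ∈ A.U := fun d hd ↦ (hψN _ (hDN0 d hd.1) hd.2).1
  have hinj : ∀ a, ∀ d ∈ D ∩ S, ∀ a', ∀ d' ∈ D ∩ S, A.act a (σ d) = A.act a' (σ d') →
      a = a' ∧ d = d' := by
    intro a d hd a' d' hd' h
    have h1 : A.act (a'⁻¹ * a) (σ d) = σ d' := by
      rw [A.mul_act _ _ _ (hσU d hd), h, A.act_inv_act _ (hσU d' hd')]
    obtain ⟨h2, h3⟩ := hinj₀ _ d hd d' hd' h1
    exact ⟨(inv_mul_eq_one.1 h2).symm, h3⟩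
  set T : Set M := {x | ∃ p : Circle × (SliceSpace n × ℝ), p.2 ∈ D ∩ S ∧
    A.act p.1 (σ p.2) = x} with hT
  classical
  -- The value `(1, 0)` off `T` is arbitrary.
  set χ : M → Circle × (SliceSpace n × ℝ) := fun x ↦ if h : x ∈ T then h.choose else (1, 0) with hχ
  have hχact : ∀ a, ∀ d ∈ D ∩ S, χ (A.act a (σ d)) = (a, d) := by
    intro a d hd
    have h : A.act a (σ d) ∈ T := ⟨(a, d), hd, rfl⟩
    simp only [hχ, dif_pos h]
    obtain ⟨h1, h2⟩ := h.choose_spec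
    obtain ⟨h3, h4⟩ := hinj _ _ h1 _ _ hd h2
    exact Prod.ext h3 h4
  -- On `O'` the local coordinates `ψ` describe the tube. Every point of the tube is moved into `O'`
  -- by a group element, which reduces smoothness of the angle and of the slice coordinates to that
  -- of `ψ`.
  set O' : Set M := O ∩ ψ ⁻¹' (univ ×ˢ D) with hO'
  have hO'o : IsOpen O' :=
    hψ.continuousOn.isOpen_inter_preimage hO (isOpen_univ.prod Metric.isOpen_ball)
  have hO'T : ∀ a, ∀ x ∈ O', A.act a x ∈ T ∧ χ (A.act a x) =
      (a * Circle.exp (ψ x).1, (ψ x).2) := by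
    intro a x hx
    obtain ⟨-, h2, h3⟩ := hψO x hx.1
    have h4 : (ψ x).2 ∈ D ∩ S := ⟨hx.2.2, h2⟩
    have h5 : A.act a x = A.act (a * Circle.exp (ψ x).1) (σ (ψ x).2) := by
      rw [A.mul_act _ _ _ (hσU _ h4), h3]
    rw [h5]
    exact ⟨⟨(_, _), h4, rfl⟩, hχact _ _ h4⟩
  have hσO' : ∀ d ∈ D ∩ S, σ d ∈ O' := by
    intro d hd
    have h1 := hψN _ (hDN0 d hd.1) hd.2
    simp only [Circle.exp_zero, A.one_act _ h1.1] at h1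
    exact ⟨h1.2.2.1, by rw [mem_preimage, h1.2.2.2.1]; exact ⟨mem_univ _, hd.1⟩⟩
  have hO'U : O' ⊆ A.U := inter_subset_left.trans hOU
  have hloc : ∀ a, ∀ d ∈ D ∩ S, ∀ᶠ x in 𝓝 (A.act a (σ d)), A.act a⁻¹ x ∈ O' ∧ x ∈ A.U := by
    intro a d hd
    refine Filter.Eventually.and
      ((A.contMDiffAt_act a⁻¹ (A.act_mem a _ (hσU d hd))).continuousAt.preimage_mem_nhds
      (hO'o.mem_nhds ?_)) (A.isOpen_U.mem_nhds (A.act_mem a _ (hσU d hd)))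
    rw [A.act_inv_act _ (hσU d hd)]
    exact hσO' d hd
  have hψact : ∀ a, ∀ d ∈ D ∩ S, ContMDiffAt (𝓡∂ n) 𝓘(ℝ, ℝ × (SliceSpace n × ℝ)) ∞
      (fun x ↦ ψ (A.act a⁻¹ x)) (A.act a (σ d)) := by
    intro a d hd
    have h1 := A.contMDiffAt_act a⁻¹ (A.act_mem a _ (hσU d hd))
    have h2 : ContMDiffAt (𝓡∂ n) 𝓘(ℝ, ℝ × (SliceSpace n × ℝ)) ∞ ψ
        (A.act a⁻¹ (A.act a (σ d))) := by
      rw [A.act_inv_act _ (hσU d hd)]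
      exact hψ.contMDiffAt (hO.mem_nhds (hσO' d hd).1)
    exact h2.comp _ h1
  refine ⟨⟨hn, D, Metric.isOpen_ball, convex_ball _ _, ?_, Metric.mem_ball_self hρpos, σ, ?_, hσU,
    fun d hd ↦ (hψN _ (hDN0 d hd.1) hd.2).2.1, fun x ↦ (χ x).1, fun x ↦ (χ x).2,
    fun a d hd ↦ by rw [hχact a d hd], fun a d hd ↦ by rw [hχact a d hd], T, ?_, ?_, ?_, ?_⟩,
    hσ0, ?_⟩
  · intro d hd _
    rw [hD, mem_ball_zero_iff] at hd ⊢
    refine lt_of_le_of_lt ?_ hd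
    rw [Prod.norm_def, Prod.norm_def]
    exact max_le (le_max_left _ _) (by simp)
  · exact fun d hd ↦ (hψN _ (hDN0 d hd.1) hd.2).2.2.2.2.mono inter_subset_right
  · rw [isOpen_iff_mem_nhds]
    rintro _ ⟨⟨a, d⟩, hd, rfl⟩
    filter_upwards [hloc a d hd] with x hx
    have := (hO'T a _ hx.1).1
    rwa [A.act_act_inv _ hx.2] at this
  · intro x
    constructor
    · rintro ⟨⟨a, d⟩, h1, h2⟩
      exact ⟨a, d, h1, h2⟩
    · rintro ⟨a, d, h1, h2⟩
      exact ⟨(a, d), h1, h2⟩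
  · rintro _ ⟨⟨a, d⟩, hd, rfl⟩
    refine ContMDiffAt.contMDiffWithinAt ?_
    have h1 : ContMDiffAt (𝓡∂ n) 𝓘(ℝ, ℂ) ∞ (fun x ↦ (a : ℂ) *
        Complex.exp ((ψ (A.act a⁻¹ x)).1 * Complex.I)) (A.act a (σ d)) := by
      have h2 : ContDiff ℝ ∞ (fun v : ℝ × (SliceSpace n × ℝ) ↦
          (a : ℂ) * Complex.exp (v.1 * Complex.I)) :=
        contDiff_const.mul (((Complex.ofRealCLM.contDiff.comp contDiff_fst).mul
          contDiff_const).cexp)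
      exact h2.contMDiff.contMDiffAt.comp _ (hψact a d hd)
    refine h1.congr_of_eventuallyEq ?_
    filter_upwards [hloc a d hd] with x hx
    have := (hO'T a _ hx.1).2
    rw [A.act_act_inv _ hx.2] at this
    rw [this, Circle.coe_mul, Circle.coe_exp]
  · rintro _ ⟨⟨a, d⟩, hd, rfl⟩
    refine ContMDiffAt.contMDiffWithinAt ?_
    refine ((contDiff_snd.contMDiff.contMDiffAt).comp _ (hψact a d hd)).congr_of_eventuallyEq ?_
    filter_upwards [hloc a d hd] with x hx
    have := (hO'T a _ hx.1).2
    rw [A.act_act_inv _ hx.2] at this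
    rw [this]
    rfl
  · rintro _ ⟨⟨a, d⟩, hd, rfl⟩
    refine hV.act_mem a _ (hr₁V ⟨?_, hd.2⟩)
    exact Metric.ball_subset_ball ((min_le_right _ _).trans (min_le_left _ _)) hd.1

namespace Tube
variable {A} (τ : A.Tube)

/-- The part of the parameter domain with nonnegative transversal coordinate. -/
def Dp : Set (SliceSpace n × ℝ) := τ.D ∩ {d | 0 ≤ d.2}

theorem act_mem_T (a : Circle) {d} (hd : d ∈ τ.Dp) : A.act a (τ.σ d) ∈ τ.T :=
  (τ.mem_T_iff _).2 ⟨a, d, hd, rfl⟩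

theorem σ_mem_T {d} (hd : d ∈ τ.Dp) : τ.σ d ∈ τ.T := by
  have := τ.act_mem_T 1 hd
  rwa [A.one_act _ (τ.σ_mem d hd)] at this

theorem T_subset_U : τ.T ⊆ A.U := by
  intro x hx
  obtain ⟨a, d, hd, rfl⟩ := (τ.mem_T_iff x).1 hx
  exact A.act_mem _ _ (τ.σ_mem d hd)

theorem act_mem_T_of_mem (a : Circle) {x} (hx : x ∈ τ.T) : A.act a x ∈ τ.T := by
  obtain ⟨b, d, hd, rfl⟩ := (τ.mem_T_iff x).1 hx
  rw [← A.mul_act _ _ _ (τ.σ_mem d hd)]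
  exact τ.act_mem_T _ hd

theorem co_mem {x} (hx : x ∈ τ.T) : τ.co x ∈ τ.Dp := by
  obtain ⟨b, d, hd, rfl⟩ := (τ.mem_T_iff x).1 hx
  rwa [τ.co_act _ _ hd]

theorem act_ang_σ_co {x} (hx : x ∈ τ.T) : A.act (τ.ang x) (τ.σ (τ.co x)) = x := by
  obtain ⟨b, d, hd, rfl⟩ := (τ.mem_T_iff x).1 hx
  rw [τ.co_act _ _ hd, τ.ang_act _ _ hd]

theorem ang_act_of_mem (a : Circle) {x} (hx : x ∈ τ.T) : τ.ang (A.act a x) = a * τ.ang x := by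
  obtain ⟨b, d, hd, rfl⟩ := (τ.mem_T_iff x).1 hx
  rw [← A.mul_act _ _ _ (τ.σ_mem d hd), τ.ang_act _ _ hd, τ.ang_act _ _ hd]

theorem co_act_of_mem (a : Circle) {x} (hx : x ∈ τ.T) : τ.co (A.act a x) = τ.co x := by
  obtain ⟨b, d, hd, rfl⟩ := (τ.mem_T_iff x).1 hx
  rw [← A.mul_act _ _ _ (τ.σ_mem d hd), τ.co_act _ _ hd, τ.co_act _ _ hd]

theorem ang_σ {d} (hd : d ∈ τ.Dp) : τ.ang (τ.σ d) = 1 := by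
  have := τ.ang_act 1 d hd
  rwa [A.one_act _ (τ.σ_mem d hd)] at this

theorem co_σ {d} (hd : d ∈ τ.Dp) : τ.co (τ.σ d) = d := by
  have := τ.co_act 1 d hd
  rwa [A.one_act _ (τ.σ_mem d hd)] at this

theorem mem_boundary_iff [IsManifold (𝓡∂ n) ∞ M] {x} (hx : x ∈ τ.T) :
    x ∈ (𝓡∂ n).boundary M ↔ (τ.co x).2 = 0 := by
  obtain ⟨b, d, hd, rfl⟩ := (τ.mem_T_iff x).1 hx
  rw [A.act_mem_boundary_iff _ (τ.σ_mem d hd), τ.co_act _ _ hd, τ.σ_mem_boundary_iff d hd]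

theorem mem_interior_iff [IsManifold (𝓡∂ n) ∞ M] {x} (hx : x ∈ τ.T) :
    x ∈ (𝓡∂ n).interior M ↔ 0 < (τ.co x).2 := by
  rw [← ModelWithCorners.compl_boundary, mem_compl_iff, τ.mem_boundary_iff hx]
  exact ⟨fun h ↦ lt_of_le_of_ne (τ.co_mem hx).2 (Ne.symm h), fun h ↦ h.ne'⟩

theorem zero_mem_Dp : 0 ∈ τ.Dp := ⟨τ.zero_mem, by simp⟩

theorem uniqueDiffOn_Dp : UniqueDiffOn ℝ τ.Dp :=
  uniqueDiffOn_inter_halfSpace (ContinuousLinearMap.snd ℝ (SliceSpace n) ℝ)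
    (fun h ↦ by simpa using congr($h ((0 : SliceSpace n), (1 : ℝ)))) τ.isOpen_D

end Tube
end FreeCircleActionNearBoundary
end

/-! ### Topology and charts of the cut space -/

noncomputable section

open Set Filter Topology

namespace FreeCircleActionNearBoundary

variable {n : ℕ} [NeZero n] {M : Type*} [TopologicalSpace M]
  [ChartedSpace (EuclideanHalfSpace n) M]
  (A : FreeCircleActionNearBoundary n M)

theorem c_eq_iff {x y : M} : A.c x = A.c y ↔ x = y ∨
    (x ∈ (𝓡∂ n).boundary M ∧ y ∈ (𝓡∂ n).boundary M ∧ ∃ a, A.act a x = y) :=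
  Quotient.eq (r := A.cutSetoid)

theorem isQuotientMap_c : IsQuotientMap A.c := isQuotientMap_quotient_mk'

theorem continuous_c : Continuous A.c := A.isQuotientMap_c.continuous

theorem surjective_c : Function.Surjective A.c := A.isQuotientMap_c.surjective

theorem c_act {a : Circle} {x : M} [IsManifold (𝓡∂ n) ∞ M] (hx : x ∈ (𝓡∂ n).boundary M) :
    A.c (A.act a x) = A.c x :=
  (A.c_eq_iff.2 (Or.inr ⟨hx, (A.act_mem_boundary_iff a (A.boundary_subset hx)).2 hx, a, rfl⟩)).symm

/-- A representative of a point of the cut space. -/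
def out (p : A.Cut) : M := Quotient.out (s := A.cutSetoid) p

theorem c_out (p : A.Cut) : A.c (A.out p) = p := Quotient.out_eq (s := A.cutSetoid) p

theorem eq_of_c_eq_of_interior {x y : M} (hx : x ∈ (𝓡∂ n).interior M) (h : A.c x = A.c y) :
    x = y := by
  rcases A.c_eq_iff.1 h with h | ⟨h, -⟩
  · exact h
  · rw [← ModelWithCorners.compl_boundary] at hx
    exact absurd h hx

theorem out_c_of_interior {x : M} (hx : x ∈ (𝓡∂ n).interior M) : A.out (A.c x) = x :=
  (A.eq_of_c_eq_of_interior hx (A.c_out _).symm).symm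

theorem preimage_image_c_of_subset_interior {O : Set M} (hO : O ⊆ (𝓡∂ n).interior M) :
    A.c ⁻¹' (A.c '' O) = O := by
  refine Subset.antisymm ?_ (subset_preimage_image _ _)
  rintro x ⟨y, hy, hyx⟩
  rwa [← A.eq_of_c_eq_of_interior (hO hy) hyx]

theorem isOpen_c_image_of_subset_interior {O : Set M} (hO : O ⊆ (𝓡∂ n).interior M)
    (hOo : IsOpen O) : IsOpen (A.c '' O) := by
  rw [← A.isQuotientMap_c.isOpen_preimage, A.preimage_image_c_of_subset_interior hO]
  exact hOo

theorem preimage_image_c_of_invariant {O : Set M} (hO : ∀ a, ∀ x ∈ O, A.act a x ∈ O) :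
    A.c ⁻¹' (A.c '' O) = O := by
  refine Subset.antisymm ?_ (subset_preimage_image _ _)
  rintro x ⟨y, hy, hyx⟩
  rcases A.c_eq_iff.1 hyx with rfl | ⟨-, -, a, rfl⟩
  · exact hy
  · exact hO a y hy

theorem isOpen_c_image_of_invariant {O : Set M} (hO : ∀ a, ∀ x ∈ O, A.act a x ∈ O)
    (hOo : IsOpen O) : IsOpen (A.c '' O) := by
  rw [← A.isQuotientMap_c.isOpen_preimage, A.preimage_image_c_of_invariant hO]
  exact hOo

section Topology
variable [IsManifold (𝓡∂ n) ∞ M]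

/-- The saturation of a closed set `C` adds to it the boundary points whose orbit meets `C`, and
these are the image of a closed set under the projection along the compact circle. -/
theorem isClosedMap_c : IsClosedMap A.c := by
  intro C hC
  rw [← A.isQuotientMap_c.isClosed_preimage]
  have hb : IsClosed ((𝓡∂ n).boundary M) := ModelWithCorners.isClosed_boundary (n := ∞) (by simp)
  have h1 : IsClosed ((univ ×ˢ (𝓡∂ n).boundary M) ∩
      (fun p : Circle × M ↦ A.act p.1 p.2) ⁻¹' C) :=
    ContinuousOn.preimage_isClosed_of_isClosed
      (A.smooth.continuousOn.mono (prod_mono_right A.boundary_subset)) (isClosed_univ.prod hb) hC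
  have h2 := isClosedMap_snd_of_compactSpace _ h1
  have h3 : A.c ⁻¹' (A.c '' C) = C ∪ Prod.snd '' ((univ ×ˢ (𝓡∂ n).boundary M) ∩
      (fun p : Circle × M ↦ A.act p.1 p.2) ⁻¹' C) := by
    ext x
    constructor
    · rintro ⟨y, hy, hyx⟩
      rcases A.c_eq_iff.1 hyx.symm with rfl | ⟨hx, -, a, rfl⟩
      · exact Or.inl hy
      · exact Or.inr ⟨(a, x), ⟨⟨mem_univ _, hx⟩, hy⟩, rfl⟩
    · rintro (hx | ⟨⟨a, y⟩, ⟨⟨-, hy⟩, hyC⟩, rfl⟩)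
      · exact ⟨x, hx, rfl⟩
      · exact ⟨_, hyC, A.c_act hy⟩
  rw [h3]
  exact hC.union h2

/-- Fibres are closed and `M` is normal, so two fibres have disjoint open neighbourhoods; a closed
map turns these into disjoint neighbourhoods of the two points. -/
theorem t2Space_cut [T2Space M] [SecondCountableTopology M] : T2Space A.Cut := by
  have : LocallyCompactSpace M := Manifold.locallyCompact_of_finiteDimensional (𝓡∂ n)
  have hfib : ∀ p : A.Cut, IsClosed (A.c ⁻¹' {p}) := fun p ↦ by
    obtain ⟨x, rfl⟩ := A.surjective_c p
    have := A.isClosedMap_c _ (isClosed_singleton (x := x))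
    rw [image_singleton] at this
    exact this.preimage A.continuous_c
  refine ⟨fun p q hpq ↦ ?_⟩
  obtain ⟨O₁, O₂, h1, h2, h3, h4, h5⟩ := normal_separation (hfib p) (hfib q)
    (disjoint_left.2 fun x hx hx' ↦ hpq (hx.symm.trans hx'))
  refine ⟨(A.c '' O₁ᶜ)ᶜ, (A.c '' O₂ᶜ)ᶜ, (A.isClosedMap_c _ h1.isClosed_compl).isOpen_compl,
    (A.isClosedMap_c _ h2.isClosed_compl).isOpen_compl, ?_, ?_, ?_⟩
  · rintro ⟨x, hx, hxp⟩
    exact hx (h3 hxp)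
  · rintro ⟨x, hx, hxp⟩
    exact hx (h4 hxp)
  · refine disjoint_left.2 fun r hr hr' ↦ ?_
    obtain ⟨x, rfl⟩ := A.surjective_c r
    have hx1 : x ∈ O₁ := by
      by_contra h
      exact hr ⟨x, h, rfl⟩
    have hx2 : x ∈ O₂ := by
      by_contra h
      exact hr' ⟨x, h, rfl⟩
    exact disjoint_left.1 h5 hx1 hx2

theorem sigmaCompactSpace_cut [T2Space M] [SecondCountableTopology M] :
    SigmaCompactSpace A.Cut := by
  have : LocallyCompactSpace M := Manifold.locallyCompact_of_finiteDimensional (𝓡∂ n)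
  obtain ⟨K, hK, hKu⟩ := SigmaCompactSpace.exists_compact_covering (X := M)
  refine ⟨⟨fun i ↦ A.c '' K i, fun i ↦ (hK i).image A.continuous_c, ?_⟩⟩
  rw [← image_iUnion, hKu, image_univ, A.surjective_c.range_eq]

/-- The chart of the cut space around the image of an interior point. -/
def interiorChart (x : M) : OpenPartialHomeomorph A.Cut (EuclideanSpace ℝ (Fin n)) where
  toFun p := extChartAt (𝓡∂ n) x (A.out p)
  invFun v := A.c ((extChartAt (𝓡∂ n) x).symm v)
  source := A.c '' ((𝓡∂ n).interior M ∩ (extChartAt (𝓡∂ n) x).source)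
  target := (extChartAt (𝓡∂ n) x).target ∩ {v | 0 < v 0}
  map_source' := by
    rintro _ ⟨y, ⟨hy, hys⟩, rfl⟩
    rw [A.out_c_of_interior hy]
    refine ⟨(extChartAt (𝓡∂ n) x).map_source hys, lt_of_le_of_ne (zero_le_extChartAt_zero _ _) ?_⟩
    intro h
    rw [← ModelWithCorners.compl_boundary, mem_compl_iff,
      mem_boundary_iff_extChartAt_eq_zero (x := x) (by rwa [extChartAt_source] at hys)] at hy
    exact hy h.symm
  map_target' := by
    rintro v ⟨hv, hv0⟩
    have h1 := (extChartAt (𝓡∂ n) x).map_target hv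
    refine ⟨_, ⟨?_, h1⟩, rfl⟩
    rw [← ModelWithCorners.compl_boundary, mem_compl_iff,
      mem_boundary_iff_extChartAt_eq_zero (x := x) (by rwa [extChartAt_source] at h1),
      (extChartAt (𝓡∂ n) x).right_inv hv]
    exact hv0.ne'
  left_inv' := by
    rintro _ ⟨y, ⟨hy, hys⟩, rfl⟩
    rw [A.out_c_of_interior hy, (extChartAt (𝓡∂ n) x).left_inv hys]
  right_inv' := by
    rintro v ⟨hv, hv0⟩
    have h1 := (extChartAt (𝓡∂ n) x).map_target hv
    rw [A.out_c_of_interior, (extChartAt (𝓡∂ n) x).right_inv hv]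
    rw [← ModelWithCorners.compl_boundary, mem_compl_iff,
      mem_boundary_iff_extChartAt_eq_zero (x := x) (by rwa [extChartAt_source] at h1),
      (extChartAt (𝓡∂ n) x).right_inv hv]
    exact hv0.ne'
  open_source := A.isOpen_c_image_of_subset_interior inter_subset_left
    ((ModelWithCorners.isOpen_interior (n := ∞) (by simp)).inter (isOpen_extChartAt_source x))
  open_target := by
    have : (extChartAt (𝓡∂ n) x).target ∩ {v | 0 < v 0} =
        ((𝓡∂ n).symm ⁻¹' (chartAt (EuclideanHalfSpace n) x).target) ∩ {v | 0 < v 0} := by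
      rw [extChartAt_target]
      ext v
      constructor
      · rintro ⟨⟨h1, -⟩, h2⟩
        exact ⟨h1, h2⟩
      · rintro ⟨h1, h2⟩
        refine ⟨⟨h1, ?_⟩, h2⟩
        rw [range_modelWithCornersEuclideanHalfSpace]
        exact (show 0 < v 0 from h2).le
    rw [this]
    exact ((chartAt (EuclideanHalfSpace n) x).open_target.preimage (𝓡∂ n).continuous_symm).inter
      (isOpen_lt continuous_const (EuclideanSpace.proj (𝕜 := ℝ) (0 : Fin n) :
        EuclideanSpace ℝ (Fin n) →L[ℝ] ℝ).continuous)
  continuousOn_toFun := by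
    have hop := A.isOpen_c_image_of_subset_interior (O := (𝓡∂ n).interior M ∩
      (extChartAt (𝓡∂ n) x).source) inter_subset_left
      ((ModelWithCorners.isOpen_interior (n := ∞) (by simp)).inter (isOpen_extChartAt_source x))
    rw [A.isQuotientMap_c.continuousOn_isOpen_iff hop,
      A.preimage_image_c_of_subset_interior inter_subset_left]
    refine ((continuousOn_extChartAt x).mono inter_subset_right).congr fun y hy ↦ ?_
    simp only [Function.comp]
    rw [A.out_c_of_interior hy.1]
  continuousOn_invFun := A.continuous_c.comp_continuousOn
    ((continuousOn_extChartAt_symm x).mono inter_subset_left)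

end Topology

theorem exp_arg_mul_norm (w : ℂ) : (Circle.exp (Complex.arg w) : ℂ) * ‖w‖ = w := by
  rw [Circle.coe_exp, mul_comm, Complex.norm_mul_exp_arg_mul_I]

namespace Tube
variable {A} (τ : A.Tube)

/-- The domain of the parametrization of the cut space that is given by a tube. -/
def cutD : Set (SliceSpace n × ℂ) := {v | (v.1, ‖v.2‖ ^ 2) ∈ τ.D}

/-- The lift to the manifold of the parametrization of the cut space. -/
def lift (v : SliceSpace n × ℂ) : M := A.act (Circle.exp (Complex.arg v.2)) (τ.σ (v.1, ‖v.2‖ ^ 2))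

/-- The map from the manifold to the coordinate space of the cut space. -/
def cutCo (x : M) : SliceSpace n × ℂ := ((τ.co x).1, (√(τ.co x).2 : ℝ) * (τ.ang x : ℂ))

theorem contDiff_sq : ContDiff ℝ ∞ (fun v : SliceSpace n × ℂ ↦ (v.1, ‖v.2‖ ^ 2)) :=
  contDiff_fst.prodMk (contDiff_snd.norm_sq ℝ)

theorem isOpen_cutD : IsOpen τ.cutD := τ.isOpen_D.preimage contDiff_sq.continuous

theorem sq_mem_Dp {v} (hv : v ∈ τ.cutD) : (v.1, ‖v.2‖ ^ 2) ∈ τ.Dp := ⟨hv, sq_nonneg ‖v.2‖⟩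

theorem lift_mem_T {v} (hv : v ∈ τ.cutD) : τ.lift v ∈ τ.T := τ.act_mem_T _ (τ.sq_mem_Dp hv)

theorem co_lift {v} (hv : v ∈ τ.cutD) : τ.co (τ.lift v) = (v.1, ‖v.2‖ ^ 2) :=
  τ.co_act _ _ (τ.sq_mem_Dp hv)

theorem cutCo_lift {v} (hv : v ∈ τ.cutD) : τ.cutCo (τ.lift v) = v := by
  refine Prod.ext ?_ ?_
  · simp [cutCo, τ.co_lift hv]
  · simp only [cutCo, τ.co_lift hv]
    rw [lift, τ.ang_act _ _ (τ.sq_mem_Dp hv), Real.sqrt_sq (norm_nonneg _), mul_comm,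
      exp_arg_mul_norm]

theorem norm_cutCo_sq {x} (hx : x ∈ τ.T) : ‖(τ.cutCo x).2‖ ^ 2 = (τ.co x).2 := by
  rw [cutCo, norm_mul, Circle.norm_coe, mul_one, Complex.norm_real, Real.norm_eq_abs,
    sq_abs, Real.sq_sqrt (τ.co_mem hx).2]

theorem cutCo_mem {x} (hx : x ∈ τ.T) : τ.cutCo x ∈ τ.cutD := by
  change (_, _) ∈ τ.D
  rw [τ.norm_cutCo_sq hx]
  exact (τ.co_mem hx).1

theorem lift_cutCo_of_pos {x} (hx : x ∈ τ.T) (h : 0 < (τ.co x).2) : τ.lift (τ.cutCo x) = x := by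
  rw [lift, τ.norm_cutCo_sq hx]
  have h1 : Complex.arg (τ.cutCo x).2 = Complex.arg (τ.ang x) :=
    Complex.arg_real_mul _ (Real.sqrt_pos.2 h)
  rw [h1, Circle.exp_arg]
  exact τ.act_ang_σ_co hx

theorem c_lift_cutCo [IsManifold (𝓡∂ n) ∞ M] {x} (hx : x ∈ τ.T) :
    A.c (τ.lift (τ.cutCo x)) = A.c x := by
  rcases (show 0 ≤ (τ.co x).2 from (τ.co_mem hx).2).lt_or_eq with h | h
  · rw [τ.lift_cutCo_of_pos hx h]
  · have h0 : (τ.cutCo x).2 = 0 := by simp [cutCo, ← h]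
    have h1 : τ.σ (τ.co x) ∈ (𝓡∂ n).boundary M := (τ.σ_mem_boundary_iff _ (τ.co_mem hx)).2 h.symm
    rw [lift, τ.norm_cutCo_sq hx]
    conv_rhs => rw [← τ.act_ang_σ_co hx]
    exact (A.c_act h1).trans (A.c_act h1).symm

theorem lift_mem_boundary_iff [IsManifold (𝓡∂ n) ∞ M] {v} (hv : v ∈ τ.cutD) :
    τ.lift v ∈ (𝓡∂ n).boundary M ↔ v.2 = 0 := by
  rw [τ.mem_boundary_iff (τ.lift_mem_T hv), τ.co_lift hv]
  simp

theorem lift_mem_interior_iff [IsManifold (𝓡∂ n) ∞ M] {v} (hv : v ∈ τ.cutD) :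
    τ.lift v ∈ (𝓡∂ n).interior M ↔ v.2 ≠ 0 := by
  rw [← ModelWithCorners.compl_boundary, mem_compl_iff, τ.lift_mem_boundary_iff hv]

/-- Along a boundary orbit only the angle varies, and there it is multiplied by √0. -/
theorem cutCo_eq_of_c_eq [IsManifold (𝓡∂ n) ∞ M] {x y} (hx : x ∈ τ.T) (h : A.c x = A.c y) :
    τ.cutCo x = τ.cutCo y := by
  rcases A.c_eq_iff.1 h with rfl | ⟨hb, -, a, rfl⟩
  · rfl
  · have h1 := (τ.mem_boundary_iff hx).1 hb
    simp [cutCo, τ.co_act_of_mem a hx, h1]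

theorem contMDiffOn_σ_sq : ContMDiffOn 𝓘(ℝ, SliceSpace n × ℂ) (𝓡∂ n) ∞
    (fun v : SliceSpace n × ℂ ↦ τ.σ (v.1, ‖v.2‖ ^ 2)) τ.cutD :=
  τ.contMDiffOn_σ.comp (contDiff_sq.contMDiff.contMDiffOn) fun _ hv ↦ τ.sq_mem_Dp hv

/-- A local branch of the argument, smooth even where `Complex.arg` jumps. Its derivative is the
formula for dθ in the coordinate z. -/
theorem exists_contDiffAt_exp_eq {w₀ : ℂ} (hw₀ : w₀ ≠ 0) : ∃ s : ℂ → ℝ, ContDiffAt ℝ ∞ s w₀ ∧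
    (∀ w, w ≠ 0 → Circle.exp (s w) = Circle.exp (Complex.arg w)) ∧
      ∀ z, fderiv ℝ s w₀ z = (z / w₀).im := by
  refine ⟨fun w ↦ Complex.arg w₀ + (Complex.log (w / w₀)).im, ?_, fun w hw ↦ ?_, fun z ↦ ?_⟩
  · have h1 : ContDiffAt ℝ ∞ (fun w : ℂ ↦ Complex.log (w / w₀)) w₀ := by
      have h2 : ContDiffAt ℂ ∞ Complex.log (w₀ / w₀) := by
        rw [div_self hw₀]
        exact Complex.contDiffAt_log Complex.one_mem_slitPlane
      exact (ContDiffAt.comp (f := fun w : ℂ ↦ w / w₀) w₀ h2 (contDiffAt_id.div_const w₀)).restrict_scalars ℝ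
    exact contDiffAt_const.add (Complex.imCLM.contDiff.contDiffAt.comp w₀ h1)
  · change Circle.exp (Complex.arg w₀ + (Complex.log (w / w₀)).im) = _
    rw [Complex.log_im, Circle.exp_add]
    ext
    have h1 : (‖w‖ : ℂ) ≠ 0 := by exact_mod_cast norm_ne_zero_iff.2 hw
    refine mul_right_cancel₀ h1 ?_
    rw [exp_arg_mul_norm]
    have h2 := exp_arg_mul_norm w₀
    have h3 := exp_arg_mul_norm (w / w₀)
    have h4 : (‖w‖ : ℂ) = ‖w₀‖ * ‖w / w₀‖ := by
      rw [norm_div]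
      have : ‖w₀‖ ≠ 0 := norm_ne_zero_iff.2 hw₀
      push_cast
      have : (‖w₀‖ : ℂ) ≠ 0 := by exact_mod_cast this
      field_simp
    calc _ = ((Circle.exp (Complex.arg w₀) : ℂ) * ‖w₀‖) *
        ((Circle.exp (Complex.arg (w / w₀)) : ℂ) * ‖w / w₀‖) := by
          rw [Circle.coe_mul, h4]; ring
      _ = w := by rw [h2, h3]; field_simp
  · have h1 : HasDerivAt (fun w : ℂ ↦ Complex.log (w / w₀)) (1 / w₀ / (w₀ / w₀)) w₀ :=
      ((hasDerivAt_id w₀).div_const w₀).clog (by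
        rw [id, div_self hw₀]
        exact Complex.one_mem_slitPlane)
    have h2 := ((Complex.imCLM.hasFDerivAt.comp w₀
      (h1.hasFDerivAt.restrictScalars ℝ)).const_add (Complex.arg w₀)).fderiv
    refine (congrArg (fun L : ℂ →L[ℝ] ℝ ↦ L z) h2).trans ?_
    simp [hw₀, div_eq_mul_inv]

/-- The jump of `Complex.arg` is by 2π and disappears in the circle, so a smooth local branch of the
argument may replace it. -/
theorem contMDiffAt_lift {v} (hv : v ∈ τ.cutD) (h0 : v.2 ≠ 0) :
    ContMDiffAt 𝓘(ℝ, SliceSpace n × ℂ) (𝓡∂ n) ∞ τ.lift v := by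
  obtain ⟨s, hs, hs', -⟩ := exists_contDiffAt_exp_eq h0
  have h1 : ContMDiffAt 𝓘(ℝ, SliceSpace n × ℂ) (𝓡∂ n) ∞
      (fun v : SliceSpace n × ℂ ↦ A.act (Circle.exp (s v.2)) (τ.σ (v.1, ‖v.2‖ ^ 2))) v := by
    refine (A.contMDiffAt_exp_act_prod (s v.2) (τ.σ_mem _ (τ.sq_mem_Dp hv))).comp
      (f := fun v : SliceSpace n × ℂ ↦ (s v.2, τ.σ (v.1, ‖v.2‖ ^ 2))) v ?_
    refine ContMDiffAt.prodMk ?_ (τ.contMDiffOn_σ_sq.contMDiffAt (τ.isOpen_cutD.mem_nhds hv))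
    exact (hs.comp v contDiffAt_snd).contMDiffAt
  refine h1.congr_of_eventuallyEq ?_
  filter_upwards [continuous_snd.continuousAt.preimage_mem_nhds
    (isOpen_compl_singleton.mem_nhds h0)] with u hu
  rw [lift, hs' _ hu]

/-- At z = 0 the lift itself need not be continuous, but all rotations of the base point have the
same image in the cut space, and compactness of the circle gives a neighbourhood that works for all
angles at once. -/
theorem continuousOn_c_lift [IsManifold (𝓡∂ n) ∞ M] :
    ContinuousOn (fun v ↦ A.c (τ.lift v)) τ.cutD := by
  intro v hv
  by_cases h0 : v.2 = 0
  · refine ContinuousAt.continuousWithinAt ?_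
    intro O hO
    obtain ⟨O', hO'O, hO', hvO'⟩ := mem_nhds_iff.1 hO
    have hd := τ.sq_mem_Dp hv
    have hb : τ.σ (v.1, ‖v.2‖ ^ 2) ∈ (𝓡∂ n).boundary M :=
      (τ.σ_mem_boundary_iff _ hd).2 (by simp [h0])
    have hcont := τ.contMDiffOn_σ_sq.continuousOn.continuousAt (τ.isOpen_cutD.mem_nhds hv)
    have key : ∀ᶠ x in 𝓝 (τ.σ (v.1, ‖v.2‖ ^ 2)), ∀ a ∈ (univ : Set Circle),
        A.c (A.act a x) ∈ O' := by
      refine isCompact_univ.eventually_forall_of_forall_eventually fun a _ ↦ ?_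
      have h1 : ContinuousAt (fun z : M × Circle ↦ A.act z.2 z.1) (τ.σ (v.1, ‖v.2‖ ^ 2), a) :=
        (A.contMDiffAt_act_prod a (τ.σ_mem _ hd)).continuousAt.comp
          (f := fun z : M × Circle ↦ (z.2, z.1)) (x := (τ.σ (v.1, ‖v.2‖ ^ 2), a)) (by fun_prop)
      refine (A.continuous_c.continuousAt.comp h1).preimage_mem_nhds (hO'.mem_nhds ?_)
      change A.c (A.act a (τ.σ (v.1, ‖v.2‖ ^ 2))) ∈ O'
      rw [A.c_act hb, ← A.c_act (a := Circle.exp (Complex.arg v.2)) hb]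
      exact hvO'
    change ∀ᶠ u in 𝓝 v, A.c (τ.lift u) ∈ O
    filter_upwards [hcont.eventually key] with u hu
    exact hO'O (hu _ (mem_univ _))
  · exact (A.continuous_c.continuousAt.comp (τ.contMDiffAt_lift hv h0).continuousAt).continuousWithinAt

/-- The coordinates on the cut space that are given by a tube. -/
def cutChart [IsManifold (𝓡∂ n) ∞ M] : OpenPartialHomeomorph A.Cut (SliceSpace n × ℂ) where
  toFun p := τ.cutCo (A.out p)
  invFun v := A.c (τ.lift v)
  source := A.c '' τ.T
  target := τ.cutD
  map_source' := by
    rintro _ ⟨x, hx, rfl⟩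
    rw [← τ.cutCo_eq_of_c_eq hx (A.c_out _).symm]
    exact τ.cutCo_mem hx
  map_target' := fun v hv ↦ ⟨_, τ.lift_mem_T hv, rfl⟩
  left_inv' := by
    rintro _ ⟨x, hx, rfl⟩
    rw [← τ.cutCo_eq_of_c_eq hx (A.c_out _).symm, τ.c_lift_cutCo hx]
  right_inv' := by
    intro v hv
    rw [← τ.cutCo_eq_of_c_eq (τ.lift_mem_T hv) (A.c_out _).symm, τ.cutCo_lift hv]
  open_source := A.isOpen_c_image_of_invariant (fun a _ hx ↦ τ.act_mem_T_of_mem a hx) τ.isOpen_T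
  open_target := τ.isOpen_cutD
  continuousOn_toFun := by
    rw [A.isQuotientMap_c.continuousOn_isOpen_iff
      (A.isOpen_c_image_of_invariant (fun a _ hx ↦ τ.act_mem_T_of_mem a hx) τ.isOpen_T),
      A.preimage_image_c_of_invariant (fun a _ hx ↦ τ.act_mem_T_of_mem a hx)]
    have h1 : ContinuousOn τ.cutCo τ.T := by
      refine (τ.contMDiffOn_co.continuousOn.fst).prodMk ?_
      refine ContinuousOn.mul ?_ τ.contMDiffOn_ang.continuousOn
      exact (Complex.continuous_ofReal.comp Real.continuous_sqrt).comp_continuousOn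
        τ.contMDiffOn_co.continuousOn.snd
    exact h1.congr fun x hx ↦ (τ.cutCo_eq_of_c_eq hx (A.c_out _).symm).symm
  continuousOn_invFun := τ.continuousOn_c_lift

theorem cutChart_c [IsManifold (𝓡∂ n) ∞ M] {x} (hx : x ∈ τ.T) : τ.cutChart (A.c x) = τ.cutCo x :=
  (τ.cutCo_eq_of_c_eq hx (A.c_out _).symm).symm

end Tube
end FreeCircleActionNearBoundary
end

/-! ### Averaging, and linear growth away from the boundary -/

noncomputable section

open Set Filter Topology

/-- In a chart, the intersection of a ball with the range of the model is convex and has unique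
derivatives, so the vector space version applies. -/
theorem contMDiffOn_intervalIntegral_param {V : Type} [NormedAddCommGroup V] [NormedSpace ℝ V]
    {H : Type*} [TopologicalSpace H] (J : ModelWithCorners ℝ V H) {N : Type*} [TopologicalSpace N]
    [ChartedSpace H N] [IsManifold J ∞ N] {F : Type} [NormedAddCommGroup F] [NormedSpace ℝ F]
    [CompleteSpace F] {W : Set N} (hW : IsOpen W) {a b : ℝ} (hab : a < b) {G : ℝ × N → F}
    (hG : ContMDiffOn (𝓘(ℝ, ℝ).prod J) 𝓘(ℝ, F) ∞ G (univ ×ˢ W)) :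
    ContMDiffOn J 𝓘(ℝ, F) ∞ (fun x ↦ ∫ s in a..b, G (s, x)) W := by
  intro x hx
  refine ContMDiffAt.contMDiffWithinAt ?_
  rw [contMDiffAt_iff_source_of_mem_source (mem_chart_source H x), contMDiffWithinAt_iff_contDiffWithinAt]
  have h1 : (extChartAt J x).target ∩ (extChartAt J x).symm ⁻¹' W ∈
      𝓝[range J] (extChartAt J x x) := by
    refine inter_mem (extChartAt_target_mem_nhdsWithin x) ?_
    refine mem_nhdsWithin_of_mem_nhds
      ((continuousAt_extChartAt_symm x).preimage_mem_nhds (hW.mem_nhds ?_))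
    rwa [extChartAt_to_inv]
  obtain ⟨r, hr, hball⟩ := Metric.mem_nhdsWithin_iff.1 h1
  set S := Metric.ball (extChartAt J x x) r ∩ range J with hS
  have hSc : Convex ℝ S := (convex_ball _ _).inter J.convex_range
  have hSu : UniqueDiffOn ℝ S := by
    rw [hS, inter_comm]
    exact J.uniqueDiffOn.inter Metric.isOpen_ball
  have h2 : ContDiffOn ℝ ∞ (fun p : ℝ × V ↦ G (p.1, (extChartAt J x).symm p.2))
      (Icc a b ×ˢ S) := by
    suffices h : ContMDiffOn (𝓘(ℝ, ℝ).prod 𝓘(ℝ, V)) 𝓘(ℝ, F) ∞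
        (fun p : ℝ × V ↦ G (p.1, (extChartAt J x).symm p.2)) (Icc a b ×ˢ S) by
      rw [← modelWithCornersSelf_prod, chartedSpaceSelf_prod] at h
      exact h.contDiffOn
    refine hG.comp (t := univ ×ˢ W) (f := fun p : ℝ × V ↦ (p.1, (extChartAt J x).symm p.2)) ?_
      fun p hp ↦ ⟨mem_univ _, (hball hp.2).2⟩
    refine contMDiffOn_fst.prodMk ?_
    exact (contMDiffOn_extChartAt_symm x).comp contMDiffOn_snd fun p hp ↦ (hball hp.2).1
  have h3 := contDiffOn_intervalIntegral_param hSc hSu hab h2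
  refine (h3 _ ⟨Metric.mem_ball_self hr, mem_range_self _⟩).mono_of_mem_nhdsWithin ?_
  exact inter_mem (mem_nhdsWithin_of_mem_nhds (Metric.ball_mem_nhds _ hr)) self_mem_nhdsWithin

/-- Translation invariance of the circle integral, from periodicity. -/
theorem intervalIntegral_circle_mul {F : Type*} [NormedAddCommGroup F] [NormedSpace ℝ F]
    (G : Circle → F) (a : Circle) :
    ∫ s in (0 : ℝ)..2 * Real.pi, G (Circle.exp s * a) =
      ∫ s in (0 : ℝ)..2 * Real.pi, G (Circle.exp s) := by
  obtain ⟨θ, rfl⟩ : ∃ θ, Circle.exp θ = a := ⟨_, Circle.exp_arg a⟩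
  simp only [← Circle.exp_add]
  rw [intervalIntegral.integral_comp_add_right (fun s ↦ G (Circle.exp s)), zero_add, add_comm]
  have hp : Function.Periodic (fun s ↦ G (Circle.exp s)) (2 * Real.pi) := fun s ↦ by
    change G (Circle.exp (s + 2 * Real.pi)) = _
    rw [Circle.exp_add, Circle.exp_two_pi, mul_one]
  rw [hp.intervalIntegral_add_eq θ 0, zero_add]

namespace FreeCircleActionNearBoundary

variable {n : ℕ} [NeZero n] {M : Type*} [TopologicalSpace M]
  [ChartedSpace (EuclideanHalfSpace n) M]
  (A : FreeCircleActionNearBoundary n M)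

namespace Tube
variable {A} (τ τ' : A.Tube)

theorem contMDiffOn_co_snd : ContMDiffOn (𝓡∂ n) 𝓘(ℝ, ℝ) ∞ (fun x ↦ (τ.co x).2) τ.T :=
  (contDiff_snd.contMDiff (n := ∞)).comp_contMDiffOn τ.contMDiffOn_co

/-- On the slice of `τ'` the transversal coordinate of `τ` is Lipschitz and vanishes on the wall, so
it is at most `K` times that of `τ'`. The constant is `1 / (K + 1)` because `K` may be 0. -/
theorem exists_le_co_snd [IsManifold (𝓡∂ n) ∞ M] {x : M} (hx : x ∈ τ.T) (hx' : x ∈ τ'.T)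
    (hxb : x ∈ (𝓡∂ n).boundary M) :
    ∃ c > 0, ∀ᶠ y in 𝓝 x, c * (τ.co y).2 ≤ (τ'.co y).2 := by
  set d₀ := τ'.co x with hd₀
  have hd₀m : d₀ ∈ τ'.Dp := τ'.co_mem hx'
  have hd₀0 : d₀.2 = 0 := (τ'.mem_boundary_iff hx').1 hxb
  have hσx : τ'.σ d₀ ∈ τ.T := by
    have h1 := τ'.act_ang_σ_co hx'
    rw [← A.act_inv_act (τ'.ang x) (τ'.σ_mem _ hd₀m), h1]
    exact τ.act_mem_T_of_mem _ hx
  have hsm : ContDiffWithinAt ℝ 1 (fun d ↦ (τ.co (τ'.σ d)).2) τ'.Dp d₀ := by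
    rw [← contMDiffWithinAt_iff_contDiffWithinAt]
    exact ((τ.contMDiffOn_co_snd.contMDiffAt (τ.isOpen_T.mem_nhds hσx)).comp_contMDiffWithinAt d₀
      (τ'.contMDiffOn_σ d₀ hd₀m)).of_le (by simp)
  have hconv : Convex ℝ τ'.Dp := τ'.convex_D.inter
    ((convex_Ici (0 : ℝ)).linear_preimage (LinearMap.snd ℝ (SliceSpace n) ℝ))
  obtain ⟨K, t, ht, hK⟩ := hsm.exists_lipschitzOnWith hconv
  have hTσ : ∀ᶠ d in 𝓝[τ'.Dp] d₀, τ'.σ d ∈ τ.T :=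
    (τ'.contMDiffOn_σ d₀ hd₀m).continuousWithinAt.preimage_mem_nhdsWithin (τ.isOpen_T.mem_nhds hσx)
  have hco : Tendsto τ'.co (𝓝 x) (𝓝[τ'.Dp] d₀) := by
    refine tendsto_nhdsWithin_iff.2 ⟨(τ'.contMDiffOn_co.continuousOn.continuousAt
      (τ'.isOpen_T.mem_nhds hx')), ?_⟩
    filter_upwards [τ'.isOpen_T.mem_nhds hx'] with y hy using τ'.co_mem hy
  have hpr : Tendsto (fun y ↦ ((τ'.co y).1, (0 : ℝ))) (𝓝 x) (𝓝[τ'.Dp] d₀) := by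
    refine tendsto_nhdsWithin_iff.2 ⟨?_, ?_⟩
    · have h1 : Tendsto (fun y ↦ ((τ'.co y).1, (0 : ℝ))) (𝓝 x) (𝓝 (d₀.1, 0)) :=
        ((tendsto_nhds_of_tendsto_nhdsWithin hco).fst_nhds).prodMk_nhds tendsto_const_nhds
      rwa [show (d₀.1, (0 : ℝ)) = d₀ from Prod.ext rfl hd₀0.symm] at h1
    · filter_upwards [τ'.isOpen_T.mem_nhds hx'] with y hy
      exact ⟨τ'.proj_mem _ (τ'.co_mem hy).1 (τ'.co_mem hy).2, le_refl (0 : ℝ)⟩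
  refine ⟨((K : ℝ) + 1)⁻¹, by positivity, ?_⟩
  filter_upwards [hco.eventually ht, hpr.eventually ht, hpr.eventually hTσ, τ.isOpen_T.mem_nhds hx,
    τ'.isOpen_T.mem_nhds hx'] with y hy1 hy2 hyT hy hy'
  have h1 := hK.dist_le_mul _ hy1 _ hy2
  have hdm := τ'.co_mem hy'
  have hdm0 : ((τ'.co y).1, (0 : ℝ)) ∈ τ'.Dp := ⟨τ'.proj_mem _ hdm.1 hdm.2, le_refl (0 : ℝ)⟩
  have h2 : (τ.co (τ'.σ ((τ'.co y).1, 0))).2 = 0 :=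
    (τ.mem_boundary_iff hyT).1 ((τ'.σ_mem_boundary_iff _ hdm0).2 rfl)
  have h3 : τ.co (τ'.σ (τ'.co y)) = τ.co y := by
    have h4 : τ'.σ (τ'.co y) = A.act (τ'.ang y)⁻¹ y := by
      conv_rhs => rw [← τ'.act_ang_σ_co hy']
      rw [τ'.ang_act_of_mem _ (τ'.σ_mem_T hdm), τ'.ang_σ hdm, mul_one,
        A.act_inv_act _ (τ'.σ_mem _ hdm)]
    rw [h4, τ.co_act_of_mem _ hy]
  rw [h2, h3, Real.dist_eq, sub_zero, abs_of_nonneg (τ.co_mem hy).2] at h1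
  have h5 : dist (τ'.co y) ((τ'.co y).1, (0 : ℝ)) = (τ'.co y).2 := by
    rw [Prod.dist_eq, dist_self, Real.dist_eq, sub_zero, abs_of_nonneg hdm.2]
    exact max_eq_right hdm.2
  rw [h5] at h1
  have h6 : 0 ≤ (τ'.co y).2 := hdm.2
  rw [inv_mul_le_iff₀ (by positivity)]
  nlinarith

/-- Linear growth away from the boundary survives sums with a partition of unity and averages over
the circle, where it replaces the condition on the derivative; this converts it back. -/
theorem mfderiv_ne_zero_of_le [IsManifold (𝓡∂ n) ∞ M] {x : M} (hx : x ∈ τ.T)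
    (hxb : x ∈ (𝓡∂ n).boundary M) {f : M → ℝ} (hf : MDifferentiableAt (𝓡∂ n) 𝓘(ℝ, ℝ) f x)
    (hfx : f x = 0) {c : ℝ} (hc : 0 < c) (hle : ∀ᶠ y in 𝓝 x, c * (τ.co y).2 ≤ f y) :
    mfderiv (𝓡∂ n) 𝓘(ℝ, ℝ) f x ≠ 0 := by
  intro h0
  set d₀ := τ.co x with hd₀
  have hd₀m : d₀ ∈ τ.Dp := τ.co_mem hx
  have hd₀0 : d₀.2 = 0 := (τ.mem_boundary_iff hx).1 hxb
  have hfx' : A.act (τ.ang x) (τ.σ d₀) = x := τ.act_ang_σ_co hx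
  have hsm : ContMDiffWithinAt 𝓘(ℝ, SliceSpace n × ℝ) (𝓡∂ n) ∞
      (fun d ↦ A.act (τ.ang x) (τ.σ d)) τ.Dp d₀ :=
    (A.contMDiffAt_act _ (τ.σ_mem _ hd₀m)).comp_contMDiffWithinAt d₀ (τ.contMDiffOn_σ d₀ hd₀m)
  have hF : HasMFDerivAt (𝓡∂ n) 𝓘(ℝ, ℝ) f (A.act (τ.ang x) (τ.σ d₀)) 0 := by
    rw [hfx', ← h0]
    exact hf.hasMFDerivAt
  have hcomp := hF.comp_hasMFDerivWithinAt d₀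
    (hsm.mdifferentiableWithinAt (by simp)).hasMFDerivWithinAt
  rw [ContinuousLinearMap.zero_comp] at hcomp
  have hcomp' : HasFDerivWithinAt (fun d ↦ f (A.act (τ.ang x) (τ.σ d))) 0 τ.Dp d₀ :=
    hcomp.hasFDerivWithinAt
  have hγ : HasDerivWithinAt (fun s : ℝ ↦ (d₀.1, s)) ((0 : SliceSpace n), (1 : ℝ)) (Ici 0) 0 :=
    (hasDerivWithinAt_const _ _ _).prodMk (hasDerivWithinAt_id _ _)
  have hlim : Tendsto (fun s : ℝ ↦ (d₀.1, s)) (𝓝[Ici 0] 0) (𝓝[τ.Dp] d₀) := by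
    have h1 : Tendsto (fun s : ℝ ↦ (d₀.1, s)) (𝓝[Ici 0] 0) (𝓝 d₀) := by
      have : d₀ = (d₀.1, 0) := Prod.ext rfl hd₀0
      conv => rw [this]
      exact hγ.continuousWithinAt
    refine tendsto_nhdsWithin_iff.2 ⟨h1, ?_⟩
    filter_upwards [h1.eventually (τ.isOpen_D.mem_nhds hd₀m.1), self_mem_nhdsWithin] with s h2 h3
    exact ⟨h2, h3⟩
  have hev : ∀ᶠ s in 𝓝[>] (0 : ℝ), c * s ≤ f (A.act (τ.ang x) (τ.σ (d₀.1, s))) ∧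
      |f (A.act (τ.ang x) (τ.σ (d₀.1, s)))| ≤ (c / 2) * ‖(d₀.1, s) - d₀‖ := by
    have hlim' := hlim.mono_left (nhdsWithin_mono 0 Ioi_subset_Ici_self)
    have hcont : Tendsto (fun d ↦ A.act (τ.ang x) (τ.σ d)) (𝓝[τ.Dp] d₀) (𝓝 x) := by
      have := hsm.continuousWithinAt.tendsto
      rwa [hfx'] at this
    have h1 := (hasFDerivWithinAt_iff_isLittleO.1 hcomp').def (half_pos hc)
    filter_upwards [hlim'.eventually (hcont.eventually hle), hlim'.eventually h1,
      hlim'.eventually self_mem_nhdsWithin] with s h2 h3 h4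
    rw [τ.co_act _ _ h4] at h2
    refine ⟨h2, ?_⟩
    rw [hfx', hfx, sub_zero] at h3
    have h5 : |f (A.act (τ.ang x) (τ.σ (d₀.1, s))) - (0 : ℝ)| ≤ _ := h3
    rwa [sub_zero] at h5
  obtain ⟨s, ⟨h1, h2⟩, hs⟩ := (hev.and self_mem_nhdsWithin).exists
  have hs' : 0 < s := hs
  have h3 : ‖(d₀.1, s) - d₀‖ = s := by
    rw [Prod.norm_def]
    simp [hd₀0, abs_of_pos hs', hs'.le]
  rw [h3] at h2
  have := (le_abs_self _).trans h2
  nlinarith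

/-- In a tube, an invariant boundary defining function is the boundary coordinate times a positive
smooth function. -/
theorem exists_pos_factor [IsManifold (𝓡∂ n) ∞ M] {f : M → ℝ} (hf : A.IsInvariantBoundaryDefining f)
    (hinv : ∀ a, ∀ x ∈ τ.T, f (A.act a x) = f x) :
    ∃ g : SliceSpace n × ℝ → ℝ, ContDiffOn ℝ ∞ g τ.Dp ∧ (∀ d ∈ τ.Dp, 0 < g d) ∧
      ∀ x ∈ τ.T, f x = (τ.co x).2 * g (τ.co x) := by
  have hfσ : ContDiffOn ℝ ∞ (fun d ↦ f (τ.σ d)) τ.Dp := by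
    rw [← contMDiffOn_iff_contDiffOn]
    exact hf.smooth.comp_contMDiffOn τ.contMDiffOn_σ
  obtain ⟨g, hg, hfg, -⟩ := exists_contDiffOn_eq_smul_of_vanishing τ.isOpen_D τ.convex_D τ.proj_mem
    hfσ fun d hd h0 ↦ (hf.eq_zero_iff _).2
      ((τ.σ_mem_boundary_iff d ⟨hd, h0.ge⟩).2 h0)
  have hfac : ∀ x ∈ τ.T, f x = (τ.co x).2 * g (τ.co x) := by
    intro x hx
    rw [← smul_eq_mul, ← hfg _ (τ.co_mem hx)]
    conv_lhs => rw [← τ.act_ang_σ_co hx]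
    rw [hinv _ _ (τ.σ_mem_T (τ.co_mem hx))]
  have hpos : ∀ d ∈ τ.Dp, 0 < d.2 → 0 < g d := by
    intro d hd h
    have h1 : 0 < f (τ.σ d) := lt_of_le_of_ne (hf.nonneg _) fun h0 ↦
      h.ne' ((τ.σ_mem_boundary_iff d hd).1 ((hf.eq_zero_iff _).1 h0.symm))
    have h2 := hfg d hd
    rw [smul_eq_mul] at h2
    rw [h2] at h1
    exact (mul_pos_iff_of_pos_left h).1 h1
  refine ⟨g, hg, fun d hd ↦ ?_, hfac⟩
  rcases (show 0 ≤ d.2 from hd.2).lt_or_eq with h | h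
  · exact hpos d hd h
  -- On the wall `g` is a limit of positive values, and a zero of `g` there would make the
  -- derivative of `f`, the product of the transversal coordinate and `g`, vanish.
  refine lt_of_le_of_ne ?_ fun h0 ↦ ?_
  · have hlim : Tendsto (fun s : ℝ ↦ (d.1, s)) (𝓝[>] 0) (𝓝[τ.Dp] d) := by
      have h1 : Tendsto (fun s : ℝ ↦ (d.1, s)) (𝓝[>] 0) (𝓝 d) := by
        have h2 : d = (d.1, 0) := Prod.ext rfl h.symm
        conv => rw [h2]
        have : Continuous fun s : ℝ ↦ (d.1, s) := by fun_prop
        exact this.continuousAt.tendsto.mono_left nhdsWithin_le_nhds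
      refine tendsto_nhdsWithin_iff.2 ⟨h1, ?_⟩
      filter_upwards [h1.eventually (τ.isOpen_D.mem_nhds hd.1), self_mem_nhdsWithin] with s h2 h3
      exact ⟨h2, le_of_lt (show (0 : ℝ) < s from h3)⟩
    refine ge_of_tendsto ((hg d hd).continuousWithinAt.tendsto.comp hlim) ?_
    filter_upwards [hlim.eventually self_mem_nhdsWithin, self_mem_nhdsWithin] with s h2 h3
    exact (hpos _ h2 h3).le
  · have hb : τ.σ d ∈ (𝓡∂ n).boundary M := (τ.σ_mem_boundary_iff d hd).2 h.symm
    have hT := τ.σ_mem_T hd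
    have h1 : MDifferentiableAt (𝓡∂ n) 𝓘(ℝ, ℝ) (fun x ↦ (τ.co x).2) (τ.σ d) :=
      (τ.contMDiffOn_co_snd.contMDiffAt (τ.isOpen_T.mem_nhds hT)).mdifferentiableAt (by simp)
    have h2 : MDifferentiableAt (𝓡∂ n) 𝓘(ℝ, ℝ) (fun x ↦ g (τ.co x)) (τ.σ d) :=
      ((hg.contMDiffOn.comp τ.contMDiffOn_co fun _ hx ↦ τ.co_mem hx).contMDiffAt
        (τ.isOpen_T.mem_nhds hT)).mdifferentiableAt (by simp)
    have h3 := h1.hasMFDerivAt.mul h2.hasMFDerivAt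
    have h4 : f =ᶠ[𝓝 (τ.σ d)] ((fun x ↦ (τ.co x).2) * fun x ↦ g (τ.co x)) := by
      filter_upwards [τ.isOpen_T.mem_nhds hT] with x hx using hfac x hx
    have h5 := (h3.congr_of_eventuallyEq h4).mfderiv
    have h6 : ∀ (a b : ℝ) (p q : EuclideanSpace ℝ (Fin n) →L[ℝ] ℝ), a = 0 → b = 0 →
        a • p + b • q = 0 := by
      rintro a b p q rfl rfl
      simp
    exact hf.mfderiv_ne_zero _ hb (h5.trans (h6 _ _ _ _ (by rw [τ.co_σ hd, ← h])
      (by rw [τ.co_σ hd, ← h0])))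

end Tube
end FreeCircleActionNearBoundary
end

/-! ### Existence of invariant boundary defining functions -/

noncomputable section

open Set Filter Topology

namespace FreeCircleActionNearBoundary

variable {n : ℕ} [NeZero n] {M : Type*} [TopologicalSpace M]
  [ChartedSpace (EuclideanHalfSpace n) M]
  (A : FreeCircleActionNearBoundary n M)

theorem exists_local_boundaryDefining [T2Space M] [IsManifold (𝓡∂ n) ∞ M] (x : M) :
    ∃ (O : Set M) (g : M → ℝ), IsOpen O ∧ x ∈ O ∧ ContMDiffOn (𝓡∂ n) 𝓘(ℝ, ℝ) ∞ g O ∧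
      (∀ y ∈ O, 0 ≤ g y) ∧ (∀ y ∈ O, g y = 0 ↔ y ∈ (𝓡∂ n).boundary M) ∧
      ∀ y ∈ O, y ∈ (𝓡∂ n).boundary M → ∀ τ : A.Tube, y ∈ τ.T →
        ∃ c > 0, ∀ᶠ z in 𝓝 y, c * (τ.co z).2 ≤ g z := by
  by_cases hx : x ∈ (𝓡∂ n).boundary M
  · obtain ⟨τ, h0, -⟩ := A.exists_tube A.isInvariantNhd_U hx
    refine ⟨τ.T, fun y ↦ (τ.co y).2, τ.isOpen_T, ?_, τ.contMDiffOn_co_snd,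
      fun y hy ↦ (τ.co_mem hy).2, fun y hy ↦ (τ.mem_boundary_iff hy).symm,
      fun y hy hyb τ' hy' ↦ τ'.exists_le_co_snd τ hy' hy hyb⟩
    rw [← h0]
    exact τ.σ_mem_T τ.zero_mem_Dp
  · have h1 : ∀ y ∈ (𝓡∂ n).interior M, y ∉ (𝓡∂ n).boundary M := fun y hy ↦ by
      rwa [← ModelWithCorners.compl_boundary] at hy
    refine ⟨(𝓡∂ n).interior M, fun _ ↦ 1, ModelWithCorners.isOpen_interior (n := ∞) (by simp), ?_,
      contMDiffOn_const, fun _ _ ↦ zero_le_one, fun y hy ↦ ?_, fun y hy hyb ↦ absurd hyb (h1 y hy)⟩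
    · rwa [← ModelWithCorners.compl_boundary]
    · simp [h1 y hy]

/-- Local functions are glued by a partition of unity. The sum dominates each of its nonnegative
terms and some weight is positive at each point, so the zero set and the linear growth are
inherited. -/
theorem exists_boundaryDefining [T2Space M] [SecondCountableTopology M] [IsManifold (𝓡∂ n) ∞ M] :
    ∃ f : M → ℝ, ContMDiff (𝓡∂ n) 𝓘(ℝ, ℝ) ∞ f ∧ (∀ x, 0 ≤ f x) ∧
      (∀ x, f x = 0 ↔ x ∈ (𝓡∂ n).boundary M) ∧
      ∀ x ∈ (𝓡∂ n).boundary M, ∀ τ : A.Tube, x ∈ τ.T →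
        ∃ c > 0, ∀ᶠ z in 𝓝 x, c * (τ.co z).2 ≤ f z := by
  have : LocallyCompactSpace M := Manifold.locallyCompact_of_finiteDimensional (𝓡∂ n)
  choose O g hO hxO hg hg0 hgb hgg using A.exists_local_boundaryDefining
  obtain ⟨ρ, hρ⟩ := SmoothPartitionOfUnity.exists_isSubordinate (𝓡∂ n) isClosed_univ O hO
    fun x _ ↦ mem_iUnion.2 ⟨x, hxO x⟩
  have hmem : ∀ i x, ρ i x ≠ 0 → x ∈ O i := fun i x h ↦ hρ i (subset_tsupport _ h)
  have hnn : ∀ i x, 0 ≤ ρ i x • g i x := by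
    intro i x
    by_cases h : ρ i x = 0
    · simp [h]
    · exact smul_nonneg (ρ.nonneg i x) (hg0 i x (hmem i x h))
  have hle : ∀ i x, ρ i x • g i x ≤ ∑ᶠ j, ρ j x • g j x := by
    intro i x
    refine single_le_finsum i (f := fun j ↦ ρ j x • g j x) ?_ fun j ↦ hnn j x
    refine (ρ.locallyFinite.point_finite x).subset fun j hj ↦ ?_
    intro h
    have h' : ρ j x = 0 := h
    exact hj (by simp [h'])
  refine ⟨fun x ↦ ∑ᶠ i, ρ i x • g i x, ?_, fun x ↦ finsum_nonneg fun i ↦ hnn i x, fun x ↦ ?_, ?_⟩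
  · exact ρ.contMDiff_finsum_smul fun i x hx ↦ (hg i).contMDiffAt ((hO i).mem_nhds (hρ i hx))
  · constructor
    · intro h
      obtain ⟨i, hi⟩ := ρ.exists_pos_of_mem (mem_univ x)
      have h1 := hle i x
      rw [show ∑ᶠ j, ρ j x • g j x = 0 from h] at h1
      have h2 := hmem i x hi.ne'
      have h3 : ρ i x • g i x = 0 := le_antisymm h1 (hnn i x)
      exact (hgb i x h2).1 ((smul_eq_zero.1 h3).resolve_left hi.ne')
    · intro h
      refine finsum_eq_zero_of_forall_eq_zero fun i ↦ ?_
      by_cases h1 : ρ i x = 0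
      · simp [h1]
      · rw [(hgb i x (hmem i x h1)).2 h, smul_zero]
  · intro x hxb τ hxτ
    obtain ⟨i, hi⟩ := ρ.exists_pos_of_mem (mem_univ x)
    have hxi := hmem i x hi.ne'
    obtain ⟨c, hc, hcg⟩ := hgg i x hxi hxb τ hxτ
    refine ⟨ρ i x / 2 * c, by positivity, ?_⟩
    have h1 : ∀ᶠ z in 𝓝 x, ρ i x / 2 < ρ i z :=
      (ρ i).contMDiff.continuous.continuousAt.eventually_const_lt (half_lt_self hi)
    filter_upwards [hcg, h1, τ.isOpen_T.mem_nhds hxτ] with z h2 h3 h4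
    refine le_trans ?_ (hle i z)
    have h5 : 0 ≤ (τ.co z).2 := (τ.co_mem h4).2
    rw [mul_assoc, smul_eq_mul]
    exact mul_le_mul h3.le h2 (by positivity) (ρ.nonneg i z)

/-- Growth holds near each point of the orbit and the slice coordinates are invariant; compactness
of the circle makes the constant uniform. -/
theorem exists_le_act_of_le [IsManifold (𝓡∂ n) ∞ M] {f : M → ℝ}
    (hf : ∀ x ∈ (𝓡∂ n).boundary M, ∀ τ : A.Tube, x ∈ τ.T →
      ∃ c > 0, ∀ᶠ z in 𝓝 x, c * (τ.co z).2 ≤ f z) {x : M} (hx : x ∈ (𝓡∂ n).boundary M)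
    (τ : A.Tube) (hxτ : x ∈ τ.T) :
    ∃ c > 0, ∀ᶠ z in 𝓝 x, ∀ a ∈ (univ : Set Circle), c * (τ.co z).2 ≤ f (A.act a z) := by
  refine isCompact_univ.induction_on
    (p := fun S : Set Circle ↦ ∃ c > 0, ∀ᶠ z in 𝓝 x, ∀ a ∈ S, c * (τ.co z).2 ≤ f (A.act a z))
    ⟨1, one_pos, by simp⟩ ?_ ?_ ?_
  · rintro s t hst ⟨c, hc, h⟩
    exact ⟨c, hc, h.mono fun z hz a ha ↦ hz a (hst ha)⟩
  · rintro s t ⟨c, hc, h⟩ ⟨c', hc', h'⟩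
    refine ⟨min c c', lt_min hc hc', ?_⟩
    filter_upwards [h, h', τ.isOpen_T.mem_nhds hxτ] with z h1 h2 h3 a ha
    have h4 : 0 ≤ (τ.co z).2 := (τ.co_mem h3).2
    rcases ha with ha | ha
    · exact (mul_le_mul_of_nonneg_right (min_le_left _ _) h4).trans (h1 a ha)
    · exact (mul_le_mul_of_nonneg_right (min_le_right _ _) h4).trans (h2 a ha)
  · intro a _
    have hU := A.boundary_subset hx
    obtain ⟨c, hc, h⟩ := hf (A.act a x) ((A.act_mem_boundary_iff a hU).2 hx) τ
      (τ.act_mem_T_of_mem a hxτ)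
    have h1 : ∀ᶠ p : Circle × M in 𝓝 (a, x),
        c * (τ.co (A.act p.1 p.2)).2 ≤ f (A.act p.1 p.2) :=
      (A.contMDiffAt_act_prod a hU).continuousAt.eventually h
    rw [nhds_prod_eq, eventually_prod_iff] at h1
    obtain ⟨pa, hpa, pb, hpb, hab⟩ := h1
    refine ⟨{b | pa b}, mem_nhdsWithin_of_mem_nhds hpa, c, hc, ?_⟩
    filter_upwards [hpb, τ.isOpen_T.mem_nhds hxτ] with z hz hzT b hb
    have := hab hb hz
    rwa [τ.co_act_of_mem b hzT] at this

/-- Averaging over the circle gives invariance and preserves zero set, sign and linear growth, but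
makes sense only on `U`; a cut-off glues the average to the constant 1. -/
theorem exists_isInvariantBoundaryDefining [T2Space M] [SecondCountableTopology M]
    [IsManifold (𝓡∂ n) ∞ M] : ∃ f, A.IsInvariantBoundaryDefining f := by
  have : LocallyCompactSpace M := Manifold.locallyCompact_of_finiteDimensional (𝓡∂ n)
  have hbc : IsClosed ((𝓡∂ n).boundary M) := ModelWithCorners.isClosed_boundary (n := ∞) (by simp)
  obtain ⟨f₀, hf₀, hnn, hz, hgr⟩ := A.exists_boundaryDefining
  have hpi : (0 : ℝ) < 2 * Real.pi := by positivity
  set f₁ : M → ℝ := fun x ↦ ∫ s in (0 : ℝ)..2 * Real.pi, f₀ (A.act (Circle.exp s) x) with hf₁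
  have hsm₁ : ContMDiffOn (𝓡∂ n) 𝓘(ℝ, ℝ) ∞ f₁ A.U := by
    refine contMDiffOn_intervalIntegral_param (𝓡∂ n) A.isOpen_U hpi
      (G := fun p : ℝ × M ↦ f₀ (A.act (Circle.exp p.1) p.2)) ?_
    rintro ⟨s, x⟩ ⟨-, hx⟩
    exact (hf₀.contMDiffAt.comp (s, x) (A.contMDiffAt_exp_act_prod s hx)).contMDiffWithinAt
  have hcont : ∀ x ∈ A.U, Continuous fun s ↦ f₀ (A.act (Circle.exp s) x) := by
    intro x hx
    refine hf₀.continuous.comp (continuous_iff_continuousAt.2 fun s ↦ ?_)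
    exact (A.contMDiffAt_exp_act_prod s hx).continuousAt.comp (f := fun s ↦ (s, x))
      (by fun_prop)
  have hinv₁ : ∀ a, ∀ x ∈ A.U, f₁ (A.act a x) = f₁ x := by
    intro a x hx
    have := intervalIntegral_circle_mul (fun b ↦ f₀ (A.act b x)) a
    simp only [A.mul_act _ _ x hx] at this
    exact this
  have hnn₁ : ∀ x, 0 ≤ f₁ x := fun x ↦
    intervalIntegral.integral_nonneg hpi.le fun s _ ↦ hnn _
  have hb₁ : ∀ x ∈ (𝓡∂ n).boundary M, f₁ x = 0 := by
    intro x hx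
    have : ∀ s, f₀ (A.act (Circle.exp s) x) = 0 := fun s ↦
      (hz _).2 ((A.act_mem_boundary_iff _ (A.boundary_subset hx)).2 hx)
    simp [hf₁, this]
  have hpos₁ : ∀ x ∈ A.U, x ∉ (𝓡∂ n).boundary M → 0 < f₁ x := by
    intro x hx hxb
    refine intervalIntegral.intervalIntegral_pos_of_pos ((hcont x hx).intervalIntegrable _ _)
      (fun s ↦ lt_of_le_of_ne (hnn _) fun h ↦ hxb ?_) hpi
    exact (A.act_mem_boundary_iff _ hx).1 ((hz _).1 h.symm)
  have hgr₁ : ∀ x ∈ (𝓡∂ n).boundary M, ∀ τ : A.Tube, x ∈ τ.T →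
      ∃ c > 0, ∀ᶠ z in 𝓝 x, c * (τ.co z).2 ≤ f₁ z := by
    intro x hx τ hxτ
    obtain ⟨c, hc, h⟩ := A.exists_le_act_of_le hgr hx τ hxτ
    refine ⟨2 * Real.pi * c, by positivity, ?_⟩
    filter_upwards [h, A.isOpen_U.mem_nhds (A.boundary_subset hx)] with z hz hzU
    have h1 := intervalIntegral.integral_mono_on hpi.le
      (intervalIntegrable_const (μ := MeasureTheory.volume) (c := c * (τ.co z).2))
      ((hcont z hzU).intervalIntegrable _ _) fun s _ ↦ hz (Circle.exp s) (mem_univ _)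
    rw [intervalIntegral.integral_const, sub_zero, smul_eq_mul, ← mul_assoc] at h1
    exact h1
  obtain ⟨W, hW, hbW, hWU⟩ := normal_exists_closure_subset hbc A.isOpen_U A.boundary_subset
  obtain ⟨χ, hχ1, hχ0, hχ⟩ := exists_contMDiffMap_one_nhds_of_subset_interior (n := ⊤) (𝓡∂ n)
    (s := (𝓡∂ n).boundary M) (t := closure W) hbc
    (hbW.trans (interior_maximal subset_closure hW))
  have hχsm : ContMDiff (𝓡∂ n) 𝓘(ℝ, ℝ) ∞ χ := χ.contMDiff
  -- A convex combination of the average and 1: it equals the average near the boundary and is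
  -- positive off the boundary.
  set f : M → ℝ := fun x ↦ χ x * f₁ x + (1 - χ x) with hf
  obtain ⟨W', hW', hbW', hW'1⟩ := mem_nhdsSet_iff_exists.1 hχ1
  have hff₁ : ∀ x ∈ W', f x = f₁ x := fun x hx ↦ by
    have : χ x = 1 := hW'1 hx
    simp [hf, this]
  have hev : ∀ x ∈ (𝓡∂ n).boundary M, f =ᶠ[𝓝 x] f₁ := fun x hx ↦ by
    filter_upwards [hW'.mem_nhds (hbW' hx)] with y hy using hff₁ y hy
  have hsm : ContMDiff (𝓡∂ n) 𝓘(ℝ, ℝ) ∞ f := by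
    intro x
    by_cases hx : x ∈ A.U
    · have h1 := hsm₁.contMDiffAt (A.isOpen_U.mem_nhds hx)
      exact ((hχsm x).mul h1).add (contMDiffAt_const.sub (hχsm x))
    · refine (contMDiffAt_const (c := (1 : ℝ))).congr_of_eventuallyEq ?_
      filter_upwards [isClosed_closure.isOpen_compl.mem_nhds fun h ↦ hx (hWU h)] with y hy
      simp [hf, hχ0 y hy]
  have hzero : ∀ x, x ∉ (𝓡∂ n).boundary M → 0 < f x := by
    intro x hx
    by_cases h1 : χ x = 0
    · simp [hf, h1]
    · have h2 : x ∈ A.U := hWU (by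
        by_contra h
        exact h1 (hχ0 x h))
      have h3 := mul_pos (lt_of_le_of_ne (hχ x).1 (Ne.symm h1)) (hpos₁ x h2 hx)
      have h4 := (hχ x).2
      have h5 : f x = χ x * f₁ x + (1 - χ x) := rfl
      rw [h5]
      linarith
  have hfb : ∀ x ∈ (𝓡∂ n).boundary M, f x = 0 := fun x hx ↦ by
    rw [(hev x hx).eq_of_nhds, hb₁ x hx]
  refine ⟨f, hsm, fun x ↦ ?_, fun x ↦ ⟨fun h ↦ ?_, hfb x⟩, fun x hx ↦ ?_, ?_⟩
  · by_cases hx : x ∈ (𝓡∂ n).boundary M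
    · exact (hfb x hx).ge
    · exact (hzero x hx).le
  · by_contra hx
    exact (hzero x hx).ne' h
  · obtain ⟨τ, h0, -⟩ := A.exists_tube A.isInvariantNhd_U hx
    have hxτ : x ∈ τ.T := by
      rw [← h0]
      exact τ.σ_mem_T τ.zero_mem_Dp
    obtain ⟨c, hc, h⟩ := hgr₁ x hx τ hxτ
    refine τ.mfderiv_ne_zero_of_le hxτ hx (hsm.mdifferentiableAt (by simp)) (hfb x hx) hc ?_
    filter_upwards [h, hev x hx] with y h1 h2
    rwa [h2]
  · obtain ⟨V, hV, hVW⟩ := A.exists_isInvariantNhd hW' hbW'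
    refine ⟨V, hV, fun a x hx ↦ ?_⟩
    rw [hff₁ _ (hVW (hV.act_mem a x hx)), hff₁ _ (hVW hx), hinv₁ a x (hV.subset_U hx)]

end FreeCircleActionNearBoundary
end

/-! ### The atlas of the cut space -/

noncomputable section

open Set Filter Topology

theorem ContMDiffWithinAt.complex_mul {V : Type*} [NormedAddCommGroup V] [NormedSpace ℝ V]
    {H : Type*} [TopologicalSpace H] {J : ModelWithCorners ℝ V H} {N : Type*} [TopologicalSpace N]
    [ChartedSpace H N] {f g : N → ℂ} {s : Set N} {x : N}
    (hf : ContMDiffWithinAt J 𝓘(ℝ, ℂ) ∞ f s x) (hg : ContMDiffWithinAt J 𝓘(ℝ, ℂ) ∞ g s x) :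
    ContMDiffWithinAt J 𝓘(ℝ, ℂ) ∞ (fun y ↦ f y * g y) s x :=
  ((contDiff_fst.mul contDiff_snd : ContDiff ℝ ∞ fun p : ℂ × ℂ ↦ p.1 * p.2).contMDiff
    (x := (f x, g x))).comp_contMDiffWithinAt (f := fun y ↦ (f y, g y)) x (hf.prodMk_space hg)

namespace FreeCircleActionNearBoundary

variable {n : ℕ} [NeZero n] {M : Type*} [TopologicalSpace M]
  [ChartedSpace (EuclideanHalfSpace n) M]
  (A : FreeCircleActionNearBoundary n M)

namespace Tube
variable {A} (τ : A.Tube)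

/-- On the tube, `f` is the boundary coordinate times the positive smooth function `g`. -/
structure IsFactor (f : M → ℝ) (g : SliceSpace n × ℝ → ℝ) : Prop where
  contDiffOn : ContDiffOn ℝ ∞ g τ.Dp
  pos : ∀ d ∈ τ.Dp, 0 < g d
  eq : ∀ x ∈ τ.T, f x = (τ.co x).2 * g (τ.co x)

/-- The extension of the cut coordinates to an equivariant map. -/
def eqCo (g : SliceSpace n × ℝ → ℝ) (p : M × ℂ) : SliceSpace n × ℂ :=
  ((τ.co p.1).1, ((√(g (τ.co p.1)))⁻¹ : ℝ) * (p.2 * (τ.ang p.1 : ℂ)))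

variable {τ} {f : M → ℝ} {g : SliceSpace n × ℝ → ℝ} (h : τ.IsFactor f g)
include h

theorem IsFactor.apply_act {x : M} (hx : x ∈ τ.T) (a : Circle) : f (A.act a x) = f x := by
  rw [h.eq _ (τ.act_mem_T_of_mem a hx), h.eq _ hx, τ.co_act_of_mem a hx]

theorem IsFactor.eqCo_act {x : M} (hx : x ∈ τ.T) (a : Circle) (z : ℂ) :
    τ.eqCo g (A.act a x, z) = τ.eqCo g (x, (a : ℂ) * z) := by
  simp only [eqCo, τ.co_act_of_mem a hx, τ.ang_act_of_mem a hx, Circle.coe_mul]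
  congr 2
  ring

/-- As `f` is the transversal coordinate t times `g`, the factor √g cancels and √t times the angle
remains. Thus the cut coordinates, not smooth at the boundary as functions on M, are values of the
smooth map `eqCo` at z = √f. -/
theorem IsFactor.eqCo_sqrt {x : M} (hx : x ∈ τ.T) :
    τ.eqCo g (x, ((√(f x) : ℝ) : ℂ)) = τ.cutCo x := by
  have h1 : √(g (τ.co x)) ≠ 0 := (Real.sqrt_pos.2 (h.pos _ (τ.co_mem hx))).ne'
  simp only [eqCo, cutCo]
  rw [h.eq x hx, Real.sqrt_mul (τ.co_mem hx).2]
  congr 1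
  rw [← mul_assoc, ← Complex.ofReal_mul]
  congr 2
  field_simp

theorem IsFactor.contMDiffOn_eqCo : ContMDiffOn ((𝓡∂ n).prod 𝓘(ℝ, ℂ)) 𝓘(ℝ, SliceSpace n × ℂ) ∞
    (τ.eqCo g) (τ.T ×ˢ univ) := by
  have h1 : ContMDiffOn ((𝓡∂ n).prod 𝓘(ℝ, ℂ)) 𝓘(ℝ, SliceSpace n × ℝ) ∞
      (fun p : M × ℂ ↦ τ.co p.1) (τ.T ×ˢ univ) :=
    τ.contMDiffOn_co.comp contMDiffOn_fst fun p hp ↦ hp.1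
  have h2 : ContDiffOn ℝ ∞ (fun d ↦ (((√(g d))⁻¹ : ℝ) : ℂ)) τ.Dp := by
    refine Complex.ofRealCLM.contDiff.comp_contDiffOn (ContDiffOn.inv ?_ fun d hd ↦
      (Real.sqrt_pos.2 (h.pos _ hd)).ne')
    exact h.contDiffOn.sqrt fun d hd ↦ (h.pos d hd).ne'
  have h3 : ContMDiffOn ((𝓡∂ n).prod 𝓘(ℝ, ℂ)) 𝓘(ℝ, ℂ) ∞
      (fun p : M × ℂ ↦ (((√(g (τ.co p.1)))⁻¹ : ℝ) : ℂ)) (τ.T ×ˢ univ) :=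
    h2.contMDiffOn.comp h1 fun p hp ↦ τ.co_mem hp.1
  have h4 : ContMDiffOn ((𝓡∂ n).prod 𝓘(ℝ, ℂ)) 𝓘(ℝ, ℂ) ∞
      (fun p : M × ℂ ↦ (τ.ang p.1 : ℂ)) (τ.T ×ˢ univ) :=
    τ.contMDiffOn_ang.comp contMDiffOn_fst fun p hp ↦ hp.1
  refine ContMDiffOn.prodMk_space ?_ ?_
  · exact (contDiff_fst.contMDiff (n := ∞)).comp_contMDiffOn h1
  · exact fun p hp ↦ (h3 p hp).complex_mul ((contMDiffOn_snd p hp).complex_mul (h4 p hp))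

/-- Equivariance moves the rotation from the point to the complex variable, where it combines with
√f = √g·‖z‖ to √g·z. The right-hand side no longer contains the argument of z, which is what gives
smoothness at z = 0. -/
theorem IsFactor.lift_eq {Z : Type*} {F : M × ℂ → Z} {v : SliceSpace n × ℂ} (hv : v ∈ τ.cutD)
    (hF : ∀ a : Circle, ∀ z : ℂ, F (A.act a (τ.σ (v.1, ‖v.2‖ ^ 2)), z) =
      F (τ.σ (v.1, ‖v.2‖ ^ 2), (a : ℂ) * z)) :
    F (τ.lift v, ((√(f (τ.lift v)) : ℝ) : ℂ)) =
      F (τ.σ (v.1, ‖v.2‖ ^ 2), ((√(g (v.1, ‖v.2‖ ^ 2)) : ℝ) : ℂ) * v.2) := by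
  rw [h.eq _ (τ.lift_mem_T hv), τ.co_lift hv, Real.sqrt_mul (sq_nonneg _),
    Real.sqrt_sq (norm_nonneg _), lift, hF]
  congr 2
  have h1 := exp_arg_mul_norm v.2
  calc _ = ((√(g (v.1, ‖v.2‖ ^ 2)) : ℝ) : ℂ) * ((Circle.exp (Complex.arg v.2) : ℂ) * ‖v.2‖) := by
        push_cast; ring
    _ = _ := by rw [h1]

/-- The smoothness at points over the boundary of a function on the cut space that comes from an
equivariant germ. -/
theorem IsFactor.contDiffAt_comp_lift {Z : Type*} [NormedAddCommGroup Z] [NormedSpace ℝ Z]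
    {F : M × ℂ → Z} {h' : A.Cut → Z} {v : SliceSpace n × ℂ} (hv : v ∈ τ.cutD) {V : Set M}
    (hV : V ∈ 𝓝 (τ.σ (v.1, ‖v.2‖ ^ 2))) (hVa : ∀ a, ∀ x ∈ V, A.act a x ∈ V)
    (hF : ContMDiffOn ((𝓡∂ n).prod 𝓘(ℝ, ℂ)) 𝓘(ℝ, Z) ∞ F (V ×ˢ univ))
    (hFa : ∀ a : Circle, ∀ x ∈ V, ∀ z : ℂ, F (A.act a x, z) = F (x, (a : ℂ) * z))
    (hFh : ∀ x ∈ V, h' (A.c x) = F (x, ((√(f x) : ℝ) : ℂ))) :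
    ContDiffAt ℝ ∞ (fun u ↦ h' (A.c (τ.lift u))) v := by
  have hσ := τ.contMDiffOn_σ_sq.contMDiffAt (τ.isOpen_cutD.mem_nhds hv)
  have hg : ContDiffAt ℝ ∞ (fun u : SliceSpace n × ℂ ↦ ((√(g (u.1, ‖u.2‖ ^ 2)) : ℝ) : ℂ)) v := by
    refine Complex.ofRealCLM.contDiff.contDiffAt.comp v (ContDiffAt.sqrt ?_
      (h.pos _ (τ.sq_mem_Dp hv)).ne')
    exact (h.contDiffOn.comp contDiff_sq.contDiffOn fun u hu ↦ τ.sq_mem_Dp hu).contDiffAt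
      (τ.isOpen_cutD.mem_nhds hv)
  have h1 : ContMDiffAt 𝓘(ℝ, SliceSpace n × ℂ) 𝓘(ℝ, Z) ∞ (fun u : SliceSpace n × ℂ ↦
      F (τ.σ (u.1, ‖u.2‖ ^ 2), ((√(g (u.1, ‖u.2‖ ^ 2)) : ℝ) : ℂ) * u.2)) v := by
    refine ContMDiffAt.comp (f := fun u : SliceSpace n × ℂ ↦
      (τ.σ (u.1, ‖u.2‖ ^ 2), ((√(g (u.1, ‖u.2‖ ^ 2)) : ℝ) : ℂ) * u.2)) v
      (hF.contMDiffAt (prod_mem_nhds hV univ_mem)) (hσ.prodMk ?_)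
    exact (hg.mul contDiffAt_snd).contMDiffAt
  refine (contMDiffAt_iff_contDiffAt.1 h1).congr_of_eventuallyEq ?_
  filter_upwards [τ.isOpen_cutD.mem_nhds hv, hσ.continuousAt.preimage_mem_nhds hV] with u hu huV
  rw [← h.lift_eq (F := F) hu fun a z ↦ hFa a _ huV z]
  exact hFh _ (hVa _ _ huV)

omit h in
theorem contMDiffAt_cutCo [IsManifold (𝓡∂ n) ∞ M] {x : M} (hx : x ∈ τ.T)
    (hxi : x ∈ (𝓡∂ n).interior M) :
    ContMDiffAt (𝓡∂ n) 𝓘(ℝ, SliceSpace n × ℂ) ∞ τ.cutCo x := by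
  have hT := τ.isOpen_T.mem_nhds hx
  have h0 : (τ.co x).2 ≠ 0 := fun h0 ↦ by
    rw [← ModelWithCorners.compl_boundary] at hxi
    exact hxi ((τ.mem_boundary_iff hx).2 h0)
  refine ContMDiffAt.prodMk_space ?_ ?_
  · exact (contDiff_fst.contMDiff (n := ∞)).contMDiffAt.comp x (τ.contMDiffOn_co.contMDiffAt hT)
  · refine ContMDiffWithinAt.complex_mul ?_ (τ.contMDiffOn_ang.contMDiffAt hT)
    refine ContMDiffAt.comp (g := fun r : ℝ ↦ ((√r : ℝ) : ℂ)) (f := fun x ↦ (τ.co x).2) x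
      (ContDiffAt.contMDiffAt ?_) (τ.contMDiffOn_co_snd.contMDiffAt hT)
    exact Complex.ofRealCLM.contDiff.contDiffAt.comp _ (contDiffAt_id.sqrt h0)

omit h in
theorem finrank_eq_finrank (τ : A.Tube) : Module.finrank ℝ (SliceSpace n × ℂ) =
    Module.finrank ℝ (EuclideanSpace ℝ (Fin n)) := by
  have := τ.two_le
  simp only [Module.finrank_prod, finrank_euclideanSpace_fin, Complex.finrank_real_complex]
  omega

/-- An identification of the coordinate space of a tube with the model space. -/
def linEquiv (τ : A.Tube) : (SliceSpace n × ℂ) ≃L[ℝ] EuclideanSpace ℝ (Fin n) :=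
  ContinuousLinearEquiv.ofFinrankEq τ.finrank_eq_finrank

/-- The chart of the cut space that is given by a tube. -/
def euclChart (τ : A.Tube) [IsManifold (𝓡∂ n) ∞ M] :
    OpenPartialHomeomorph A.Cut (EuclideanSpace ℝ (Fin n)) :=
  τ.cutChart.transHomeomorph τ.linEquiv.toHomeomorph

end Tube

variable {A} in
theorem IsInvariantBoundaryDefining.exists_tube [T2Space M] [IsManifold (𝓡∂ n) ∞ M] {f : M → ℝ}
    (hf : A.IsInvariantBoundaryDefining f) {V : Set M} (hV : A.IsInvariantNhd V) {x₀ : M}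
    (hx₀ : x₀ ∈ (𝓡∂ n).boundary M) :
    ∃ τ : A.Tube, τ.σ 0 = x₀ ∧ τ.T ⊆ V ∧ ∃ g, τ.IsFactor f g := by
  obtain ⟨V', hV', hfV'⟩ := hf.invariant
  obtain ⟨τ, h0, hT⟩ := A.exists_tube (hV.inter hV') hx₀
  obtain ⟨g, h1, h2, h3⟩ := τ.exists_pos_factor hf fun a x hx ↦ hfV' a x (hT hx).2
  exact ⟨τ, h0, hT.trans inter_subset_left, g, h1, h2, h3⟩

/-- The atlas of the cut space that is given by an invariant boundary defining function. -/
def cutAtlas [IsManifold (𝓡∂ n) ∞ M] (f : M → ℝ) :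
    Set (OpenPartialHomeomorph A.Cut (EuclideanSpace ℝ (Fin n))) :=
  {e | (∃ (τ : A.Tube) (g : _), τ.IsFactor f g ∧ e = τ.euclChart) ∨ ∃ x, e = A.interiorChart x}

theorem contMDiffAt_interiorChart_comp_c [IsManifold (𝓡∂ n) ∞ M] {x y : M}
    (hx : x ∈ (𝓡∂ n).interior M) (hxy : x ∈ (extChartAt (𝓡∂ n) y).source) :
    ContMDiffAt (𝓡∂ n) (𝓡 n) ∞ (fun z ↦ A.interiorChart y (A.c z)) x := by
  refine (contMDiffAt_extChartAt' (by rwa [extChartAt_source] at hxy)).congr_of_eventuallyEq ?_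
  filter_upwards [(ModelWithCorners.isOpen_interior (I := 𝓡∂ n) (M := M) (n := ∞)
    (by simp)).mem_nhds hx] with z hz
  change extChartAt (𝓡∂ n) y (A.out (A.c z)) = _
  rw [A.out_c_of_interior hz]

theorem mem_source_interiorChart_iff [IsManifold (𝓡∂ n) ∞ M] {x y : M} :
    A.c x ∈ (A.interiorChart y).source ↔
      x ∈ (𝓡∂ n).interior M ∧ x ∈ (extChartAt (𝓡∂ n) y).source := by
  constructor
  · intro h
    have h2 := A.preimage_image_c_of_subset_interior
      (O := (𝓡∂ n).interior M ∩ (extChartAt (𝓡∂ n) y).source) inter_subset_left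
    have h3 : x ∈ A.c ⁻¹' (A.c '' ((𝓡∂ n).interior M ∩ (extChartAt (𝓡∂ n) y).source)) := h
    rwa [h2] at h3
  · exact fun h ↦ ⟨x, h, rfl⟩

theorem Tube.mem_source_iff [IsManifold (𝓡∂ n) ∞ M] (τ : A.Tube) {x : M} :
    A.c x ∈ τ.cutChart.source ↔ x ∈ τ.T := by
  constructor
  · intro h
    have h3 : x ∈ A.c ⁻¹' (A.c '' τ.T) := h
    rwa [A.preimage_image_c_of_invariant fun a x hx ↦ τ.act_mem_T_of_mem a hx] at h3
  · exact fun h ↦ ⟨x, h, rfl⟩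

theorem exists_lift_interiorChart [IsManifold (𝓡∂ n) ∞ M] (y : M) {v}
    (hv : v ∈ (A.interiorChart y).target) :
    (extChartAt (𝓡∂ n) y).symm v ∈ (𝓡∂ n).interior M ∧
      ContMDiffAt (𝓡 n) (𝓡∂ n) ∞ (extChartAt (𝓡∂ n) y).symm v := by
  have h1 := (A.interiorChart y).map_target hv
  refine ⟨(A.mem_source_interiorChart_iff.1 h1).1, ?_⟩
  exact ((contMDiffOn_extChartAt_symm y).mono inter_subset_left).contMDiffAt
    ((A.interiorChart y).open_target.mem_nhds hv)

theorem contMDiffAt_atlas_comp_c [IsManifold (𝓡∂ n) ∞ M] {f : M → ℝ}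
    {e : OpenPartialHomeomorph A.Cut (EuclideanSpace ℝ (Fin n))} (he : e ∈ A.cutAtlas f)
    {x : M} (hx : x ∈ (𝓡∂ n).interior M) (hxe : A.c x ∈ e.source) :
    ContMDiffAt (𝓡∂ n) (𝓡 n) ∞ (fun z ↦ e (A.c z)) x := by
  rcases he with ⟨τ, g, h, rfl⟩ | ⟨y, rfl⟩
  · have hxT : x ∈ τ.T := τ.mem_source_iff.1 hxe
    have h1 : ContMDiffAt (𝓡∂ n) (𝓡 n) ∞ (fun z ↦ τ.linEquiv (τ.cutCo z)) x :=
      (τ.linEquiv.contDiff.contMDiff (n := ∞)).contMDiffAt.comp x (τ.contMDiffAt_cutCo hxT hx)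
    refine h1.congr_of_eventuallyEq ?_
    filter_upwards [τ.isOpen_T.mem_nhds hxT] with z hz
    rw [← τ.cutChart_c hz]
    rfl
  · exact A.contMDiffAt_interiorChart_comp_c hx (A.mem_source_interiorChart_iff.1 hxe).2

/-- Away from z = 0 both charts are compared through the interior of M. Points with z = 0 are in no
interior chart, and for a second tube `eqCo` is the equivariant smooth map to which
`contDiffAt_comp_lift` applies. -/
theorem contDiffAt_coordChange [IsManifold (𝓡∂ n) ∞ M] {f : M → ℝ}
    {e e' : OpenPartialHomeomorph A.Cut (EuclideanSpace ℝ (Fin n))} (he : e ∈ A.cutAtlas f)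
    (he' : e' ∈ A.cutAtlas f) {v : EuclideanSpace ℝ (Fin n)} (hv : v ∈ e.target)
    (hv' : e.symm v ∈ e'.source) : ContDiffAt ℝ ∞ (fun u ↦ e' (e.symm u)) v := by
  rcases he with ⟨τ, g, h, rfl⟩ | ⟨y, rfl⟩
  · set w := τ.linEquiv.symm v with hw
    have hwD : w ∈ τ.cutD := hv
    suffices hs : ContDiffAt ℝ ∞ (fun u ↦ e' (A.c (τ.lift u))) w from
      ContDiffAt.comp (f := τ.linEquiv.symm) v hs τ.linEquiv.symm.contDiff.contDiffAt
    have hs' : A.c (τ.lift w) ∈ e'.source := hv'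
    by_cases h0 : w.2 = 0
    · have hb : τ.lift w ∈ (𝓡∂ n).boundary M := (τ.lift_mem_boundary_iff hwD).2 h0
      rcases he' with ⟨τ', g', h', rfl⟩ | ⟨y, rfl⟩
      · have hT' : τ.lift w ∈ τ'.T := τ'.mem_source_iff.1 hs'
        suffices hs2 : ContDiffAt ℝ ∞ (fun u ↦ τ'.cutChart (A.c (τ.lift u))) w from
          τ'.linEquiv.contDiff.contDiffAt.comp w hs2
        have hσT : τ.σ (w.1, ‖w.2‖ ^ 2) ∈ τ'.T := by
          rw [← A.act_inv_act (Circle.exp (Complex.arg w.2)) (τ.σ_mem _ (τ.sq_mem_Dp hwD))]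
          exact τ'.act_mem_T_of_mem _ hT'
        refine h.contDiffAt_comp_lift (F := τ'.eqCo g') hwD (τ'.isOpen_T.mem_nhds hσT)
          (fun a x hx ↦ τ'.act_mem_T_of_mem a hx) h'.contMDiffOn_eqCo
          (fun a x hx z ↦ h'.eqCo_act hx a z) fun x hx ↦ ?_
        rw [h'.eqCo_sqrt hx, τ'.cutChart_c hx]
      · have := (A.mem_source_interiorChart_iff.1 hs').1
        rw [← ModelWithCorners.compl_boundary] at this
        exact absurd hb this
    · rw [← contMDiffAt_iff_contDiffAt]
      exact (A.contMDiffAt_atlas_comp_c he' ((τ.lift_mem_interior_iff hwD).2 h0) hs').comp w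
        (τ.contMDiffAt_lift hwD h0)
  · obtain ⟨h1, h2⟩ := A.exists_lift_interiorChart y hv
    rw [← contMDiffAt_iff_contDiffAt]
    exact (A.contMDiffAt_atlas_comp_c he' h1 hv').comp v h2

/-- The cut space with the smooth structure that is given by an invariant boundary defining
function. -/
def StdCut {f : M → ℝ} (_ : A.IsInvariantBoundaryDefining f) : Type _ := A.Cut

section StdCut
variable {A} {f : M → ℝ} (hf : A.IsInvariantBoundaryDefining f)

instance : TopologicalSpace (A.StdCut hf) := inferInstanceAs (TopologicalSpace A.Cut)

variable [T2Space M] [IsManifold (𝓡∂ n) ∞ M]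

include hf in
theorem exists_mem_cutAtlas (p : A.Cut) : ∃ e ∈ A.cutAtlas f, p ∈ e.source := by
  obtain ⟨x, rfl⟩ := A.surjective_c p
  by_cases hx : x ∈ (𝓡∂ n).boundary M
  · obtain ⟨τ, h0, -, g, h⟩ := hf.exists_tube A.isInvariantNhd_U hx
    refine ⟨τ.euclChart, Or.inl ⟨τ, g, h, rfl⟩, τ.mem_source_iff.2 ?_⟩
    rw [← h0]
    exact τ.σ_mem_T τ.zero_mem_Dp
  · refine ⟨A.interiorChart x, Or.inr ⟨x, rfl⟩, A.mem_source_interiorChart_iff.2 ⟨?_,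
      mem_extChartAt_source x⟩⟩
    rwa [← ModelWithCorners.compl_boundary]

instance : ChartedSpace (EuclideanSpace ℝ (Fin n)) (A.StdCut hf) where
  atlas := A.cutAtlas f
  chartAt p := (exists_mem_cutAtlas hf p).choose
  mem_chart_source p := (exists_mem_cutAtlas hf p).choose_spec.2
  chart_mem_atlas p := (exists_mem_cutAtlas hf p).choose_spec.1

instance : IsManifold (𝓡 n) ∞ (A.StdCut hf) := by
  refine isManifold_of_contDiffOn _ _ _ fun e e' he he' v hv ↦ ?_
  have hv1 : v ∈ (e.symm.trans e').source := hv.1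
  rw [OpenPartialHomeomorph.trans_source] at hv1
  exact (A.contDiffAt_coordChange (f := f) he he' hv1.1 hv1.2).contDiffWithinAt

end StdCut
end FreeCircleActionNearBoundary
end

/-! ### The smooth functions of the cut space -/

noncomputable section

open Set Filter Topology

namespace FreeCircleActionNearBoundary

variable {n : ℕ} [NeZero n] {M : Type*} [TopologicalSpace M]
  [ChartedSpace (EuclideanHalfSpace n) M]
  {A : FreeCircleActionNearBoundary n M} {f : M → ℝ} (hf : A.IsInvariantBoundaryDefining f)

section
variable [T2Space M] [SecondCountableTopology M] [IsManifold (𝓡∂ n) ∞ M]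

include hf in
-- The function is prescribed on the set where |z|² = f(x), over a neighbourhood of the boundary.
-- Locally it extends through `eqCo`, and a partition of unity glues the extensions.
theorem exists_contMDiff_extension {h : A.Cut → ℝ} (hh : ∀ (τ : A.Tube) (g : _), τ.IsFactor f g →
      ContDiffOn ℝ ∞ (fun v ↦ h (A.c (τ.lift v))) τ.cutD) :
    ∃ (V : Set M) (H : M × ℂ → ℝ), A.IsInvariantNhd V ∧
      ContMDiff ((𝓡∂ n).prod 𝓘(ℝ, ℂ)) 𝓘(ℝ, ℝ) ∞ H ∧
      ∀ x ∈ V, ∀ b : Circle, H (x, (b : ℂ) * ((√(f x) : ℝ) : ℂ)) = h (A.c (A.act b x)) := by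
  have : LocallyCompactSpace M := Manifold.locallyCompact_of_finiteDimensional (𝓡∂ n)
  have hbc : IsClosed ((𝓡∂ n).boundary M) := ModelWithCorners.isClosed_boundary (n := ∞) (by simp)
  have hTo : IsOpen {x | ∃ (τ : A.Tube) (g : _), τ.IsFactor f g ∧ x ∈ τ.T} := by
    rw [isOpen_iff_mem_nhds]
    rintro x ⟨τ, g, h, hx⟩
    filter_upwards [τ.isOpen_T.mem_nhds hx] with y hy using ⟨τ, g, h, hy⟩
  have hTb : (𝓡∂ n).boundary M ⊆ {x | ∃ (τ : A.Tube) (g : _), τ.IsFactor f g ∧ x ∈ τ.T} := by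
    intro x hx
    obtain ⟨τ, h0, -, g, h⟩ := hf.exists_tube A.isInvariantNhd_U hx
    exact ⟨τ, g, h, h0 ▸ τ.σ_mem_T τ.zero_mem_Dp⟩
  obtain ⟨W, hW, hbW, hWT⟩ := normal_exists_closure_subset hbc hTo hTb
  obtain ⟨V, hV, hVW⟩ := A.exists_isInvariantNhd hW hbW
  -- At each point the constraint fixes a value or is void, so it is convex. It is void off `closure
  -- W`, and near a point with |z|² ≠ f(x) as well; at the remaining points `h ∘ c ∘ lift ∘ eqCo` is
  -- a local solution.
  have key : ∃ H : C^∞⟮(𝓡∂ n).prod 𝓘(ℝ, ℂ), M × ℂ; 𝓘(ℝ, ℝ), ℝ⟯, ∀ p : M × ℂ,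
      H p ∈ {r : ℝ | p.1 ∈ closure W → ∀ b : Circle, p.2 = (b : ℂ) * ((√(f p.1) : ℝ) : ℂ) →
        r = h (A.c (A.act b p.1))} := by
    refine exists_contMDiffMap_forall_mem_convex_of_local (n := ⊤) ((𝓡∂ n).prod 𝓘(ℝ, ℂ)) ?_ ?_
    · intro p r₁ h₁ r₂ h₂ s t _ _ hst hp b hb
      rw [h₁ hp b hb, h₂ hp b hb, ← add_smul, hst, one_smul]
    · rintro ⟨x, z⟩
      have hnorm : ∀ (y : M) (b : Circle),
          ‖(b : ℂ) * ((√(f y) : ℝ) : ℂ)‖ ^ 2 = f y := fun y b ↦ by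
        rw [norm_mul, Circle.norm_coe, one_mul, Complex.norm_real, Real.norm_eq_abs, sq_abs,
          Real.sq_sqrt (hf.nonneg y)]
      by_cases hx : x ∈ closure W
      · by_cases hz : ‖z‖ ^ 2 = f x
        · obtain ⟨τ, g, hτ, hxT⟩ := hWT hx
          have hpos := hτ.pos _ (τ.co_mem hxT)
          have hmem : τ.eqCo g (x, z) ∈ τ.cutD := by
            have h1 : ‖(τ.eqCo g (x, z)).2‖ ^ 2 = (τ.co x).2 := by
              simp only [Tube.eqCo]
              rw [norm_mul, norm_mul, Circle.norm_coe, mul_one, Complex.norm_real,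
                Real.norm_eq_abs, mul_pow, sq_abs, inv_pow, Real.sq_sqrt hpos.le, hz,
                hτ.eq x hxT]
              field_simp
            change (_, _) ∈ τ.D
            rw [h1]
            exact (τ.co_mem hxT).1
          have hTn : τ.T ×ˢ (univ : Set ℂ) ∈ 𝓝 (x, z) :=
            prod_mem_nhds (τ.isOpen_T.mem_nhds hxT) univ_mem
          refine ⟨(τ.T ×ˢ univ) ∩ τ.eqCo g ⁻¹' τ.cutD, inter_mem hTn
            ((hτ.contMDiffOn_eqCo.continuousOn.continuousAt hTn).preimage_mem_nhds
              (τ.isOpen_cutD.mem_nhds hmem)), fun p ↦ h (A.c (τ.lift (τ.eqCo g p))), ?_, ?_⟩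
          · exact (hh τ g hτ).contMDiffOn.comp (hτ.contMDiffOn_eqCo.mono inter_subset_left)
              inter_subset_right
          · rintro ⟨y, w⟩ ⟨⟨hy, -⟩, -⟩ - b hb
            change w = (b : ℂ) * ((√(f y) : ℝ) : ℂ) at hb
            change h (A.c (τ.lift (τ.eqCo g (y, w)))) = h (A.c (A.act b y))
            rw [hb, ← hτ.eqCo_act hy, ← hτ.apply_act hy b,
              hτ.eqCo_sqrt (τ.act_mem_T_of_mem b hy), τ.c_lift_cutCo (τ.act_mem_T_of_mem b hy)]
        · have hcont : Continuous fun p : M × ℂ ↦ ‖p.2‖ ^ 2 - f p.1 :=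
            (continuous_snd.norm.pow 2).sub (hf.smooth.continuous.comp continuous_fst)
          refine ⟨{p | ‖p.2‖ ^ 2 - f p.1 ≠ 0}, hcont.continuousAt.preimage_mem_nhds
            (isOpen_ne.mem_nhds (sub_ne_zero.2 hz)), fun _ ↦ 0, contMDiffOn_const, ?_⟩
          rintro ⟨y, w⟩ hyw - b hb
          change w = (b : ℂ) * ((√(f y) : ℝ) : ℂ) at hb
          refine absurd ?_ hyw
          change ‖w‖ ^ 2 - f y = 0
          rw [hb, hnorm, sub_self]
      · refine ⟨(closure W)ᶜ ×ˢ univ, prod_mem_nhds (isClosed_closure.isOpen_compl.mem_nhds hx)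
          univ_mem, fun _ ↦ 0, contMDiffOn_const, ?_⟩
        rintro ⟨y, w⟩ ⟨hy, -⟩ hy'
        exact absurd hy' hy
  obtain ⟨H, hH⟩ := key
  exact ⟨V, H, hV, H.contMDiff, fun x hx b ↦ hH _ (subset_closure (hVW hx)) b rfl⟩

include hf in
-- Averaging `H₀ (b·x, b⁻¹ z)` over `b` makes the extension equivariant. It does not change the
-- values at z = √f, where every integrand already equals `h (c x)`.
theorem exists_equivariant_extension {h : A.Cut → ℝ} (hh : ∀ (τ : A.Tube) (g : _),
      τ.IsFactor f g → ContDiffOn ℝ ∞ (fun v ↦ h (A.c (τ.lift v))) τ.cutD) :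
    ∃ (V : Set M) (H : M × ℂ → ℝ), A.IsInvariantNhd V ∧
        ContMDiffOn ((𝓡∂ n).prod 𝓘(ℝ, ℂ)) 𝓘(ℝ, ℝ) ∞ H (V ×ˢ Set.univ) ∧
        (∀ a : Circle, ∀ x ∈ V, ∀ z : ℂ, H (A.act a x, z) = H (x, (a : ℂ) * z)) ∧
        ∀ x ∈ V, h (A.c x) = H (x, ((√(f x) : ℝ) : ℂ)) := by
  obtain ⟨V₀, H₀, hV₀, hH₀, hH₀h⟩ := exists_contMDiff_extension hf hh
  obtain ⟨V₁, hV₁, hfV₁⟩ := hf.invariant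
  have hV := hV₀.inter hV₁
  have hpi : (0 : ℝ) < 2 * Real.pi := by positivity
  refine ⟨V₀ ∩ V₁, fun p ↦ (2 * Real.pi)⁻¹ * ∫ s in (0 : ℝ)..2 * Real.pi,
    H₀ (A.act (Circle.exp s) p.1, ((Circle.exp s)⁻¹ : Circle) * p.2), hV, ?_, ?_, ?_⟩
  · have h1 : ContMDiffOn ((𝓡∂ n).prod 𝓘(ℝ, ℂ)) 𝓘(ℝ, ℝ) ∞
        (fun p : M × ℂ ↦ ∫ s in (0 : ℝ)..2 * Real.pi,
          H₀ (A.act (Circle.exp s) p.1, ((Circle.exp s)⁻¹ : Circle) * p.2))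
        ((V₀ ∩ V₁) ×ˢ univ) := by
      refine contMDiffOn_intervalIntegral_param ((𝓡∂ n).prod 𝓘(ℝ, ℂ)) (hV.isOpen.prod isOpen_univ)
        hpi (G := fun q : ℝ × (M × ℂ) ↦
          H₀ (A.act (Circle.exp q.1) q.2.1, ((Circle.exp q.1)⁻¹ : Circle) * q.2.2)) ?_
      rintro ⟨s, x, z⟩ ⟨-, hx, -⟩
      refine (hH₀.contMDiffAt.comp (f := fun q : ℝ × (M × ℂ) ↦
        (A.act (Circle.exp q.1) q.2.1, (((Circle.exp q.1)⁻¹ : Circle) : ℂ) * q.2.2))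
        (s, x, z) (ContMDiffAt.prodMk ?_ ?_)).contMDiffWithinAt
      · exact (A.contMDiffAt_exp_act_prod s (hV.subset_U hx)).comp
          (f := fun q : ℝ × (M × ℂ) ↦ (q.1, q.2.1)) (s, x, z)
          (contMDiffAt_fst.prodMk (contMDiffAt_fst.comp _ contMDiffAt_snd))
      · refine ContMDiffWithinAt.complex_mul ?_ ?_
        · have h2 : ContDiff ℝ ∞ fun s : ℝ ↦ (((Circle.exp s)⁻¹ : Circle) : ℂ) := by
            simp only [← Circle.exp_neg, Circle.coe_exp]
            exact ((Complex.ofRealCLM.contDiff.comp contDiff_neg).mul contDiff_const).cexp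
          exact h2.contMDiff.contMDiffAt.comp _ contMDiffAt_fst
        · exact contMDiffAt_snd.comp _ contMDiffAt_snd
    exact (contDiff_const.mul contDiff_id :
      ContDiff ℝ ∞ fun r : ℝ ↦ (2 * Real.pi)⁻¹ * r).contMDiff.comp_contMDiffOn h1
  · intro a x hx z
    have h1 := intervalIntegral_circle_mul
      (fun b ↦ H₀ (A.act b x, ((b⁻¹ : Circle) : ℂ) * ((a : ℂ) * z))) a
    simp only [A.mul_act _ _ x (hV.subset_U hx)] at h1
    have h2 : ∀ s, (((Circle.exp s * a)⁻¹ : Circle) : ℂ) * ((a : ℂ) * z) =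
        (((Circle.exp s)⁻¹ : Circle) : ℂ) * z := fun s ↦ by
      rw [← mul_assoc, ← Circle.coe_mul, mul_inv_rev, mul_comm a⁻¹, inv_mul_cancel_right]
    simp only [h2] at h1
    simp only [h1]
  · intro x hx
    have h1 : ∀ s, H₀ (A.act (Circle.exp s) x, ((Circle.exp s)⁻¹ : Circle) *
        ((√(f x) : ℝ) : ℂ)) = h (A.c x) := fun s ↦ by
      rw [← hfV₁ (Circle.exp s) x hx.2, hH₀h _ (hV₀.act_mem _ _ hx.1),
        A.act_inv_act _ (hV₀.subset_U hx.1)]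
    simp only [h1, intervalIntegral.integral_const, sub_zero, smul_eq_mul]
    field_simp

/-- The identity map to the cut space with its standard structure. -/
def toStd (p : A.Cut) : A.StdCut hf := p

/-- The identity map from the cut space with its standard structure. -/
def ofStd (p : A.StdCut hf) : A.Cut := p

theorem continuous_toStd : Continuous (toStd hf) := continuous_id

theorem continuous_ofStd : Continuous (ofStd hf) := continuous_id

theorem contMDiffOn_of_mem_cutAtlas {e : OpenPartialHomeomorph A.Cut (EuclideanSpace ℝ (Fin n))}
    (he : e ∈ A.cutAtlas f) :
    ContMDiffOn (𝓡 n) (𝓡 n) ∞ (fun p : A.StdCut hf ↦ e (ofStd hf p)) (ofStd hf ⁻¹' e.source) := by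
  let e' : OpenPartialHomeomorph (A.StdCut hf) (EuclideanSpace ℝ (Fin n)) := e
  have he' : e' ∈ atlas _ (A.StdCut hf) := he
  exact contMDiffOn_of_mem_maximalAtlas (IsManifold.subset_maximalAtlas he')

theorem contMDiffOn_symm_of_mem_cutAtlas
    {e : OpenPartialHomeomorph A.Cut (EuclideanSpace ℝ (Fin n))} (he : e ∈ A.cutAtlas f) :
    ContMDiffOn (𝓡 n) (𝓡 n) ∞ (fun v ↦ toStd hf (e.symm v)) e.target := by
  let e' : OpenPartialHomeomorph (A.StdCut hf) (EuclideanSpace ℝ (Fin n)) := e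
  have he' : e' ∈ atlas _ (A.StdCut hf) := he
  exact contMDiffOn_symm_of_mem_maximalAtlas (IsManifold.subset_maximalAtlas he')

theorem contMDiffOn_lift_stdCut {τ : A.Tube} {g} (h : τ.IsFactor f g) :
    ContMDiffOn 𝓘(ℝ, SliceSpace n × ℂ) (𝓡 n) ∞ (fun v ↦ toStd hf (A.c (τ.lift v)))
      τ.cutD := by
  have h1 := contMDiffOn_symm_of_mem_cutAtlas hf (e := τ.euclChart) (Or.inl ⟨τ, g, h, rfl⟩)
  have h2 := h1.comp (s := τ.cutD) (τ.linEquiv.contDiff.contMDiff (n := ∞)).contMDiffOn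
    fun v hv ↦ by
      change τ.linEquiv.symm (τ.linEquiv v) ∈ τ.cutD
      rwa [τ.linEquiv.symm_apply_apply]
  refine h2.congr fun v _ ↦ ?_
  change _ = toStd hf (A.c (τ.lift (τ.linEquiv.symm (τ.linEquiv v))))
  rw [τ.linEquiv.symm_apply_apply]

theorem contMDiffOn_cutChart_stdCut {τ : A.Tube} {g} (h : τ.IsFactor f g) :
    ContMDiffOn (𝓡 n) 𝓘(ℝ, SliceSpace n × ℂ) ∞
      (fun p ↦ τ.cutChart (ofStd hf p)) (ofStd hf ⁻¹' τ.cutChart.source) := by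
  have h1 := contMDiffOn_of_mem_cutAtlas hf (e := τ.euclChart) (Or.inl ⟨τ, g, h, rfl⟩)
  have h2 := (τ.linEquiv.symm.contDiff.contMDiff (n := ∞)).comp_contMDiffOn h1
  refine h2.congr fun v _ ↦ ?_
  exact (τ.linEquiv.symm_apply_apply _).symm

theorem contMDiffOn_c_stdCut :
    ContMDiffOn (𝓡∂ n) (𝓡 n) ∞ (fun x ↦ toStd hf (A.c x)) ((𝓡∂ n).interior M) := by
  intro x hx
  have hs : A.c x ∈ (A.interiorChart x).source :=
    A.mem_source_interiorChart_iff.2 ⟨hx, mem_extChartAt_source x⟩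
  have h1 := (contMDiffOn_symm_of_mem_cutAtlas hf (e := A.interiorChart x)
    (Or.inr ⟨x, rfl⟩)).contMDiffAt
    ((A.interiorChart x).open_target.mem_nhds ((A.interiorChart x).map_source hs))
  have h2 := h1.comp x (A.contMDiffAt_interiorChart_comp_c hx (mem_extChartAt_source x))
  refine (h2.congr_of_eventuallyEq ?_).contMDiffWithinAt
  filter_upwards [(ModelWithCorners.isOpen_interior (I := 𝓡∂ n) (M := M) (n := ∞)
    (by simp)).mem_nhds hx, extChartAt_source_mem_nhds (I := 𝓡∂ n) x] with y hy hys
  exact congrArg (toStd hf)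
    ((A.interiorChart x).left_inv (A.mem_source_interiorChart_iff.2 ⟨hy, hys⟩)).symm

theorem contMDiffOn_out_stdCut :
    ContMDiffOn (𝓡 n) (𝓡∂ n) ∞ (fun p ↦ A.out (ofStd hf p))
      (ofStd hf ⁻¹' (A.c '' (𝓡∂ n).interior M)) := by
  intro p hp
  obtain ⟨x, hx, hxp⟩ := hp
  obtain rfl : toStd hf (A.c x) = p := hxp
  have hs : A.c x ∈ (A.interiorChart x).source :=
    A.mem_source_interiorChart_iff.2 ⟨hx, mem_extChartAt_source x⟩
  have h1 := (contMDiffOn_of_mem_cutAtlas hf (e := A.interiorChart x)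
    (Or.inr ⟨x, rfl⟩)).contMDiffAt (((A.interiorChart x).open_source.preimage (continuous_ofStd hf)).mem_nhds hs)
  have h2 := (A.exists_lift_interiorChart x ((A.interiorChart x).map_source hs)).2.comp
    (toStd hf (A.c x)) h1
  refine (h2.congr_of_eventuallyEq ?_).contMDiffWithinAt
  filter_upwards [((A.interiorChart x).open_source.preimage (continuous_ofStd hf)).mem_nhds hs]
    with p hp
  obtain ⟨y, ⟨hy, hys⟩, hyp⟩ := hp
  obtain rfl : toStd hf (A.c y) = p := hyp
  change A.out (A.c y) = (extChartAt (𝓡∂ n) x).symm (extChartAt (𝓡∂ n) x (A.out (A.c y)))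
  rw [A.out_c_of_interior hy, (extChartAt (𝓡∂ n) x).left_inv hys]

/-- Membership in `cutFunctions` may be witnessed by another boundary defining function `f'`. In a
tube it too is the transversal coordinate times a positive function, so the cut coordinates of the
same tube serve for both. -/
theorem contMDiff_stdCut_iff (h : A.Cut → ℝ) :
    ContMDiff (𝓡 n) 𝓘(ℝ, ℝ) ∞ (fun p ↦ h (ofStd hf p)) ↔ h ∈ A.cutFunctions := by
  constructor
  · intro hh
    refine ⟨hh.comp_contMDiffOn (contMDiffOn_c_stdCut hf), f, hf, ?_⟩
    refine exists_equivariant_extension hf fun τ g hτ ↦ ?_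
    exact (hh.comp_contMDiffOn (contMDiffOn_lift_stdCut hf hτ)).contDiffOn
  · rintro ⟨h1, f', hf', V, H, hV, hH, hHa, hHh⟩ p
    obtain ⟨x, hxp⟩ := A.surjective_c (ofStd hf p)
    obtain rfl : toStd hf (A.c x) = p := hxp
    by_cases hx : x ∈ (𝓡∂ n).boundary M
    · obtain ⟨V', hV', hfV'⟩ := hf'.invariant
      obtain ⟨τ, h0, hT, g, hτ⟩ := hf.exists_tube (hV.inter hV') hx
      obtain ⟨g', hg1, hg2, hg3⟩ := τ.exists_pos_factor hf' fun a y hy ↦ hfV' a y (hT hy).2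
      have hτ' : τ.IsFactor f' g' := ⟨hg1, hg2, hg3⟩
      have hxT : x ∈ τ.T := h0 ▸ τ.σ_mem_T τ.zero_mem_Dp
      have hw : τ.cutCo x ∈ τ.cutD := τ.cutCo_mem hxT
      have h2 := hτ'.contDiffAt_comp_lift hw (V := V) (h' := h)
        (hV.isOpen.mem_nhds (hT (τ.σ_mem_T (τ.sq_mem_Dp hw))).1) hV.act_mem hH hHa hHh
      have hs : A.c x ∈ τ.cutChart.source := τ.mem_source_iff.2 hxT
      have h3 := (contMDiffOn_cutChart_stdCut hf hτ).contMDiffAt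
        ((τ.cutChart.open_source.preimage (continuous_ofStd hf)).mem_nhds hs)
      have h4 : ContMDiffAt 𝓘(ℝ, SliceSpace n × ℂ) 𝓘(ℝ, ℝ) ∞ (fun u ↦ h (A.c (τ.lift u)))
          (τ.cutChart (A.c x)) := by
        rw [τ.cutChart_c hxT]
        exact h2.contMDiffAt
      refine (h4.comp (toStd hf (A.c x)) h3).congr_of_eventuallyEq ?_
      filter_upwards [(τ.cutChart.open_source.preimage (continuous_ofStd hf)).mem_nhds hs] with p hp
      exact congrArg h (τ.cutChart.left_inv hp).symm
    · have hxi : x ∈ (𝓡∂ n).interior M := by rwa [← ModelWithCorners.compl_boundary]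
      have hio := A.isOpen_c_image_of_subset_interior subset_rfl
        (ModelWithCorners.isOpen_interior (I := 𝓡∂ n) (M := M) (n := ∞) (by simp))
      have h3 := (contMDiffOn_out_stdCut hf).contMDiffAt
        ((hio.preimage (continuous_ofStd hf)).mem_nhds (x := toStd hf (A.c x)) ⟨x, hxi, rfl⟩)
      have h2 : ContMDiffAt (𝓡∂ n) 𝓘(ℝ, ℝ) ∞ (fun x ↦ h (A.c x)) (A.out (A.c x)) := by
        rw [A.out_c_of_interior hxi]
        exact h1.contMDiffAt ((ModelWithCorners.isOpen_interior (n := ∞) (by simp)).mem_nhds hxi)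
      refine (h2.comp (toStd hf (A.c x)) h3).congr_of_eventuallyEq ?_
      exact Filter.Eventually.of_forall fun p ↦ congrArg h (A.c_out (ofStd hf p)).symm

end
end FreeCircleActionNearBoundary

/-- Coordinates of the target multiplied by a bump function are globally defined smooth functions
and agree with the coordinates near the given point. -/
theorem contMDiff_of_contMDiff_comp {V H V' H' X Y : Type*} [NormedAddCommGroup V]
    [NormedSpace ℝ V] [TopologicalSpace H] [NormedAddCommGroup V'] [NormedSpace ℝ V']
    [FiniteDimensional ℝ V'] [TopologicalSpace H'] {I : ModelWithCorners ℝ V H}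
    {I' : ModelWithCorners ℝ V' H'} [TopologicalSpace X] [ChartedSpace H X] [TopologicalSpace Y]
    [ChartedSpace H' Y] [IsManifold I' ∞ Y] [T2Space Y] {φ : X → Y} (hφ : Continuous φ)
    (h : ∀ u : Y → ℝ, ContMDiff I' 𝓘(ℝ, ℝ) ∞ u → ContMDiff I 𝓘(ℝ, ℝ) ∞ fun x ↦ u (φ x)) :
    ContMDiff I I' ∞ φ := by
  intro x
  rw [contMDiffAt_iff_target]
  refine ⟨hφ.continuousAt, ?_⟩
  obtain ⟨ρ⟩ : Nonempty (SmoothBumpFunction I' (φ x)) := inferInstance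
  have hρ : φ ⁻¹' {y | ρ y = 1} ∈ 𝓝 x := hφ.continuousAt.preimage_mem_nhds ρ.eventuallyEq_one
  set B := Module.finBasis ℝ V'
  have h1 : ∀ i, ContMDiffAt I 𝓘(ℝ, ℝ) ∞
      (fun z ↦ B.equivFunL (extChartAt I' (φ x) (φ z)) i) x := by
    intro i
    have h2 : ContMDiffOn I' 𝓘(ℝ, ℝ) ∞ (fun y ↦ B.equivFunL (extChartAt I' (φ x) y) i)
        (chartAt H' (φ x)).source :=
      ((ContinuousLinearMap.proj (R := ℝ) (φ := fun _ ↦ ℝ) i).comp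
        B.equivFunL.toContinuousLinearMap).contDiff.contMDiff.comp_contMDiffOn
        contMDiffOn_extChartAt
    have h3 := h _ (ρ.contMDiff_smul h2)
    refine h3.contMDiffAt.congr_of_eventuallyEq ?_
    filter_upwards [hρ] with z hz
    have hz' : ρ (φ z) = 1 := hz
    simp [hz']
  have h2 : ContMDiffAt I 𝓘(ℝ, Fin (Module.finrank ℝ V') → ℝ) ∞
      (fun z ↦ B.equivFunL (extChartAt I' (φ x) (φ z))) x := contMDiffAt_pi_space.2 h1
  have h3 := (B.equivFunL.symm.contDiff.contMDiff (n := ∞)).contMDiffAt.comp x h2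
  refine h3.congr_of_eventuallyEq (Filter.Eventually.of_forall fun z ↦ ?_)
  simp

namespace FreeCircleActionNearBoundary

variable {n : ℕ} [NeZero n] {M : Type*} [TopologicalSpace M]
  [ChartedSpace (EuclideanHalfSpace n) M] [T2Space M] [SecondCountableTopology M]
  [IsManifold (𝓡∂ n) ∞ M] {A : FreeCircleActionNearBoundary n M}

variable (A) in
theorem exists_isCutStructure : ∃ _ : ChartedSpace (EuclideanSpace ℝ (Fin n)) A.Cut,
    IsManifold (𝓡 n) ∞ A.Cut ∧ A.IsCutStructure := by
  obtain ⟨f, hf⟩ := A.exists_isInvariantBoundaryDefining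
  exact ⟨inferInstanceAs (ChartedSpace _ (A.StdCut hf)),
    inferInstanceAs (IsManifold (𝓡 n) ∞ (A.StdCut hf)), contMDiff_stdCut_iff hf⟩

variable (A) in
-- σ-compactness passes to the quotient, and a σ-compact space with charts in a Euclidean space is
-- second countable.
theorem secondCountableTopology_cut : SecondCountableTopology A.Cut := by
  obtain ⟨_, -⟩ := A.exists_isCutStructure
  have := A.sigmaCompactSpace_cut
  exact ChartedSpace.secondCountable_of_sigmaCompact (EuclideanSpace ℝ (Fin n)) A.Cut

section CutStructure
variable [ChartedSpace (EuclideanSpace ℝ (Fin n)) A.Cut] [IsManifold (𝓡 n) ∞ A.Cut]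
  (hA : A.IsCutStructure) {f : M → ℝ} (hf : A.IsInvariantBoundaryDefining f)
include hA

/-- The two structures have the same smooth functions, so the identity is smooth in both directions;
this carries the smoothness of the standard charts over to an arbitrary cut structure. -/
theorem IsCutStructure.contMDiff_toStdCut :
    ContMDiff (𝓡 n) (𝓡 n) ∞ (toStd hf) := by
  have : T2Space (A.StdCut hf) := A.t2Space_cut
  exact contMDiff_of_contMDiff_comp (continuous_toStd hf) fun u hu ↦
    (hA u).2 ((contMDiff_stdCut_iff hf (fun p ↦ u (toStd hf p))).1 hu)

theorem IsCutStructure.contMDiff_ofStdCut :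
    ContMDiff (𝓡 n) (𝓡 n) ∞ (ofStd hf) := by
  have : T2Space A.Cut := A.t2Space_cut
  exact contMDiff_of_contMDiff_comp (continuous_ofStd hf) fun u hu ↦
    (contMDiff_stdCut_iff hf u).2 ((hA u).1 hu)

include hf

theorem IsCutStructure.contMDiffOn_lift {τ : A.Tube} {g} (h : τ.IsFactor f g) :
    ContMDiffOn 𝓘(ℝ, SliceSpace n × ℂ) (𝓡 n) ∞ (fun v ↦ A.c (τ.lift v)) τ.cutD :=
  (hA.contMDiff_ofStdCut hf).comp_contMDiffOn (contMDiffOn_lift_stdCut hf h)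

theorem IsCutStructure.contMDiffOn_cutChart {τ : A.Tube} {g} (h : τ.IsFactor f g) :
    ContMDiffOn (𝓡 n) 𝓘(ℝ, SliceSpace n × ℂ) ∞ τ.cutChart τ.cutChart.source :=
  (contMDiffOn_cutChart_stdCut hf h).comp (hA.contMDiff_toStdCut hf).contMDiffOn fun _ hp ↦ hp

omit hf in
theorem IsCutStructure.contMDiffOn_c : ContMDiffOn (𝓡∂ n) (𝓡 n) ∞ A.c ((𝓡∂ n).interior M) := by
  obtain ⟨f, hf⟩ := A.exists_isInvariantBoundaryDefining
  exact (hA.contMDiff_ofStdCut hf).comp_contMDiffOn (contMDiffOn_c_stdCut hf)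

omit hf in
theorem IsCutStructure.contMDiffOn_out :
    ContMDiffOn (𝓡 n) (𝓡∂ n) ∞ A.out (A.c '' (𝓡∂ n).interior M) := by
  obtain ⟨f, hf⟩ := A.exists_isInvariantBoundaryDefining
  exact (contMDiffOn_out_stdCut hf).comp (hA.contMDiff_toStdCut hf).contMDiffOn fun _ hp ↦ hp

end CutStructure
end FreeCircleActionNearBoundary
end

/-! ### Distributions as kernels of vector valued forms -/

noncomputable section

open Set Filter Topology

section Forms
variable {F K : Type*} [NormedAddCommGroup F] [NormedSpace ℝ F] [NormedAddCommGroup K]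
  [NormedSpace ℝ K]

/-- A smooth family of linear maps to `K` with the common right inverse `ι`. Its kernels form a
distribution. -/
structure IsForm (S : Set F) (ι : K →L[ℝ] F) (α : F → F →L[ℝ] K) : Prop where
  contDiffOn : ContDiffOn ℝ ∞ α S
  apply_ι : ∀ v ∈ S, ∀ κ, α v (ι κ) = κ

/-- The exterior derivative of a form. -/
def dForm (α : F → F →L[ℝ] K) (S : Set F) (v u w : F) : K :=
  fderivWithin ℝ α S v u w - fderivWithin ℝ α S v w u

/-- The projection of a vector to the kernels of a form. -/
def formSection (ι : K →L[ℝ] F) (α : F → F →L[ℝ] K) (u v : F) : F := u - ι (α v u)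

variable {S : Set F} {ι : K →L[ℝ] F} {α : F → F →L[ℝ] K}

theorem formSection_of_eq_zero {u v : F} (h : α v u = 0) : formSection ι α u v = u := by
  simp [formSection, h]

theorem IsForm.apply_formSection (hα : IsForm S ι α) {v : F} (hv : v ∈ S) (u : F) :
    α v (formSection ι α u v) = 0 := by
  simp [formSection, hα.apply_ι v hv]

theorem IsForm.contDiffOn_formSection (hα : IsForm S ι α) (u : F) :
    ContDiffOn ℝ ∞ (formSection ι α u) S :=
  contDiffOn_const.sub (ι.contDiff.comp_contDiffOn (hα.contDiffOn.clm_apply contDiffOn_const))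

theorem IsForm.mono (hα : IsForm S ι α) {S' : Set F} (h : S' ⊆ S) : IsForm S' ι α :=
  ⟨hα.contDiffOn.mono h, fun v hv ↦ hα.apply_ι v (h hv)⟩

/-- Differentiating α(Z) = 0 gives α(DZ·w) = −(Dα·w)(Z); the bracket is the difference of two such
terms. -/
theorem IsForm.apply_lieBracketWithin (hα : IsForm S ι α) (hS : UniqueDiffOn ℝ S) {v : F}
    (hv : v ∈ S) {X Y : F → F} (hX : DifferentiableWithinAt ℝ X S v)
    (hY : DifferentiableWithinAt ℝ Y S v) (hX0 : ∀ᶠ u in 𝓝[S] v, α u (X u) = 0)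
    (hY0 : ∀ᶠ u in 𝓝[S] v, α u (Y u) = 0) :
    α v (VectorField.lieBracketWithin ℝ X Y S v) = - dForm α S v (X v) (Y v) := by
  have hd : DifferentiableWithinAt ℝ α S v := (hα.contDiffOn v hv).differentiableWithinAt (by simp)
  have key : ∀ Z : F → F, DifferentiableWithinAt ℝ Z S v → (∀ᶠ u in 𝓝[S] v, α u (Z u) = 0) →
      ∀ w, α v (fderivWithin ℝ Z S v w) = - fderivWithin ℝ α S v w (Z v) := by
    intro Z hZ hZ0 w
    have h1 := hd.hasFDerivWithinAt.clm_apply hZ.hasFDerivWithinAt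
    have h2 : HasFDerivWithinAt (fun u ↦ α u (Z u)) (0 : F →L[ℝ] K) S v :=
      (hasFDerivWithinAt_const (0 : K) v S).congr_of_eventuallyEq hZ0
        (hZ0.self_of_nhdsWithin hv)
    have h3 := congrArg (fun L : F →L[ℝ] K ↦ L w) ((hS v hv).eq h1 h2)
    simp only [_root_.add_apply, ContinuousLinearMap.comp_apply,
      ContinuousLinearMap.flip_apply, _root_.zero_apply] at h3
    exact eq_neg_of_add_eq_zero_left h3
  rw [VectorField.lieBracketWithin, map_sub, key Y hY hY0, key X hX hX0, dForm]
  abel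

/-- Kernel vectors at `v` extend to continuous kernel fields by `formSection`, so vanishing of the
exterior derivative on kernels passes to limits. -/
theorem IsForm.dForm_eq_zero_of_mem_closure (hα : IsForm S ι α) (hS : UniqueDiffOn ℝ S) {v : F}
    (hv : v ∈ S) (hcl : v ∈ closure {v' ∈ S | ∀ u w, α v' u = 0 → α v' w = 0 →
      dForm α S v' u w = 0}) {u w : F} (hu : α v u = 0) (hw : α v w = 0) :
    dForm α S v u w = 0 := by
  have h1 : ContinuousOn (fderivWithin ℝ α S) S :=
    hα.contDiffOn.continuousOn_fderivWithin hS (by simp)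
  have h2 : ∀ u w, ContinuousOn (fun v' ↦ fderivWithin ℝ α S v' (formSection ι α u v')
      (formSection ι α w v')) S := fun u w ↦
    (h1.clm_apply (hα.contDiffOn_formSection u).continuousOn).clm_apply
      (hα.contDiffOn_formSection w).continuousOn
  have h3 : ContinuousOn (fun v' ↦ dForm α S v' (formSection ι α u v') (formSection ι α w v')) S :=
    (h2 u w).sub (h2 w u)
  have h4 := ((h3 v hv).mono (sep_subset S _)).mem_closure_image hcl
  have h5 : (fun v' ↦ dForm α S v' (formSection ι α u v') (formSection ι α w v')) ''
      {v' ∈ S | ∀ u w, α v' u = 0 → α v' w = 0 → dForm α S v' u w = 0} ⊆ {0} := by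
    rintro _ ⟨v', ⟨hv', h⟩, rfl⟩
    exact h _ _ (hα.apply_formSection hv' _) (hα.apply_formSection hv' _)
  have h6 := closure_mono h5 h4
  rw [closure_singleton] at h6
  have h7 : dForm α S v (formSection ι α u v) (formSection ι α w v) = 0 := h6
  rwa [formSection_of_eq_zero hu, formSection_of_eq_zero hw] at h7

/-- Frame and complement together give an isomorphism at `v₀`, and invertibility is an open
condition; α is the component along the complement of the inverse. -/
theorem exists_isForm_of_frame [FiniteDimensional ℝ F] [FiniteDimensional ℝ K] {k : ℕ}
    {x : Fin k → F → F} (hx : ∀ i, ContDiffOn ℝ ∞ (x i) S) {v₀ : F} (hv₀ : v₀ ∈ S)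
    (hli : LinearIndependent ℝ fun i ↦ x i v₀) (hι : Function.Injective ι)
    (hc : IsCompl (Submodule.span ℝ (range fun i ↦ x i v₀)) (LinearMap.range ι.toLinearMap)) :
    ∃ (O : Set F) (α : F → F →L[ℝ] K), IsOpen O ∧ v₀ ∈ O ∧ IsForm (S ∩ O) ι α ∧
      ∀ v ∈ S ∩ O, ∀ u, u ∈ Submodule.span ℝ (range fun i ↦ x i v) ↔ α v u = 0 := by
  let B : F → ((Fin k → ℝ) × K) →L[ℝ] F := fun v ↦
    (∑ i, ((ContinuousLinearMap.proj i).comp (ContinuousLinearMap.fst ℝ (Fin k → ℝ) K)).smulRight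
      (x i v)) + ι.comp (ContinuousLinearMap.snd ℝ (Fin k → ℝ) K)
  have hB : ∀ v a κ, B v (a, κ) = ∑ i, a i • x i v + ι κ := fun v a κ ↦ by
    simp [B]
  have hBs : ContDiffOn ℝ ∞ B S := by
    refine ContDiffOn.add (ContDiffOn.sum fun i _ ↦ ?_) contDiffOn_const
    exact contDiffOn_const.smulRight (hx i)
  have hspan : ∀ v u, u ∈ Submodule.span ℝ (range fun i ↦ x i v) ↔
      ∃ a : Fin k → ℝ, ∑ i, a i • x i v = u := fun v u ↦
    Submodule.mem_span_range_iff_exists_fun ℝ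
  have hinj : Function.Injective (B v₀) := by
    rw [injective_iff_map_eq_zero]
    rintro ⟨a, κ⟩ h
    rw [hB] at h
    have h1 : ι κ = 0 := by
      refine (Submodule.disjoint_def.1 hc.disjoint) _ ?_ ⟨κ, rfl⟩
      rw [eq_neg_of_add_eq_zero_right h]
      exact Submodule.neg_mem _ ((hspan _ _).2 ⟨a, rfl⟩)
    rw [h1, add_zero] at h
    have h2 := Fintype.linearIndependent_iff.1 hli a h
    exact Prod.ext (funext h2) (hι (h1.trans (map_zero ι).symm))
  have hsurj : Function.Surjective (B v₀) := by
    intro u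
    obtain ⟨y, hy, z, ⟨κ, rfl⟩, rfl⟩ := Submodule.mem_sup.1
      (show u ∈ _ ⊔ _ by rw [hc.sup_eq_top]; trivial)
    obtain ⟨a, rfl⟩ := (hspan _ _).1 hy
    exact ⟨(a, κ), hB _ _ _⟩
  let e₀ : ((Fin k → ℝ) × K) ≃L[ℝ] F :=
    (LinearEquiv.ofBijective (B v₀).toLinearMap ⟨hinj, hsurj⟩).toContinuousLinearEquiv
  have he₀ : (e₀ : _ →L[ℝ] F) = B v₀ := by
    ext <;> rfl
  obtain ⟨O, hO, hSO⟩ := continuousOn_iff'.1 hBs.continuousOn _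
    (ContinuousLinearEquiv.isOpen (𝕜 := ℝ) (E := (Fin k → ℝ) × K) (F := F))
  have hmem : ∀ v ∈ S ∩ O, ∃ e : ((Fin k → ℝ) × K) ≃L[ℝ] F, (e : _ →L[ℝ] F) = B v := by
    intro v hv
    have : v ∈ B ⁻¹' range ContinuousLinearEquiv.toContinuousLinearMap ∩ S := by
      rw [hSO]
      exact ⟨hv.2, hv.1⟩
    exact this.1
  have hv₀O : v₀ ∈ O := by
    have : v₀ ∈ O ∩ S := by
      rw [← hSO]
      exact ⟨⟨e₀, he₀⟩, hv₀⟩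
    exact this.1
  refine ⟨O, fun v ↦ (ContinuousLinearMap.snd ℝ (Fin k → ℝ) K).comp (B v).inverse, hO, hv₀O,
    ⟨?_, ?_⟩, ?_⟩
  · refine contDiffOn_const.clm_comp ?_
    intro v hv
    obtain ⟨e, he⟩ := hmem v hv
    refine ContDiffAt.comp_contDiffWithinAt (g := ContinuousLinearMap.inverse) v ?_
      ((hBs v hv.1).mono inter_subset_left)
    rw [← he]
    exact contDiffAt_map_inverse e
  · intro v hv κ
    obtain ⟨e, he⟩ := hmem v hv
    have h1 : e (0, κ) = ι κ := by
      refine (congrArg (fun L : ((Fin k → ℝ) × K) →L[ℝ] F ↦ L (0, κ)) he).trans ?_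
      rw [hB]
      simp
    simp only [ContinuousLinearMap.comp_apply]
    rw [← he, ContinuousLinearMap.inverse_equiv, ← h1]
    simp
  · intro v hv u
    obtain ⟨e, he⟩ := hmem v hv
    have hu : u = ∑ i, (e.symm u).1 i • x i v + ι (e.symm u).2 := by
      rw [← hB, ← he]
      exact (e.apply_symm_apply u).symm
    simp only [ContinuousLinearMap.comp_apply]
    rw [← he, ContinuousLinearMap.inverse_equiv, hspan]
    change _ ↔ (e.symm u).2 = 0
    constructor
    · rintro ⟨a, rfl⟩
      have h1 : e (a, 0) = ∑ i, a i • x i v := by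
        refine (congrArg (fun L : ((Fin k → ℝ) × K) →L[ℝ] F ↦ L (a, 0)) he).trans ?_
        rw [hB]
        simp
      rw [← h1]
      simp
    · intro h
      rw [h, map_zero, add_zero] at hu
      exact ⟨_, hu.symm⟩

/-- All the kernels are complements of the range of `ι`, so projection along `ι` carries a basis of
one kernel to a basis of any other; the frame exists on all of `S`. -/
theorem IsForm.exists_frame [FiniteDimensional ℝ F] (hα : IsForm S ι α) {v₀ : F} (hv₀ : v₀ ∈ S) :
    ∃ (k : ℕ) (b : Fin k → F), ∀ v ∈ S, LinearIndependent ℝ (fun i ↦ formSection ι α (b i) v) ∧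
      ∀ u, u ∈ Submodule.span ℝ (range fun i ↦ formSection ι α (b i) v) ↔ α v u = 0 := by
  set N := LinearMap.ker (α v₀).toLinearMap with hN
  let b := Module.finBasis ℝ N
  refine ⟨_, fun i ↦ (b i : F), fun v hv ↦ ⟨?_, fun u ↦ ?_⟩⟩
  · let p : F →ₗ[ℝ] F := LinearMap.id - ι.toLinearMap.comp (α v₀).toLinearMap
    refine LinearIndependent.of_comp p ?_
    have h1 : (p ∘ fun i ↦ formSection ι α (b i : F) v) = fun i ↦ (b i : F) := by
      funext i
      have h2 : α v₀ (b i : F) = 0 := (b i).2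
      simp [p, formSection, h2, hα.apply_ι v₀ hv₀]
    rw [h1]
    exact b.linearIndependent.map' N.subtype (Submodule.ker_subtype N)
  · constructor
    · intro hu
      have : Submodule.span ℝ (range fun i ↦ formSection ι α (b i : F) v) ≤
          LinearMap.ker (α v).toLinearMap := by
        rw [Submodule.span_le]
        rintro _ ⟨i, rfl⟩
        exact hα.apply_formSection hv _
      exact this hu
    · intro hu
      have hm : u - ι (α v₀ u) ∈ N := by
        change α v₀ (u - ι (α v₀ u)) = 0
        rw [map_sub, hα.apply_ι v₀ hv₀, sub_self]
      obtain ⟨a, h1⟩ : ∃ a : Fin _ → ℝ, ∑ i, a i • (b i : F) = u - ι (α v₀ u) := by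
        refine ⟨fun i ↦ b.repr ⟨_, hm⟩ i, ?_⟩
        have := congrArg (N.subtype) (b.sum_repr ⟨_, hm⟩)
        rw [map_sum] at this
        exact this
      rw [Submodule.mem_span_range_iff_exists_fun]
      refine ⟨a, ?_⟩
      have h2 : ∑ i, a i • formSection ι α (b i : F) v =
          formSection ι α (u - ι (α v₀ u)) v := by
        rw [← h1]
        simp [formSection, smul_sub, Finset.sum_sub_distrib]
      rw [h2, formSection, map_sub, hu, hα.apply_ι v hv]
      simp

end Forms
end

/-! ### Local parametrizations and vector fields in them -/

noncomputable section

open Set Filter Topology VectorField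

/-- A parametrization of an open subset of a manifold by a subset of a vector space. -/
structure LocalParam {V H : Type*} [NormedAddCommGroup V] [NormedSpace ℝ V] [TopologicalSpace H]
    (I : ModelWithCorners ℝ V H) (N : Type*) [TopologicalSpace N] [ChartedSpace H N]
    (F : Type*) [NormedAddCommGroup F] [NormedSpace ℝ F] where
  S : Set F
  O : Set N
  ψ : F → N
  φ : N → F
  isOpen_O : IsOpen O
  uniqueDiffOn : UniqueDiffOn ℝ S
  subset_closure : S ⊆ closure (interior S)
  contMDiffOn_ψ : ContMDiffOn 𝓘(ℝ, F) I ∞ ψ S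
  contMDiffOn_φ : ContMDiffOn I 𝓘(ℝ, F) ∞ φ O
  ψ_mem : ∀ v ∈ S, ψ v ∈ O
  φ_mem : ∀ x ∈ O, φ x ∈ S
  φ_ψ : ∀ v ∈ S, φ (ψ v) = v
  ψ_φ : ∀ x ∈ O, ψ (φ x) = x

section Distributions
variable {V H : Type*} [NormedAddCommGroup V] [NormedSpace ℝ V] [TopologicalSpace H]
  (I : ModelWithCorners ℝ V H) {N : Type*} [TopologicalSpace N] [ChartedSpace H N]
  [IsManifold I ∞ N]

/-- Involutivity at a point. -/
def InvolutiveAt (E : ∀ x : N, Submodule ℝ (TangentSpace I x)) (x : N) : Prop :=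
  ∀ (W : Set N) (X Y : ∀ x : N, TangentSpace I x), IsOpen W → x ∈ W →
    IsSectionOn I E X W → IsSectionOn I E Y W → mlieBracket I X Y x ∈ E x

/-- Non-degeneracy at a point of the two-form that is induced by the Lie bracket. -/
def NondegenerateAt (E : ∀ x : N, Submodule ℝ (TangentSpace I x)) (x : N) : Prop :=
  ∀ u ∈ E x, (∀ (W : Set N) (X Y : ∀ x : N, TangentSpace I x), IsOpen W → x ∈ W →
    IsSectionOn I E X W → IsSectionOn I E Y W → X x = u → mlieBracket I X Y x ∈ E x) → u = 0

theorem isInvolutive_iff {E : ∀ x : N, Submodule ℝ (TangentSpace I x)} :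
    IsInvolutive I E ↔ ∀ x, InvolutiveAt I E x :=
  ⟨fun h x W X Y hW hx hX hY ↦ h W X Y hW hX hY x hx,
    fun h W X Y hW hX hY x hx ↦ h x W X Y hW hx hX hY⟩

/-- The values of the local vector fields whose values at the points of `Q` are in `E`. -/
def distributionClosure (E : ∀ x : N, Submodule ℝ (TangentSpace I x)) (Q : Set N) (x : N) :
    Submodule ℝ (TangentSpace I x) where
  carrier := {u | ∃ (W : Set N) (Z : ∀ x : N, TangentSpace I x), IsOpen W ∧ x ∈ W ∧
    SmoothFieldOn I Z W ∧ Z x = u ∧ ∀ y ∈ W ∩ Q, Z y ∈ E y}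
  zero_mem' := ⟨univ, fun _ ↦ 0, isOpen_univ, mem_univ _,
    (Bundle.contMDiff_zeroSection ℝ (TangentSpace I : N → Type _)).contMDiffOn, rfl, fun y _ ↦ Submodule.zero_mem _⟩
  add_mem' := by
    rintro _ _ ⟨W, Z, hW, hx, hZ, rfl, hZE⟩ ⟨W', Z', hW', hx', hZ', rfl, hZE'⟩
    exact ⟨W ∩ W', fun y ↦ Z y + Z' y, hW.inter hW', ⟨hx, hx'⟩,
      (hZ.mono inter_subset_left).add_section (hZ'.mono inter_subset_right), rfl,
      fun y hy ↦ Submodule.add_mem _ (hZE y ⟨hy.1.1, hy.2⟩) (hZE' y ⟨hy.1.2, hy.2⟩)⟩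
  smul_mem' := by
    rintro r _ ⟨W, Z, hW, hx, hZ, rfl, hZE⟩
    exact ⟨W, fun y ↦ r • Z y, hW, hx, hZ.const_smul_section, rfl,
      fun y hy ↦ Submodule.smul_mem _ _ (hZE y hy)⟩

/-- Only the values on `Q` enter. For a dense `Q` this yields both the extension of a distribution
from `Q` and its uniqueness. -/
theorem distributionClosure_congr {E E' : ∀ x : N, Submodule ℝ (TangentSpace I x)} {Q : Set N}
    (h : ∀ x ∈ Q, E x = E' x) : distributionClosure I E Q = distributionClosure I E' Q := by
  funext x
  ext u
  constructor
  · rintro ⟨W, Z, hW, hx, hZ, hZx, hZE⟩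
    exact ⟨W, Z, hW, hx, hZ, hZx, fun y hy ↦ h y hy.2 ▸ hZE y hy⟩
  · rintro ⟨W, Z, hW, hx, hZ, hZx, hZE⟩
    exact ⟨W, Z, hW, hx, hZ, hZx, fun y hy ↦ (h y hy.2).symm ▸ hZE y hy⟩

namespace LocalParam
variable {I} {F : Type*} [NormedAddCommGroup F] [NormedSpace ℝ F] (P : LocalParam I N F)

/-- The derivative of the parametrization. -/
def D (v : F) : F →L[ℝ] TangentSpace I (P.ψ v) := mfderivWithin 𝓘(ℝ, F) I P.ψ P.S v

theorem mdifferentiableWithinAt_ψ {v : F} (hv : v ∈ P.S) :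
    MDifferentiableWithinAt 𝓘(ℝ, F) I P.ψ P.S v :=
  (P.contMDiffOn_ψ v hv).mdifferentiableWithinAt (by simp)

theorem contMDiffAt_φ {x : N} (hx : x ∈ P.O) : ContMDiffAt I 𝓘(ℝ, F) ∞ P.φ x :=
  P.contMDiffOn_φ.contMDiffAt (P.isOpen_O.mem_nhds hx)

theorem mfderiv_φ_comp_D {v : F} (hv : v ∈ P.S) :
    (mfderiv I 𝓘(ℝ, F) P.φ (P.ψ v)).comp (P.D v) = ContinuousLinearMap.id ℝ F := by
  have h1 := ((P.contMDiffAt_φ (P.ψ_mem v hv)).mdifferentiableAt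
    (by simp)).hasMFDerivAt.comp_hasMFDerivWithinAt v
    (P.mdifferentiableWithinAt_ψ hv).hasMFDerivWithinAt
  have h2 : HasMFDerivWithinAt 𝓘(ℝ, F) 𝓘(ℝ, F) (P.φ ∘ P.ψ) P.S v (ContinuousLinearMap.id ℝ F) :=
    (hasMFDerivWithinAt_id P.S v).congr_of_eventuallyEq
      (by filter_upwards [self_mem_nhdsWithin] with u hu using P.φ_ψ u hu) (P.φ_ψ v hv)
  exact (P.uniqueDiffOn.uniqueMDiffOn v hv).eq h1 h2

theorem D_comp_mfderiv_φ {v : F} (hv : v ∈ P.S) :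
    (P.D v).comp (mfderiv I 𝓘(ℝ, F) P.φ (P.ψ v)) =
      ContinuousLinearMap.id ℝ (TangentSpace I (P.ψ v)) := by
  have hO := P.isOpen_O.mem_nhds (P.ψ_mem v hv)
  -- The type of `P.D v` depends on `v`, so the base point is generalised before `φ (ψ v) = v` is
  -- used.
  have h0 : ∀ w, w = v → HasMFDerivWithinAt 𝓘(ℝ, F) I P.ψ P.S w (P.D v) := by
    rintro _ rfl
    exact (P.mdifferentiableWithinAt_ψ hv).hasMFDerivWithinAt
  have h1 := (h0 _ (P.φ_ψ v hv)).comp (P.ψ v) ((P.contMDiffAt_φ (P.ψ_mem v hv)).mdifferentiableAt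
    (by simp)).hasMFDerivAt.hasMFDerivWithinAt (s := P.O) fun x hx ↦ P.φ_mem x hx
  have h2 : HasMFDerivWithinAt I I (P.ψ ∘ P.φ) P.O (P.ψ v)
      (ContinuousLinearMap.id ℝ (TangentSpace I (P.ψ v))) :=
    (hasMFDerivWithinAt_id P.O (P.ψ v)).congr_of_eventuallyEq
      (by filter_upwards [self_mem_nhdsWithin] with u hu using P.ψ_φ u hu)
      (P.ψ_φ _ (P.ψ_mem v hv))
  exact (P.isOpen_O.uniqueMDiffOn _ (P.ψ_mem v hv)).eq h1 h2

theorem isInvertible_D {v : F} (hv : v ∈ P.S) : (P.D v).IsInvertible :=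
  ContinuousLinearMap.IsInvertible.of_inverse (P.D_comp_mfderiv_φ hv) (P.mfderiv_φ_comp_D hv)

theorem isInvertible_mfderiv_φ {v : F} (hv : v ∈ P.S) :
    (mfderiv I 𝓘(ℝ, F) P.φ (P.ψ v)).IsInvertible :=
  ContinuousLinearMap.IsInvertible.of_inverse (P.mfderiv_φ_comp_D hv) (P.D_comp_mfderiv_φ hv)

/-- The coordinate representation of a vector field. -/
def pull (X : ∀ x : N, TangentSpace I x) : F → F := mpullbackWithin 𝓘(ℝ, F) I P.ψ X P.S

/-- The vector field with a given coordinate representation. -/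
def push (Z : F → F) : ∀ x : N, TangentSpace I x := mpullback I 𝓘(ℝ, F) P.φ Z

theorem D_pull (X : ∀ x : N, TangentSpace I x) {v : F} (hv : v ∈ P.S) :
    P.D v (P.pull X v) = X (P.ψ v) := (P.isInvertible_D hv).self_apply_inverse _

theorem push_ψ (Z : F → F) {v : F} (hv : v ∈ P.S) : P.push Z (P.ψ v) = P.D v (Z v) := by
  have h1 : (mfderiv I 𝓘(ℝ, F) P.φ (P.ψ v)).inverse = P.D v := by
    have h2 := (P.isInvertible_mfderiv_φ hv).inverse_comp_self
    calc _ = ((mfderiv I 𝓘(ℝ, F) P.φ (P.ψ v)).inverse.comp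
          (mfderiv I 𝓘(ℝ, F) P.φ (P.ψ v))).comp (P.D v) := by
            rw [ContinuousLinearMap.comp_assoc, P.mfderiv_φ_comp_D hv]
            rfl
      _ = _ := by
            rw [h2]
            rfl
  change (mfderiv I 𝓘(ℝ, F) P.φ (P.ψ v)).inverse (Z (P.φ (P.ψ v))) = _
  rw [P.φ_ψ v hv]
  exact DFunLike.congr_fun h1 (Z v)

theorem pull_push (Z : F → F) {v : F} (hv : v ∈ P.S) : P.pull (P.push Z) v = Z v := by
  change (P.D v).inverse (P.push Z (P.ψ v)) = Z v
  rw [P.push_ψ Z hv]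
  exact (P.isInvertible_D hv).inverse_apply_self _

theorem contDiffWithinAt_pull [CompleteSpace F] [CompleteSpace V] {X : ∀ x : N, TangentSpace I x}
    {W : Set N} (hW : IsOpen W) (hX : SmoothFieldOn I X W) {v : F} (hv : v ∈ P.S)
    (hvW : P.ψ v ∈ W) : ContDiffWithinAt ℝ ∞ (P.pull X) P.S v := by
  have : IsManifold I 1 N := IsManifold.of_le (n := ∞) (by simp)
  refine contMDiffWithinAt_vectorSpace_iff_contDiffWithinAt.1 ?_
  refine ContMDiffWithinAt.mpullbackWithin_vectorField_of_mem (n := ∞) (t := W) (hX _ hvW)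
    (P.contMDiffOn_ψ v hv) (P.isInvertible_D hv) hv P.uniqueDiffOn.uniqueMDiffOn (by simp) ?_
  exact (P.contMDiffOn_ψ v hv).continuousWithinAt.preimage_mem_nhdsWithin (hW.mem_nhds hvW)

theorem smoothFieldOn_push [CompleteSpace F] [CompleteSpace V] {Z : F → F}
    (hZ : ContDiffOn ℝ ∞ Z P.S) : SmoothFieldOn I (P.push Z) P.O := by
  have : IsManifold I 1 N := IsManifold.of_le (n := ∞) (by simp)
  intro x hx
  have hv := P.φ_mem x hx
  have hinv := P.isInvertible_mfderiv_φ hv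
  rw [P.ψ_φ x hx] at hinv
  refine ContMDiffWithinAt.mpullback_vectorField_of_mem_nhdsWithin (n := ∞) (t := P.S) ?_
    (P.contMDiffAt_φ hx) hinv le_rfl ?_
  · exact contMDiffWithinAt_vectorSpace_iff_contDiffWithinAt.2 (hZ _ hv)
  · filter_upwards [self_mem_nhdsWithin] with y hy using P.φ_mem y hy

/-- Naturality of the bracket. At boundary points of `S` it rests on `subset_closure`: second
derivatives within `S` are symmetric at limits of interior points. -/
theorem pull_mlieBracket [CompleteSpace F] [CompleteSpace V] {X Y : ∀ x : N, TangentSpace I x}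
    {W : Set N} (hW : IsOpen W) (hX : SmoothFieldOn I X W) (hY : SmoothFieldOn I Y W) {v : F}
    (hv : v ∈ P.S) (hvW : P.ψ v ∈ W) :
    P.pull (mlieBracket I X Y) v = lieBracketWithin ℝ (P.pull X) (P.pull Y) P.S v := by
  have : IsManifold I 2 N :=
    IsManifold.of_le (n := ∞) (WithTop.coe_le_coe.2 (le_top (a := (2 : ℕ∞))))
  have : IsManifold I (minSmoothness ℝ 2) N := by
    rw [minSmoothness_of_isRCLikeNormedField]
    infer_instance
  have key := mpullbackWithin_mlieBracketWithin (V := X) (W := Y) (n := ∞) (t := univ) ?_ ?_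
    P.uniqueDiffOn.uniqueMDiffOn (P.contMDiffOn_ψ v hv) hv ?_ univ_mem (P.subset_closure hv)
  · rw [mlieBracketWithin_univ, mlieBracketWithin_eq_lieBracketWithin] at key
    exact key
  · exact ((ContMDiffOn.contMDiffAt (n := ∞) hX (hW.mem_nhds hvW)).mdifferentiableAt
      (by simp)).mdifferentiableWithinAt
  · exact ((ContMDiffOn.contMDiffAt (n := ∞) hY (hW.mem_nhds hvW)).mdifferentiableAt
      (by simp)).mdifferentiableWithinAt
  · rw [minSmoothness_of_isRCLikeNormedField]
    exact WithTop.coe_le_coe.2 (le_top (a := (2 : ℕ∞)))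

/-- The restriction of a parametrization to an open subset. -/
def restrict {O' : Set F} (hO' : IsOpen O') : LocalParam I N F where
  S := P.S ∩ O'
  O := P.O ∩ P.φ ⁻¹' O'
  ψ := P.ψ
  φ := P.φ
  isOpen_O := P.contMDiffOn_φ.continuousOn.isOpen_inter_preimage P.isOpen_O hO'
  uniqueDiffOn := P.uniqueDiffOn.inter hO'
  subset_closure := by
    rintro v ⟨hv, hv'⟩
    rw [interior_inter, hO'.interior_eq, inter_comm]
    exact hO'.inter_closure ⟨hv', P.subset_closure hv⟩
  contMDiffOn_ψ := P.contMDiffOn_ψ.mono inter_subset_left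
  contMDiffOn_φ := P.contMDiffOn_φ.mono inter_subset_left
  ψ_mem v hv := ⟨P.ψ_mem v hv.1, by rw [mem_preimage, P.φ_ψ v hv.1]; exact hv.2⟩
  φ_mem x hx := ⟨P.φ_mem x hx.1, hx.2⟩
  φ_ψ v hv := P.φ_ψ v hv.1
  ψ_φ x hx := P.ψ_φ x hx.1

theorem restrict_D {O' : Set F} (hO' : IsOpen O') {v : F} (hv : v ∈ O') :
    (P.restrict hO').D v = P.D v := mfderivWithin_inter (hO'.mem_nhds hv)

end LocalParam
end Distributions
end

/-! ### Forms that describe a distribution in a parametrization -/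

noncomputable section

open Set Filter Topology VectorField

namespace LocalParam
variable {V H : Type*} [NormedAddCommGroup V] [NormedSpace ℝ V] [TopologicalSpace H]
  {I : ModelWithCorners ℝ V H} {N : Type*} [TopologicalSpace N] [ChartedSpace H N]
  [IsManifold I ∞ N]
  {F K : Type*} [NormedAddCommGroup F] [NormedSpace ℝ F] [NormedAddCommGroup K] [NormedSpace ℝ K]
  {P : LocalParam I N F}

variable (P) in
/-- In the parametrization `P` the distribution `E` is the kernel of the form `α`. -/
structure HasForm (ι : K →L[ℝ] F) (α : F → F →L[ℝ] K)
    (E : ∀ x : N, Submodule ℝ (TangentSpace I x)) : Prop where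
  isForm : IsForm P.S ι α
  mem_iff : ∀ v ∈ P.S, ∀ u, P.D v u ∈ E (P.ψ v) ↔ α v u = 0

variable {ι : K →L[ℝ] F} {α : F → F →L[ℝ] K} {E : ∀ x : N, Submodule ℝ (TangentSpace I x)}

variable [FiniteDimensional ℝ F] [CompleteSpace V]

/-- A complement of the fibre at one point is a complement at nearby points. The choice of `ι` is
left free because at the boundary it has to be adapted to the orbits. -/
theorem exists_hasForm_restrict [FiniteDimensional ℝ K] (hE : IsDistribution I E) {v₀ : F}
    (hv₀ : v₀ ∈ P.S) (hι : Function.Injective ι)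
    (hc : IsCompl ((E (P.ψ v₀)).comap (P.D v₀).toLinearMap) (LinearMap.range ι.toLinearMap)) :
    ∃ (O' : Set F) (hO' : IsOpen O') (α : F → F →L[ℝ] K), v₀ ∈ O' ∧
      (P.restrict hO').HasForm ι α E := by
  have : CompleteSpace F := FiniteDimensional.complete ℝ F
  obtain ⟨W, k, X, hW, hxW, hX, hXE⟩ := hE (P.ψ v₀)
  obtain ⟨O₁, hO₁, hSO₁⟩ := continuousOn_iff'.1 P.contMDiffOn_ψ.continuousOn _ hW
  have hmem : ∀ v ∈ P.S, v ∈ O₁ ↔ P.ψ v ∈ W := fun v hv ↦ by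
    have : v ∈ P.ψ ⁻¹' W ∩ P.S ↔ v ∈ O₁ ∩ P.S := by rw [hSO₁]
    simpa [hv] using this.symm
  have hspan : ∀ v ∈ P.S ∩ O₁, ∀ u, u ∈ Submodule.span ℝ (range fun i ↦ P.pull (X i) v) ↔
      P.D v u ∈ E (P.ψ v) := by
    intro v hv u
    rw [← (hXE _ ((hmem v hv.1).1 hv.2)).2, Submodule.mem_span_range_iff_exists_fun,
      Submodule.mem_span_range_iff_exists_fun]
    refine exists_congr fun a ↦ ?_
    have h1 : ∑ i, a i • X i (P.ψ v) = P.D v (∑ i, a i • P.pull (X i) v) := by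
      simp only [map_sum, map_smul, P.D_pull _ hv.1]
    rw [h1]
    constructor
    · rintro rfl
      rfl
    · intro h
      have := congrArg (P.D v).inverse h
      rwa [(P.isInvertible_D hv.1).inverse_apply_self,
        (P.isInvertible_D hv.1).inverse_apply_self] at this
  have hv₀' : v₀ ∈ P.S ∩ O₁ := ⟨hv₀, (hmem _ hv₀).2 hxW⟩
  have hli : LinearIndependent ℝ fun i ↦ P.pull (X i) v₀ := by
    refine LinearIndependent.of_comp (P.D v₀).toLinearMap ?_
    have h1 : ((P.D v₀).toLinearMap ∘ fun i ↦ P.pull (X i) v₀) = fun i ↦ X i (P.ψ v₀) :=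
      funext fun i ↦ P.D_pull _ hv₀
    rw [h1]
    exact (hXE _ hxW).1
  have hc' : IsCompl (Submodule.span ℝ (range fun i ↦ P.pull (X i) v₀))
      (LinearMap.range ι.toLinearMap) := by
    have h1 : Submodule.span ℝ (range fun i ↦ P.pull (X i) v₀) =
        (E (P.ψ v₀)).comap (P.D v₀).toLinearMap := by
      ext u
      exact hspan v₀ hv₀' u
    rwa [h1]
  obtain ⟨O₂, α, hO₂, hv₀2, hα, hker⟩ := exists_isForm_of_frame (S := P.S ∩ O₁)
    (fun i v hv ↦ (P.contDiffWithinAt_pull hW (hX i) hv.1 ((hmem v hv.1).1 hv.2)).mono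
      inter_subset_left) hv₀' hli hι hc'
  refine ⟨O₁ ∩ O₂, hO₁.inter hO₂, α, ⟨hv₀'.2, hv₀2⟩, ?_, ?_⟩
  · refine hα.mono ?_
    rintro v ⟨hv, hv1, hv2⟩
    exact ⟨⟨hv, hv1⟩, hv2⟩
  · rintro v ⟨hv, hv1, hv2⟩ u
    rw [P.restrict_D (hO₁.inter hO₂) (show v ∈ O₁ ∩ O₂ from ⟨hv1, hv2⟩), ← hker v ⟨⟨hv, hv1⟩, hv2⟩ u, hspan v ⟨hv, hv1⟩]
    rfl

theorem HasForm.isSectionOn_push (h : P.HasForm ι α E) (u : F) :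
    IsSectionOn I E (P.push (formSection ι α u)) P.O := by
  have : CompleteSpace F := FiniteDimensional.complete ℝ F
  refine ⟨P.smoothFieldOn_push (h.isForm.contDiffOn_formSection u), fun x hx ↦ ?_⟩
  have hv := P.φ_mem x hx
  rw [← P.ψ_φ x hx, P.push_ψ _ hv, h.mem_iff _ hv]
  exact h.isForm.apply_formSection hv u

theorem HasForm.exists_frame (h : P.HasForm ι α E) {x₀ : N} (hx₀ : x₀ ∈ P.O) :
    ∃ (W : Set N) (k : ℕ) (X : Fin k → ∀ x : N, TangentSpace I x),
    IsOpen W ∧ x₀ ∈ W ∧ (∀ i, SmoothFieldOn I (X i) W) ∧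
      ∀ x ∈ W, LinearIndependent ℝ (fun i ↦ X i x) ∧
        Submodule.span ℝ (Set.range fun i ↦ X i x) = E x := by
  obtain ⟨k, b, hb⟩ := h.isForm.exists_frame (P.φ_mem x₀ hx₀)
  refine ⟨P.O, k, fun i ↦ P.push (formSection ι α (b i)), P.isOpen_O, hx₀,
    fun i ↦ (h.isSectionOn_push (b i)).1, fun x hx ↦ ?_⟩
  have hv := P.φ_mem x hx
  obtain ⟨v, hvS, rfl⟩ : ∃ v ∈ P.S, P.ψ v = x := ⟨_, hv, P.ψ_φ x hx⟩
  obtain ⟨h1, h2⟩ := hb v hvS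
  have h3 : (fun i ↦ P.push (formSection ι α (b i)) (P.ψ v)) =
      fun i ↦ P.D v (formSection ι α (b i) v) := funext fun i ↦ P.push_ψ _ hvS
  rw [h3]
  constructor
  · have hinj : LinearMap.ker (P.D v).toLinearMap = ⊥ := by
      rw [LinearMap.ker_eq_bot]
      exact Function.LeftInverse.injective (g := (P.D v).inverse)
        fun u ↦ (P.isInvertible_D hvS).inverse_apply_self u
    exact h1.map' (P.D v).toLinearMap hinj
  · ext y
    obtain ⟨u, rfl⟩ : ∃ u, P.D v u = y := ⟨_, (P.isInvertible_D hvS).self_apply_inverse y⟩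
    rw [h.mem_iff v hvS, ← h2 u, Submodule.mem_span_range_iff_exists_fun,
      Submodule.mem_span_range_iff_exists_fun]
    refine exists_congr fun a ↦ ?_
    have h4 : ∑ i, a i • P.D v (formSection ι α (b i) v) =
        P.D v (∑ i, a i • formSection ι α (b i) v) := by
      simp only [map_sum, map_smul]
    rw [h4]
    constructor
    · intro h
      have := congrArg (P.D v).inverse h
      rwa [(P.isInvertible_D hvS).inverse_apply_self,
        (P.isInvertible_D hvS).inverse_apply_self] at this
    · rintro rfl
      rfl

/-- The closure of a distribution that is given over a dense set by the kernel of a form. -/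
theorem hasForm_distributionClosure (hα : IsForm P.S ι α) {Q : Set N}
    (hQ : ∀ v ∈ P.S, v ∈ closure {v' ∈ P.S | P.ψ v' ∈ Q})
    (h : ∀ v ∈ P.S, P.ψ v ∈ Q → ∀ u, P.D v u ∈ E (P.ψ v) ↔ α v u = 0) :
    P.HasForm ι α (distributionClosure I E Q) := by
  have : CompleteSpace F := FiniteDimensional.complete ℝ F
  refine ⟨hα, fun v hv u ↦ ⟨?_, fun hu ↦ ?_⟩⟩
  · rintro ⟨W, Z, hW, hvW, hZ, hZv, hZE⟩
    have h1 : P.pull Z v = u := by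
      change (P.D v).inverse (Z (P.ψ v)) = u
      rw [hZv, (P.isInvertible_D hv).inverse_apply_self]
    have h2 : ContinuousWithinAt (fun v' ↦ α v' (P.pull Z v')) P.S v :=
      (hα.contDiffOn.continuousOn v hv).clm_apply
        (P.contDiffWithinAt_pull hW hZ hv hvW).continuousWithinAt
    -- The equation α(Z) = 0 holds over `Q` and extends to `v` by continuity and density.
    have h3 : ∀ᶠ v' in 𝓝[{v' ∈ P.S | P.ψ v' ∈ Q}] v, α v' (P.pull Z v') = 0 := by
      have h4 : ∀ᶠ v' in 𝓝[P.S] v, P.ψ v' ∈ W :=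
        (P.contMDiffOn_ψ v hv).continuousWithinAt.preimage_mem_nhdsWithin (hW.mem_nhds hvW)
      filter_upwards [nhdsWithin_mono v (sep_subset _ _) h4, self_mem_nhdsWithin] with v' h5 h6
      rw [← h v' h6.1 h6.2, P.D_pull _ h6.1]
      exact hZE _ ⟨h5, h6.2⟩
    have : (𝓝[{v' ∈ P.S | P.ψ v' ∈ Q}] v).NeBot := mem_closure_iff_nhdsWithin_neBot.1 (hQ v hv)
    have h7 := tendsto_nhds_unique (tendsto_const_nhds.congr' (h3.mono fun _ h ↦ h.symm))
      (h2.mono (sep_subset _ _)).tendsto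
    rw [h1] at h7
    exact h7.symm
  · refine ⟨P.O, P.push (formSection ι α u), P.isOpen_O, P.ψ_mem v hv,
      P.smoothFieldOn_push (hα.contDiffOn_formSection u), ?_, ?_⟩
    · rw [P.push_ψ _ hv, formSection_of_eq_zero hu]
    · rintro x ⟨hx, hxQ⟩
      have hv' := P.φ_mem x hx
      have h1 := h _ hv' (by rwa [P.ψ_φ x hx]) (formSection ι α u (P.φ x))
      rw [← P.ψ_φ x hx, P.push_ψ _ hv']
      exact h1.2 (hα.apply_formSection hv' u)

/-- Up to sign, Ω is the exterior derivative of the form on kernels; in particular the condition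
depends only on the values of `X` and `Y` at the point. -/
theorem HasForm.mlieBracket_mem_iff (h : P.HasForm ι α E) {W : Set N} (hW : IsOpen W)
    {X Y : ∀ x : N, TangentSpace I x} (hX : IsSectionOn I E X W) (hY : IsSectionOn I E Y W)
    {v : F} (hv : v ∈ P.S) (hvW : P.ψ v ∈ W) :
    mlieBracket I X Y (P.ψ v) ∈ E (P.ψ v) ↔
      dForm α P.S v (P.pull X v) (P.pull Y v) = 0 := by
  have : CompleteSpace F := FiniteDimensional.complete ℝ F
  have h0 : ∀ Z : ∀ x : N, TangentSpace I x, IsSectionOn I E Z W →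
      ∀ᶠ v' in 𝓝[P.S] v, α v' (P.pull Z v') = 0 := by
    intro Z hZ
    have h4 : ∀ᶠ v' in 𝓝[P.S] v, P.ψ v' ∈ W :=
      (P.contMDiffOn_ψ v hv).continuousWithinAt.preimage_mem_nhdsWithin (hW.mem_nhds hvW)
    filter_upwards [h4, self_mem_nhdsWithin] with v' h5 h6
    rw [← h.mem_iff v' h6, P.D_pull _ h6]
    exact hZ.2 _ h5
  rw [← P.D_pull (mlieBracket I X Y) hv, h.mem_iff v hv, P.pull_mlieBracket hW hX.1 hY.1 hv hvW,
    h.isForm.apply_lieBracketWithin P.uniqueDiffOn hv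
      ((P.contDiffWithinAt_pull hW hX.1 hv hvW).differentiableWithinAt (by simp))
      ((P.contDiffWithinAt_pull hW hY.1 hv hvW).differentiableWithinAt (by simp)) (h0 X hX)
      (h0 Y hY), neg_eq_zero]

theorem HasForm.apply_pull (h : P.HasForm ι α E) {X : ∀ x : N, TangentSpace I x} {v : F}
    (hv : v ∈ P.S) : α v (P.pull X v) = 0 ↔ X (P.ψ v) ∈ E (P.ψ v) := by
  rw [← h.mem_iff v hv, P.D_pull _ hv]

theorem pull_push_formSection {v u : F} (hv : v ∈ P.S) (hu : α v u = 0) :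
    P.pull (P.push (formSection ι α u)) v = u := by
  rw [P.pull_push _ hv, formSection_of_eq_zero hu]

/-- Every kernel vector is the value of a section built by `formSection`, so a condition on all
local sections becomes bilinear algebra at one point. -/
theorem HasForm.involutiveAt_iff (h : P.HasForm ι α E) {v : F} (hv : v ∈ P.S) :
    InvolutiveAt I E (P.ψ v) ↔ ∀ u w, α v u = 0 → α v w = 0 → dForm α P.S v u w = 0 := by
  constructor
  · intro hi u w hu hw
    have h1 := hi P.O _ _ P.isOpen_O (P.ψ_mem v hv) (h.isSectionOn_push u) (h.isSectionOn_push w)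
    rwa [h.mlieBracket_mem_iff P.isOpen_O (h.isSectionOn_push u) (h.isSectionOn_push w) hv
      (P.ψ_mem v hv), pull_push_formSection hv hu, pull_push_formSection hv hw] at h1
  · intro hd W X Y hW hvW hX hY
    rw [h.mlieBracket_mem_iff hW hX hY hv hvW]
    exact hd _ _ ((h.apply_pull hv).2 (hX.2 _ hvW)) ((h.apply_pull hv).2 (hY.2 _ hvW))

theorem HasForm.nondegenerateAt_iff (h : P.HasForm ι α E) {v : F} (hv : v ∈ P.S) :
    NondegenerateAt I E (P.ψ v) ↔ ∀ u, α v u = 0 →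
      (∀ w, α v w = 0 → dForm α P.S v u w = 0) → u = 0 := by
  constructor
  · intro hi u hu hd
    have h1 := hi (P.D v u) ((h.mem_iff v hv u).2 hu) fun W X Y hW hvW hX hY hXu ↦ by
      rw [h.mlieBracket_mem_iff hW hX hY hv hvW]
      have h2 : P.pull X v = u := by
        change (P.D v).inverse (X (P.ψ v)) = u
        rw [hXu, (P.isInvertible_D hv).inverse_apply_self]
      rw [h2]
      exact hd _ ((h.apply_pull hv).2 (hY.2 _ hvW))
    have h2 := congrArg (P.D v).inverse h1
    rwa [(P.isInvertible_D hv).inverse_apply_self, map_zero] at h2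
  · intro hd y hy hbr
    obtain ⟨u, rfl⟩ : ∃ u, P.D v u = y := ⟨_, (P.isInvertible_D hv).self_apply_inverse y⟩
    have hu := (h.mem_iff v hv u).1 hy
    rw [hd u hu fun w hw ↦ ?_, map_zero]
    have h1 := hbr P.O _ _ P.isOpen_O (P.ψ_mem v hv) (h.isSectionOn_push u) (h.isSectionOn_push w)
      (by rw [P.push_ψ _ hv, formSection_of_eq_zero hu])
    rwa [h.mlieBracket_mem_iff P.isOpen_O (h.isSectionOn_push u) (h.isSectionOn_push w) hv
      (P.ψ_mem v hv), pull_push_formSection hv hu, pull_push_formSection hv hw] at h1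

/-- Involutivity extends from a dense set. -/
theorem HasForm.involutiveAt_of_mem_closure (h : P.HasForm ι α E) {v : F} (hv : v ∈ P.S)
    (hcl : v ∈ closure {v' ∈ P.S | InvolutiveAt I E (P.ψ v')}) : InvolutiveAt I E (P.ψ v) := by
  rw [h.involutiveAt_iff hv]
  intro u w hu hw
  refine h.isForm.dForm_eq_zero_of_mem_closure P.uniqueDiffOn hv (closure_mono ?_ hcl) hu hw
  rintro v' ⟨hv', hi⟩
  exact ⟨hv', (h.involutiveAt_iff hv').1 hi⟩

theorem HasForm.finrank_quotient (h : P.HasForm ι α E) {v : F} (hv : v ∈ P.S) :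
    Module.finrank ℝ (TangentSpace I (P.ψ v) ⧸ E (P.ψ v)) = Module.finrank ℝ K := by
  let L : TangentSpace I (P.ψ v) →ₗ[ℝ] K := (α v).toLinearMap.comp (P.D v).inverse.toLinearMap
  have h1 : LinearMap.ker L = E (P.ψ v) := by
    ext y
    obtain ⟨u, rfl⟩ : ∃ u, P.D v u = y := ⟨_, (P.isInvertible_D hv).self_apply_inverse y⟩
    rw [h.mem_iff v hv, LinearMap.mem_ker]
    change α v ((P.D v).inverse (P.D v u)) = 0 ↔ _
    rw [(P.isInvertible_D hv).inverse_apply_self]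
  have h2 : Function.Surjective L := fun κ ↦ ⟨P.D v (ι κ), by
    change α v ((P.D v).inverse (P.D v (ι κ))) = κ
    rw [(P.isInvertible_D hv).inverse_apply_self, h.isForm.apply_ι v hv]⟩
  rw [← h1]
  exact (L.quotKerEquivOfSurjective h2).finrank_eq

end LocalParam
end

/-! ### Comparison over the interior, and the covering of a tube -/

noncomputable section

open Set Filter Topology VectorField

namespace FreeCircleActionNearBoundary

variable {n : ℕ} [NeZero n] {M : Type*} [TopologicalSpace M]
  [ChartedSpace (EuclideanHalfSpace n) M] [IsManifold (𝓡∂ n) ∞ M]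
  {A : FreeCircleActionNearBoundary n M}

theorem isOpen_interior_M : IsOpen ((𝓡∂ n).interior M) :=
  ModelWithCorners.isOpen_interior (n := ∞) (by simp)

variable (A) in
/-- The parametrization of a part of the interior by a chart. -/
def interiorParam (x : M) : LocalParam (𝓡∂ n) M (EuclideanSpace ℝ (Fin n)) where
  S := (A.interiorChart x).target
  O := (𝓡∂ n).interior M ∩ (extChartAt (𝓡∂ n) x).source
  ψ := (extChartAt (𝓡∂ n) x).symm
  φ := extChartAt (𝓡∂ n) x
  isOpen_O := isOpen_interior_M.inter (isOpen_extChartAt_source x)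
  uniqueDiffOn := (A.interiorChart x).open_target.uniqueDiffOn
  subset_closure := by
    rw [(A.interiorChart x).open_target.interior_eq]
    exact subset_closure
  contMDiffOn_ψ := (contMDiffOn_extChartAt_symm x).mono inter_subset_left
  contMDiffOn_φ := contMDiffOn_extChartAt.mono
    (inter_subset_right.trans (extChartAt_source (𝓡∂ n) x).subset)
  ψ_mem v hv := A.mem_source_interiorChart_iff.1 ((A.interiorChart x).map_target hv)
  φ_mem y hy := by
    have := (A.interiorChart x).map_source (A.mem_source_interiorChart_iff.2 hy)
    change extChartAt (𝓡∂ n) x (A.out (A.c y)) ∈ _ at this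
    rwa [A.out_c_of_interior hy.1] at this
  φ_ψ v hv := (extChartAt (𝓡∂ n) x).right_inv hv.1
  ψ_φ y hy := (extChartAt (𝓡∂ n) x).left_inv hy.2

section CutStructure
variable [T2Space M] [SecondCountableTopology M]
  [ChartedSpace (EuclideanSpace ℝ (Fin n)) A.Cut] [IsManifold (𝓡 n) ∞ A.Cut]

/-- The parametrization of a part of the cut space by an interior chart. -/
def IsCutStructure.interiorParam (hA : A.IsCutStructure) (x : M) :
    LocalParam (𝓡 n) A.Cut (EuclideanSpace ℝ (Fin n)) where
  S := (A.interiorChart x).target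
  O := (A.interiorChart x).source
  ψ := (A.interiorChart x).symm
  φ := A.interiorChart x
  isOpen_O := (A.interiorChart x).open_source
  uniqueDiffOn := (A.interiorChart x).open_target.uniqueDiffOn
  subset_closure := by
    rw [(A.interiorChart x).open_target.interior_eq]
    exact subset_closure
  contMDiffOn_ψ := hA.contMDiffOn_c.comp (A.interiorParam x).contMDiffOn_ψ
    fun v hv ↦ ((A.interiorParam x).ψ_mem v hv).1
  contMDiffOn_φ := by
    refine (A.interiorParam x).contMDiffOn_φ.comp (hA.contMDiffOn_out.mono ?_) ?_
    · rintro _ ⟨y, hy, rfl⟩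
      exact ⟨y, hy.1, rfl⟩
    · rintro _ ⟨y, hy, rfl⟩
      rw [mem_preimage, A.out_c_of_interior hy.1]
      exact hy
  ψ_mem _ hv := (A.interiorChart x).map_target hv
  φ_mem _ hy := (A.interiorChart x).map_source hy
  φ_ψ _ hv := (A.interiorChart x).right_inv hv
  ψ_φ _ hy := (A.interiorChart x).left_inv hy

theorem IsCutStructure.mdifferentiableAt_c (hA : A.IsCutStructure) {x : M}
    (hx : x ∈ (𝓡∂ n).interior M) : MDifferentiableAt (𝓡∂ n) (𝓡 n) A.c x :=
  (hA.contMDiffOn_c.contMDiffAt (isOpen_interior_M.mem_nhds hx)).mdifferentiableAt (by simp)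

theorem IsCutStructure.interiorParam_D (hA : A.IsCutStructure) (x : M)
    {v : EuclideanSpace ℝ (Fin n)} (hv : v ∈ (A.interiorParam x).S) (u) :
    (hA.interiorParam x).D v u =
      mfderiv (𝓡∂ n) (𝓡 n) A.c ((A.interiorParam x).ψ v) ((A.interiorParam x).D v u) := by
  have h1 := (hA.mdifferentiableAt_c ((A.interiorParam x).ψ_mem v hv).1).hasMFDerivAt
  have h2 := h1.comp_hasMFDerivWithinAt v
    ((A.interiorParam x).mdifferentiableWithinAt_ψ hv).hasMFDerivWithinAt
  have h3 := ((hA.interiorParam x).mdifferentiableWithinAt_ψ hv).hasMFDerivWithinAt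
  exact DFunLike.congr_fun (((A.interiorParam x).uniqueDiffOn.uniqueMDiffOn v hv).eq h3 h2) u

theorem exists_interiorParam {x : M} (hx : x ∈ (𝓡∂ n).interior M) :
    ∃ v ∈ (A.interiorParam x).S, (A.interiorParam x).ψ v = x :=
  ⟨_, (A.interiorParam x).φ_mem x ⟨hx, mem_extChartAt_source x⟩,
    (A.interiorParam x).ψ_φ x ⟨hx, mem_extChartAt_source x⟩⟩

theorem IsCutStructure.isInvertible_mfderiv_c (hA : A.IsCutStructure) {x : M}
    (hx : x ∈ (𝓡∂ n).interior M) : (mfderiv (𝓡∂ n) (𝓡 n) A.c x).IsInvertible := by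
  obtain ⟨v, hv, hvx⟩ := exists_interiorParam (A := A) hx
  have h1 := (A.interiorParam x).isInvertible_D hv
  have h2 := (hA.interiorParam x).isInvertible_D hv
  obtain ⟨e₁, he₁⟩ := h1
  obtain ⟨e₂, he₂⟩ := h2
  rw [← hvx]
  refine ⟨e₁.symm.trans e₂, ?_⟩
  ext1 y
  obtain ⟨u, rfl⟩ := e₁.surjective y
  have h3 := hA.interiorParam_D x hv u
  rw [← he₁, ← he₂] at h3
  refine Eq.trans ?_ h3
  exact congrArg e₂ (e₁.symm_apply_apply u)

theorem mem_iff_of_agrees {E : ∀ x : M, Submodule ℝ (TangentSpace (𝓡∂ n) x)}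
    {E' : ∀ y : A.Cut, Submodule ℝ (TangentSpace (𝓡 n) y)} (hag : A.AgreesOnInterior E E') {x : M}
    (hx : x ∈ (𝓡∂ n).interior M) (u) : mfderiv (𝓡∂ n) (𝓡 n) A.c x u ∈ E' (A.c x) ↔ u ∈ E x := by
  rw [← hag x hx]
  rfl

/-- The two parametrizations have the same domain and differ by `c`, so one form describes both
distributions. -/
theorem IsCutStructure.hasForm_interior (hA : A.IsCutStructure)
    {E : ∀ x : M, Submodule ℝ (TangentSpace (𝓡∂ n) x)}
    {E' : ∀ y : A.Cut, Submodule ℝ (TangentSpace (𝓡 n) y)} (hag : A.AgreesOnInterior E E')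
    {K : Type*} [NormedAddCommGroup K] [NormedSpace ℝ K] {x : M}
    {ι : K →L[ℝ] EuclideanSpace ℝ (Fin n)} {α} {O' : Set (EuclideanSpace ℝ (Fin n))}
    (hO' : IsOpen O') (h : ((A.interiorParam x).restrict hO').HasForm ι α E) :
    ((hA.interiorParam x).restrict hO').HasForm ι α E' := by
  refine ⟨h.isForm, fun v hv u ↦ ?_⟩
  have h1 := h.mem_iff v hv u
  rw [LocalParam.restrict_D _ _ hv.2] at h1 ⊢
  refine Iff.trans ?_ h1
  have h2 := mem_iff_of_agrees hag ((A.interiorParam x).ψ_mem v hv.1).1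
    ((A.interiorParam x).D v u)
  rw [← hA.interiorParam_D x hv.1 u] at h2
  exact h2

theorem exists_hasForm_interior {E : ∀ x : M, Submodule ℝ (TangentSpace (𝓡∂ n) x)}
    (hE : IsDistribution (𝓡∂ n) E) {x : M} (hx : x ∈ (𝓡∂ n).interior M) :
    ∃ (K : Submodule ℝ (EuclideanSpace ℝ (Fin n))) (O' : Set (EuclideanSpace ℝ (Fin n)))
      (hO' : IsOpen O') (α : EuclideanSpace ℝ (Fin n) → EuclideanSpace ℝ (Fin n) →L[ℝ] K)
      (v : EuclideanSpace ℝ (Fin n)), v ∈ ((A.interiorParam x).restrict hO').S ∧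
      (A.interiorParam x).ψ v = x ∧ ((A.interiorParam x).restrict hO').HasForm K.subtypeL α E := by
  obtain ⟨v, hv, hvx⟩ := exists_interiorParam (A := A) hx
  obtain ⟨K, hK⟩ := Submodule.exists_isCompl
    ((E ((A.interiorParam x).ψ v)).comap ((A.interiorParam x).D v).toLinearMap)
  obtain ⟨O', hO', α, hvO', hα⟩ := LocalParam.exists_hasForm_restrict (ι := K.subtypeL) hE hv
    Subtype.val_injective (by
      have : LinearMap.range K.subtypeL.toLinearMap = K := Submodule.range_subtype K
      rwa [this])
  exact ⟨K, O', hO', α, v, ⟨hv, hvO'⟩, hvx, hα⟩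

/-- The local properties of a distribution at an interior point and of its cut at the image of this
point are the same. -/
theorem IsCutStructure.interior_iff (hA : A.IsCutStructure)
    {E : ∀ x : M, Submodule ℝ (TangentSpace (𝓡∂ n) x)} (hE : IsDistribution (𝓡∂ n) E)
    {E' : ∀ y : A.Cut, Submodule ℝ (TangentSpace (𝓡 n) y)} (hag : A.AgreesOnInterior E E')
    {x : M} (hx : x ∈ (𝓡∂ n).interior M) :
    (InvolutiveAt (𝓡∂ n) E x ↔ InvolutiveAt (𝓡 n) E' (A.c x)) ∧
    (NondegenerateAt (𝓡∂ n) E x ↔ NondegenerateAt (𝓡 n) E' (A.c x)) ∧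
    Module.finrank ℝ (TangentSpace (𝓡∂ n) x ⧸ E x) =
      Module.finrank ℝ (TangentSpace (𝓡 n) (A.c x) ⧸ E' (A.c x)) := by
  obtain ⟨K, O', hO', α, v, hv, hvx, hα⟩ := exists_hasForm_interior (A := A) hE hx
  have hα' := hA.hasForm_interior hag hO' hα
  have hvx' : ((hA.interiorParam x).restrict hO').ψ v = A.c x := congrArg A.c hvx
  have h1 := (hα.involutiveAt_iff hv).trans (hα'.involutiveAt_iff hv).symm
  have h2 := (hα.nondegenerateAt_iff hv).trans (hα'.nondegenerateAt_iff hv).symm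
  have h3 := (hα.finrank_quotient hv).trans (hα'.finrank_quotient hv).symm
  rw [hvx'] at h1 h2 h3
  change (A.interiorParam x).ψ v = x at hvx
  change (InvolutiveAt (𝓡∂ n) E ((A.interiorParam x).ψ v) ↔ _) at h1
  change (NondegenerateAt (𝓡∂ n) E ((A.interiorParam x).ψ v) ↔ _) at h2
  change Module.finrank ℝ (TangentSpace (𝓡∂ n) ((A.interiorParam x).ψ v) ⧸
    E ((A.interiorParam x).ψ v)) = _ at h3
  rw [hvx] at h1 h2 h3
  exact ⟨h1, h2, h3⟩

end CutStructure

namespace Tube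
variable (τ : A.Tube)

/-- The parametrization of a tube by its universal covering. -/
def cover (p : ℝ × (SliceSpace n × ℝ)) : M := A.act (Circle.exp p.1) (τ.σ p.2)

theorem contMDiffOn_cover : ContMDiffOn 𝓘(ℝ, ℝ × (SliceSpace n × ℝ)) (𝓡∂ n) ∞ τ.cover
    (univ ×ˢ τ.Dp) := by
  rintro ⟨s, d⟩ ⟨-, hd⟩
  refine (A.contMDiffAt_exp_act_prod s (τ.σ_mem d hd)).comp_contMDiffWithinAt
    (f := fun p : ℝ × (SliceSpace n × ℝ) ↦ (p.1, τ.σ p.2)) (s, d) ?_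
  refine ContMDiffWithinAt.prodMk ?_ ?_
  · exact contDiff_fst.contMDiff.contMDiffAt.contMDiffWithinAt
  · exact (τ.contMDiffOn_σ d hd).comp (s, d)
      (contDiff_snd.contMDiff.contMDiffAt.contMDiffWithinAt) fun p hp ↦ hp.2

theorem uniqueMDiffOn_cover : UniqueMDiffOn 𝓘(ℝ, ℝ × (SliceSpace n × ℝ))
    ((univ : Set ℝ) ×ˢ τ.Dp) :=
  (uniqueDiffOn_univ.prod τ.uniqueDiffOn_Dp).uniqueMDiffOn

/-- The derivative of the covering parametrization of a tube. -/
def coverD (p : ℝ × (SliceSpace n × ℝ)) :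
    ℝ × (SliceSpace n × ℝ) →L[ℝ] TangentSpace (𝓡∂ n) (τ.cover p) :=
  mfderivWithin 𝓘(ℝ, ℝ × (SliceSpace n × ℝ)) (𝓡∂ n) τ.cover (univ ×ˢ τ.Dp) p

theorem hasMFDerivWithinAt_cover {s : ℝ} {d} (hd : d ∈ τ.Dp) :
    HasMFDerivWithinAt 𝓘(ℝ, ℝ × (SliceSpace n × ℝ)) (𝓡∂ n) τ.cover (univ ×ˢ τ.Dp) (s, d)
      (τ.coverD (s, d)) :=
  ((τ.contMDiffOn_cover (s, d) ⟨mem_univ _, hd⟩).mdifferentiableWithinAt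
    (by simp)).hasMFDerivWithinAt

theorem cover_add (s t : ℝ) {d} (hd : d ∈ τ.Dp) :
    τ.cover (s + t, d) = A.act (Circle.exp s) (τ.cover (t, d)) := by
  rw [cover, cover, Circle.exp_add, A.mul_act _ _ _ (τ.σ_mem d hd)]

theorem cover_mem_T (s : ℝ) {d} (hd : d ∈ τ.Dp) : τ.cover (s, d) ∈ τ.T := τ.act_mem_T _ hd

theorem coverD_add (s t : ℝ) {d} (hd : d ∈ τ.Dp) (u) :
    τ.coverD (s + t, d) u =
      mfderiv (𝓡∂ n) (𝓡∂ n) (A.act (Circle.exp s)) (τ.cover (t, d)) (τ.coverD (t, d) u) := by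
  have h1 : HasMFDerivWithinAt 𝓘(ℝ, ℝ × (SliceSpace n × ℝ)) 𝓘(ℝ, ℝ × (SliceSpace n × ℝ))
      (fun p : ℝ × (SliceSpace n × ℝ) ↦ (s + p.1, p.2)) (univ ×ˢ τ.Dp) (t, d)
      (ContinuousLinearMap.id ℝ (ℝ × (SliceSpace n × ℝ))) := by
    refine HasFDerivWithinAt.hasMFDerivWithinAt ?_
    have : (fun p : ℝ × (SliceSpace n × ℝ) ↦ (s + p.1, p.2)) = fun p ↦ (s, 0) + p := by
      funext p
      simp [Prod.ext_iff]
    rw [this]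
    exact (hasFDerivWithinAt_id _ _).const_add _
  have h0 : (univ : Set ℝ) ×ˢ τ.Dp ⊆
      (fun p : ℝ × (SliceSpace n × ℝ) ↦ (s + p.1, p.2)) ⁻¹' (univ ×ˢ τ.Dp) :=
    fun p hp ↦ ⟨mem_univ _, hp.2⟩
  have h2 := (τ.hasMFDerivWithinAt_cover (s := s + t) hd).comp (t, d) h1 h0
  have hmem : τ.cover (t, d) ∈ A.U := τ.T_subset_U (τ.cover_mem_T t hd)
  have h3 := ((A.contMDiffAt_act (Circle.exp s) hmem).mdifferentiableAt
    (by simp)).hasMFDerivAt.comp_hasMFDerivWithinAt (t, d)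
    (τ.hasMFDerivWithinAt_cover (s := t) hd)
  have h4 := h3.congr_of_eventuallyEq (f₁ := τ.cover ∘ fun p : ℝ × (SliceSpace n × ℝ) ↦
    (s + p.1, p.2)) (by
      filter_upwards [self_mem_nhdsWithin] with p hp
      exact τ.cover_add s p.1 hp.2) (τ.cover_add s t hd)
  exact DFunLike.congr_fun (((τ.uniqueMDiffOn_cover) (t, d) ⟨mem_univ _, hd⟩).eq h2 h4) u

/-- Translation in the angular variable is the circle action, so invariance of `E` makes its
coordinate expression independent of the angle. -/
theorem coverD_mem_iff {E : ∀ x : M, Submodule ℝ (TangentSpace (𝓡∂ n) x)} {V : Set M}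
    (hV : τ.T ⊆ V) (hE : ∀ a, ∀ x ∈ V,
      (E x).map (mfderiv (𝓡∂ n) (𝓡∂ n) (A.act a) x).toLinearMap = E (A.act a x))
    (s : ℝ) {d} (hd : d ∈ τ.Dp) (u) :
    τ.coverD (s, d) u ∈ E (τ.cover (s, d)) ↔ τ.coverD (0, d) u ∈ E (τ.cover (0, d)) := by
  have hT := τ.cover_mem_T 0 hd
  have h1 := τ.coverD_add s 0 hd u
  have h2 := τ.cover_add s 0 hd
  have h3 := hE (Circle.exp s) _ (hV hT)
  have hinj : Function.Injective
      (mfderiv (𝓡∂ n) (𝓡∂ n) (A.act (Circle.exp s)) (τ.cover (0, d))) :=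
    Function.LeftInverse.injective fun y ↦
      DFunLike.congr_fun (A.mfderiv_act_inv_comp (Circle.exp s) (τ.T_subset_U hT)) y
  have key : ∀ p, p = s + 0 → (τ.coverD (p, d) u ∈ E (τ.cover (p, d)) ↔
      τ.coverD (0, d) u ∈ E (τ.cover (0, d))) := by
    rintro _ rfl
    rw [h1, h2, ← h3]
    constructor
    · rintro ⟨y, hy, hyu⟩
      rwa [← hinj hyu]
    · exact fun h ↦ ⟨_, h, rfl⟩
  exact key s (add_zero s).symm

end Tube
end FreeCircleActionNearBoundary
end

/-! ### Parametrizations at the boundary and at its image -/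

noncomputable section

open Set Filter Topology VectorField

namespace FreeCircleActionNearBoundary

variable {n : ℕ} [NeZero n] {M : Type*} [TopologicalSpace M]
  [ChartedSpace (EuclideanHalfSpace n) M] [IsManifold (𝓡∂ n) ∞ M]
  {A : FreeCircleActionNearBoundary n M}

namespace Tube
variable (τ : A.Tube)

/-- The domain of `boundaryParam`. -/
def paramDomain : Set (ℝ × (SliceSpace n × ℝ)) :=
  (univ ×ˢ τ.Dp) ∩ (Ioo (-Real.pi) Real.pi ×ˢ univ)

theorem isOpen_Ioo_prod_univ : IsOpen (Ioo (-Real.pi) Real.pi ×ˢ (univ : Set (SliceSpace n × ℝ))) :=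
  isOpen_Ioo.prod isOpen_univ

theorem subset_closure_interior_Dp : τ.Dp ⊆ closure (interior τ.Dp) := by
  rintro d ⟨hd, hd'⟩
  have h1 : {d : SliceSpace n × ℝ | 0 < d.2} ∩ τ.D ⊆ interior τ.Dp :=
    interior_maximal (fun e he ↦ ⟨he.2, (show (0 : ℝ) < e.2 from he.1).le⟩)
      ((isOpen_lt continuous_const continuous_snd).inter τ.isOpen_D)
  refine closure_mono h1 (τ.isOpen_D.closure_inter ⟨?_, hd⟩)
  have h2 : (univ : Set (SliceSpace n)) ×ˢ Ici (0 : ℝ) ⊆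
      closure ((univ : Set (SliceSpace n)) ×ˢ Ioi (0 : ℝ)) := by
    rw [closure_prod_eq, closure_univ, closure_Ioi]
  have h3 : d ∈ (univ : Set (SliceSpace n)) ×ˢ Ici (0 : ℝ) := ⟨mem_univ d.1, hd'⟩
  exact closure_mono (fun e he ↦ he.2) (h2 h3)

theorem exp_mem_slitPlane {s : ℝ} (hs : s ∈ Ioo (-Real.pi) Real.pi) :
    (Circle.exp s : ℂ) ∈ Complex.slitPlane := by
  rw [Complex.mem_slitPlane_iff_arg, Circle.arg_exp hs.1 hs.2.le]
  exact ⟨hs.2.ne, Circle.coe_ne_zero _⟩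

/-- The parametrization of a part of a tube by its universal covering. -/
def boundaryParam : LocalParam (𝓡∂ n) M (ℝ × (SliceSpace n × ℝ)) where
  S := τ.paramDomain
  O := τ.T ∩ (fun x ↦ (τ.ang x : ℂ)) ⁻¹' Complex.slitPlane
  ψ := τ.cover
  φ x := (Complex.arg (τ.ang x), τ.co x)
  isOpen_O := τ.contMDiffOn_ang.continuousOn.isOpen_inter_preimage τ.isOpen_T
    Complex.isOpen_slitPlane
  uniqueDiffOn := (uniqueDiffOn_univ.prod τ.uniqueDiffOn_Dp).inter isOpen_Ioo_prod_univ
  subset_closure := by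
    rintro v ⟨hv, hv'⟩
    rw [paramDomain, interior_inter, isOpen_Ioo_prod_univ.interior_eq, inter_comm]
    refine isOpen_Ioo_prod_univ.inter_closure ⟨hv', ?_⟩
    rw [interior_prod_eq, closure_prod_eq, interior_univ, closure_univ]
    exact ⟨mem_univ _, τ.subset_closure_interior_Dp hv.2⟩
  contMDiffOn_ψ := τ.contMDiffOn_cover.mono inter_subset_left
  contMDiffOn_φ := by
    intro x hx
    refine ContMDiffWithinAt.prodMk_space ?_ ((τ.contMDiffOn_co x hx.1).mono inter_subset_left)
    have h1 : ContDiffAt ℝ ∞ (fun z : ℂ ↦ z.arg) (τ.ang x : ℂ) := by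
      have h2 : ContDiffAt ℂ ∞ Complex.log (τ.ang x : ℂ) := Complex.contDiffAt_log hx.2
      have h3 := Complex.imCLM.contDiff.contDiffAt.comp _ (h2.restrict_scalars ℝ)
      exact h3.congr_of_eventuallyEq (Eventually.of_forall fun z ↦ (Complex.log_im z).symm)
    exact h1.contMDiffAt.comp_contMDiffWithinAt (f := fun x ↦ (τ.ang x : ℂ)) x
      ((τ.contMDiffOn_ang x hx.1).mono inter_subset_left)
  ψ_mem v hv := ⟨τ.cover_mem_T v.1 hv.1.2, by
    rw [mem_preimage, cover, τ.ang_act _ _ hv.1.2]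
    exact exp_mem_slitPlane hv.2.1⟩
  φ_mem x hx := by
    have h := Complex.mem_slitPlane_iff_arg.1 hx.2
    exact ⟨⟨mem_univ _, τ.co_mem hx.1⟩,
      ⟨⟨Complex.neg_pi_lt_arg _, lt_of_le_of_ne (Complex.arg_le_pi _) h.1⟩, mem_univ _⟩⟩
  φ_ψ v hv := by
    rw [cover, τ.ang_act _ _ hv.1.2, τ.co_act _ _ hv.1.2, Circle.arg_exp hv.2.1.1 hv.2.1.2.le]
  ψ_φ x hx := by
    rw [cover, Circle.exp_arg]
    exact τ.act_ang_σ_co hx.1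

theorem boundaryParam_D {v} (hv : v ∈ τ.paramDomain) : τ.boundaryParam.D v = τ.coverD v :=
  mfderivWithin_inter (isOpen_Ioo_prod_univ.mem_nhds hv.2)

theorem zero_mem_paramDomain : 0 ∈ τ.paramDomain :=
  ⟨⟨mem_univ _, τ.zero_mem_Dp⟩, ⟨⟨by simp [Real.pi_pos], by simp [Real.pi_pos]⟩, mem_univ _⟩⟩

theorem cover_zero : τ.cover 0 = τ.σ 0 := by
  change A.act (Circle.exp 0) (τ.σ 0) = _
  rw [Circle.exp_zero, A.one_act _ (τ.σ_mem 0 τ.zero_mem_Dp)]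

theorem cover_mem_interior_iff {v} (hv : v.2 ∈ τ.Dp) :
    τ.cover v ∈ (𝓡∂ n).interior M ↔ 0 < v.2.2 := by
  rw [τ.mem_interior_iff (τ.cover_mem_T v.1 hv), cover, τ.co_act _ _ hv]

section Cut
variable [T2Space M] [SecondCountableTopology M]
  [ChartedSpace (EuclideanSpace ℝ (Fin n)) A.Cut] [IsManifold (𝓡 n) ∞ A.Cut]

variable {τ} in
/-- The parametrization of a part of the cut space by cut coordinates. -/
def _root_.FreeCircleActionNearBoundary.IsCutStructure.cutParam (hA : A.IsCutStructure)
    {f : M → ℝ} (hf : A.IsInvariantBoundaryDefining f) {g} (hτ : τ.IsFactor f g) :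
    LocalParam (𝓡 n) A.Cut (SliceSpace n × ℂ) where
  S := τ.cutD
  O := τ.cutChart.source
  ψ v := A.c (τ.lift v)
  φ := τ.cutChart
  isOpen_O := τ.cutChart.open_source
  uniqueDiffOn := τ.isOpen_cutD.uniqueDiffOn
  subset_closure := by
    rw [τ.isOpen_cutD.interior_eq]
    exact subset_closure
  contMDiffOn_ψ := hA.contMDiffOn_lift hf hτ
  contMDiffOn_φ := hA.contMDiffOn_cutChart hf hτ
  ψ_mem v hv := τ.cutChart.map_target hv
  φ_mem x hx := τ.cutChart.map_source hx
  φ_ψ v hv := τ.cutChart.right_inv hv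
  ψ_φ x hx := τ.cutChart.left_inv hx

variable (hA : A.IsCutStructure) {f : M → ℝ} (hf : A.IsInvariantBoundaryDefining f) {g}
  (hτ : τ.IsFactor f g)
include hA hf hτ

/-- The chain rule for (y, z) ↦ (arg z, y, |z|²), with a local branch of the argument; the angle is
then set to 0 by invariance. -/
theorem cutParam_D_mem_iff {E : ∀ x : M, Submodule ℝ (TangentSpace (𝓡∂ n) x)}
    {E' : ∀ y : A.Cut, Submodule ℝ (TangentSpace (𝓡 n) y)} (hag : A.AgreesOnInterior E E')
    {V : Set M} (hV : τ.T ⊆ V) (hE : ∀ a, ∀ x ∈ V,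
      (E x).map (mfderiv (𝓡∂ n) (𝓡∂ n) (A.act a) x).toLinearMap = E (A.act a x))
    {v : SliceSpace n × ℂ} (hv : v ∈ τ.cutD) (h0 : v.2 ≠ 0) (u : SliceSpace n × ℂ) :
    (hA.cutParam hf hτ).D v u ∈ E' (A.c (τ.lift v)) ↔
      τ.coverD (0, (v.1, ‖v.2‖ ^ 2)) ((u.2 / v.2).im, (u.1, 2 * inner ℝ v.2 u.2)) ∈
        E (τ.cover (0, (v.1, ‖v.2‖ ^ 2))) := by
  obtain ⟨s, hs, hs', hsd⟩ := exists_contDiffAt_exp_eq h0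
  have hd := τ.sq_mem_Dp hv
  let χ : SliceSpace n × ℂ → ℝ × (SliceSpace n × ℝ) := fun v ↦ (s v.2, (v.1, ‖v.2‖ ^ 2))
  have hχ : HasFDerivWithinAt χ (((fderiv ℝ s v.2).comp (ContinuousLinearMap.snd ℝ _ ℂ)).prod
      ((ContinuousLinearMap.fst ℝ _ ℂ).prod
        ((2 • innerSL ℝ v.2).comp (ContinuousLinearMap.snd ℝ _ ℂ)))) τ.cutD v := by
    refine HasFDerivAt.hasFDerivWithinAt (HasFDerivAt.prodMk ?_ (HasFDerivAt.prodMk ?_ ?_))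
    · exact ((hs.differentiableAt (by simp)).hasFDerivAt).comp v hasFDerivAt_snd
    · exact hasFDerivAt_fst
    · exact (hasStrictFDerivAt_norm_sq v.2).hasFDerivAt.comp v hasFDerivAt_snd
  have hint : τ.cover (χ v) ∈ (𝓡∂ n).interior M := by
    rw [τ.cover_mem_interior_iff hd]
    exact pow_pos (norm_pos_iff.2 h0) 2
  have h1 := (τ.hasMFDerivWithinAt_cover (s := s v.2) hd).comp (f := χ) (s := τ.cutD) v
    hχ.hasMFDerivWithinAt fun y hy ↦ ⟨mem_univ _, τ.sq_mem_Dp hy⟩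
  have h2 := (hA.mdifferentiableAt_c hint).hasMFDerivAt.comp_hasMFDerivWithinAt v h1
  have hev : ∀ᶠ y in 𝓝 v, τ.lift y = τ.cover (χ y) := by
    filter_upwards [continuous_snd.continuousAt.preimage_mem_nhds
      (isOpen_compl_singleton.mem_nhds h0)] with y hy
    rw [lift, ← hs' _ hy]
    rfl
  have h3 := h2.congr_of_eventuallyEq (f₁ := fun y ↦ A.c (τ.lift y))
    (nhdsWithin_le_nhds (hev.mono fun y hy ↦ congrArg A.c hy)) (congrArg A.c hev.self_of_nhds)
  have h4 := ((hA.cutParam hf hτ).mdifferentiableWithinAt_ψ hv).hasMFDerivWithinAt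
  have h5 := DFunLike.congr_fun
    (((hA.cutParam hf hτ).uniqueDiffOn.uniqueMDiffOn v hv).eq h4 h3) u
  -- All tangent spaces are the same model space, and stating membership on it allows the base point
  -- to be replaced by an equal one.
  let P : A.Cut → EuclideanSpace ℝ (Fin n) → Prop := fun y z ↦
    (show TangentSpace (𝓡 n) y from z) ∈ E' y
  have key : ∀ y, y = A.c (τ.cover (χ v)) → ∀ z, P y z ↔ P (A.c (τ.cover (χ v))) z := by
    rintro _ rfl z
    rfl
  refine (key _ (congrArg A.c hev.self_of_nhds) _).trans ?_
  rw [← τ.coverD_mem_iff hV hE (s v.2) hd]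
  have h6 := mem_iff_of_agrees hag hint (τ.coverD (χ v)
    ((u.2 / v.2).im, (u.1, 2 * inner ℝ v.2 u.2)))
  refine Iff.trans (iff_of_eq ?_) h6
  refine congrArg (P (A.c (τ.cover (χ v)))) ?_
  refine h5.trans ?_
  have h7 : fderiv ℝ s v.2 u.2 = (u.2 / v.2).im := hsd u.2
  rw [← h7, two_mul, ← two_nsmul]
  rfl

end Cut
end Tube
end FreeCircleActionNearBoundary
end

/-! ### Normal form of a distribution near the boundary -/

noncomputable section

open Set Filter Topology VectorField

namespace FreeCircleActionNearBoundary

variable {n : ℕ} [NeZero n] {M : Type*} [TopologicalSpace M]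
  [ChartedSpace (EuclideanHalfSpace n) M] [IsManifold (𝓡∂ n) ∞ M]
  {A : FreeCircleActionNearBoundary n M}

/-- A nonnegative function that vanishes at a point has zero derivative in the directions that are
tangent to the boundary. -/
theorem mfderiv_eq_zero_of_mem_boundaryTangent {h : M → ℝ} {x : M}
    (hh : MDifferentiableAt (𝓡∂ n) 𝓘(ℝ, ℝ) h x) (h0 : h x = 0) (hpos : ∀ᶠ y in 𝓝 x, 0 ≤ h y)
    {b : EuclideanSpace ℝ (Fin n)} (hb : b ∈ boundaryTangent x) :
    mfderiv (𝓡∂ n) 𝓘(ℝ, ℝ) h x b = (0 : ℝ) := by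
  set p := extChartAt (𝓡∂ n) x x with hp
  have hb0 : b 0 = 0 := hb
  obtain ⟨L, hL⟩ : ∃ L : EuclideanSpace ℝ (Fin n) →L[ℝ] ℝ, L = mfderiv (𝓡∂ n) 𝓘(ℝ, ℝ) h x :=
    ⟨_, rfl⟩
  have h1 : HasFDerivWithinAt (h ∘ (extChartAt (𝓡∂ n) x).symm) L (range (𝓡∂ n)) p := by
    rw [hL]
    exact hh.hasMFDerivAt.2
  rw [← hL]
  change L b = 0
  have hmem : ∀ t : ℝ, p + t • b ∈ range (𝓡∂ n) := by
    intro t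
    have h2 : p ∈ range (𝓡∂ n) := mem_range_self _
    rw [range_modelWithCornersEuclideanHalfSpace] at h2 ⊢
    have h3 : 0 ≤ p 0 := h2
    change 0 ≤ (p + t • b) 0
    simpa [hb0] using h3
  have hline : HasDerivAt (fun t : ℝ ↦ p + t • b) b 0 := by
    simpa using ((hasDerivAt_id (0 : ℝ)).smul_const b).const_add p
  have hF : HasDerivAt (fun t : ℝ ↦ h ((extChartAt (𝓡∂ n) x).symm (p + t • b))) (L b) 0 := by
    have h2 : HasFDerivWithinAt (h ∘ (extChartAt (𝓡∂ n) x).symm) L (range (𝓡∂ n))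
        (p + (0 : ℝ) • b) := by simpa only [zero_smul, add_zero] using h1
    rw [← hasDerivWithinAt_univ]
    exact h2.comp_hasDerivWithinAt (0 : ℝ) hline.hasDerivWithinAt fun t _ ↦ hmem t
  refine IsLocalMin.hasDerivAt_eq_zero ?_ hF
  have h3 : Tendsto (fun t : ℝ ↦ p + t • b) (𝓝 0) (𝓝[range (𝓡∂ n)] p) := by
    refine tendsto_nhdsWithin_iff.2 ⟨?_, Eventually.of_forall hmem⟩
    simpa using hline.continuousAt.tendsto
  have h4 : Tendsto (extChartAt (𝓡∂ n) x).symm (𝓝[range (𝓡∂ n)] p) (𝓝 x) := by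
    have := (continuousAt_extChartAt_symm (I := 𝓡∂ n) x).tendsto
    rw [extChartAt_to_inv] at this
    exact this.mono_left nhdsWithin_le_nhds
  filter_upwards [(h4.comp h3).eventually hpos] with t ht
  simp only [zero_smul, add_zero, hp, extChartAt_to_inv, h0]
  exact ht

namespace Tube
variable (τ : A.Tube)

/-- The description of a distribution near the centre of a tube by a form. -/
structure BoundaryForm (E : ∀ x : M, Submodule ℝ (TangentSpace (𝓡∂ n) x)) {K : Type*}
    [NormedAddCommGroup K] [NormedSpace ℝ K] (ι : K →L[ℝ] SliceSpace n) (r : ℝ)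
    (β : SliceSpace n × ℝ → SliceSpace n →L[ℝ] K) (g k : SliceSpace n × ℝ → K) : Prop where
  pos : 0 < r
  ball_subset : Metric.ball 0 r ⊆ τ.D
  contDiffOn_β : ContDiffOn ℝ ∞ β (Metric.ball 0 r ∩ {d | 0 ≤ d.2})
  contDiffOn_g : ContDiffOn ℝ ∞ g (Metric.ball 0 r ∩ {d | 0 ≤ d.2})
  contDiffOn_k : ContDiffOn ℝ ∞ k (Metric.ball 0 r ∩ {d | 0 ≤ d.2})
  apply_ι : ∀ d ∈ Metric.ball 0 r ∩ {d : SliceSpace n × ℝ | 0 ≤ d.2}, ∀ κ, β d (ι κ) = κ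
  mem_iff : ∀ d ∈ Metric.ball 0 r ∩ {d : SliceSpace n × ℝ | 0 ≤ d.2}, ∀ u,
    τ.coverD (0, d) u ∈ E (τ.cover (0, d)) ↔
      u.1 • d.2 • g d + β d u.2.1 + u.2.2 • k d = 0

theorem coverD_orbit_mem {E : ∀ x : M, Submodule ℝ (TangentSpace (𝓡∂ n) x)}
    (h_orbit : A.ContainsOrbitTangents E) {d} (hd : d ∈ τ.Dp) (hd0 : d.2 = 0) :
    τ.coverD (0, d) (1, 0) ∈ E (τ.cover (0, d)) := by
  have hb : τ.σ d ∈ (𝓡∂ n).boundary M := (τ.σ_mem_boundary_iff d hd).2 hd0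
  have h1 := h_orbit _ hb (Circle.exp 0) (mfderiv 𝓘(ℝ, ℝ) (𝓡 1) Circle.exp 0 (1 : ℝ))
  have h2 : MDifferentiableAt (𝓡 1) (𝓡∂ n) (fun b ↦ A.act b (τ.σ d)) (Circle.exp 0) := by
    refine ContMDiffAt.mdifferentiableAt (n := ∞) ?_ (by simp)
    exact (A.contMDiffAt_act_prod (Circle.exp 0) (A.boundary_subset hb)).comp
      (f := fun b : Circle ↦ (b, τ.σ d)) (Circle.exp 0) (contMDiffAt_id.prodMk contMDiffAt_const)
  have h3 := h2.hasMFDerivAt.comp (0 : ℝ)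
    ((contMDiff_circleExp (m := ∞) 0).mdifferentiableAt (by simp)).hasMFDerivAt
  have h4 : HasMFDerivWithinAt 𝓘(ℝ, ℝ) 𝓘(ℝ, ℝ × (SliceSpace n × ℝ)) (fun s : ℝ ↦ (s, d)) univ 0
      (ContinuousLinearMap.inl ℝ ℝ (SliceSpace n × ℝ)) :=
    (hasFDerivAt_prodMk_left (0 : ℝ) d).hasMFDerivAt.hasMFDerivWithinAt
  have h0 : (univ : Set ℝ) ⊆ (fun s : ℝ ↦ (s, d)) ⁻¹' (univ ×ˢ τ.Dp) :=
    fun s _ ↦ ⟨mem_univ _, hd⟩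
  have h5 := (τ.hasMFDerivWithinAt_cover (s := 0) hd).comp (0 : ℝ) h4 h0
  have h6 := DFunLike.congr_fun (hasMFDerivAt_unique (hasMFDerivWithinAt_univ.1 h5) h3) (1 : ℝ)
  rw [← show _ = mfderiv (𝓡 1) (𝓡∂ n) (fun b ↦ A.act b (τ.σ d)) (Circle.exp 0)
    (mfderiv 𝓘(ℝ, ℝ) (𝓡 1) Circle.exp 0 (1 : ℝ)) from h6] at h1
  exact h1

/-- The transversal coordinate is minimal on the boundary, so its derivative kills boundary
tangents; subtracting a boundary tangent from ∂_t therefore leaves a vector of `E` with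
∂_t-component 1. -/
theorem exists_coverD_transverse {E : ∀ x : M, Submodule ℝ (TangentSpace (𝓡∂ n) x)}
    (h_trans : TransverseToBoundary E) :
    ∃ e : ℝ × (SliceSpace n × ℝ), τ.coverD 0 e ∈ E (τ.cover 0) ∧ e.2.2 = 1 := by
  have hb : τ.cover 0 ∈ (𝓡∂ n).boundary M := by
    rw [τ.cover_zero, τ.σ_mem_boundary_iff 0 τ.zero_mem_Dp]
    rfl
  have h1 : τ.coverD 0 (0, (0, 1)) ∈ E (τ.cover 0) ⊔ boundaryTangent (τ.cover 0) := by
    rw [h_trans _ hb]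
    trivial
  obtain ⟨e, he, b, hbt, heb⟩ := Submodule.mem_sup.1 h1
  have hinv := τ.boundaryParam.isInvertible_D τ.zero_mem_paramDomain
  rw [τ.boundaryParam_D τ.zero_mem_paramDomain] at hinv
  set b' := (τ.coverD 0).inverse b with hb'
  have hbb' : τ.coverD 0 b' = b := hinv.self_apply_inverse b
  have hT := τ.cover_mem_T 0 τ.zero_mem_Dp
  have hco : MDifferentiableAt (𝓡∂ n) 𝓘(ℝ, ℝ) (fun x ↦ (τ.co x).2) (τ.cover 0) :=
    (τ.contMDiffOn_co_snd.contMDiffAt (τ.isOpen_T.mem_nhds hT)).mdifferentiableAt (by simp)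
  have h2 := mfderiv_eq_zero_of_mem_boundaryTangent hco ((τ.mem_boundary_iff hT).1 hb) (by
    filter_upwards [τ.isOpen_T.mem_nhds hT] with y hy
    exact (τ.co_mem hy).2) hbt
  have h3 : b'.2.2 = 0 := by
    have h4 := hco.hasMFDerivAt.comp_hasMFDerivWithinAt 0
      (τ.hasMFDerivWithinAt_cover (s := 0) τ.zero_mem_Dp)
    have h5 : HasMFDerivWithinAt 𝓘(ℝ, ℝ × (SliceSpace n × ℝ)) 𝓘(ℝ, ℝ)
        (fun p : ℝ × (SliceSpace n × ℝ) ↦ p.2.2) (univ ×ˢ τ.Dp) 0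
        ((ContinuousLinearMap.snd ℝ _ ℝ).comp (ContinuousLinearMap.snd ℝ ℝ _)) :=
      ((ContinuousLinearMap.snd ℝ (SliceSpace n) ℝ).comp
        (ContinuousLinearMap.snd ℝ ℝ _)).hasFDerivAt.hasMFDerivAt.hasMFDerivWithinAt
    have h6 := h4.congr_of_eventuallyEq (f₁ := fun p : ℝ × (SliceSpace n × ℝ) ↦ p.2.2) (by
      filter_upwards [self_mem_nhdsWithin] with p hp
      exact congrArg Prod.snd (τ.co_act _ _ hp.2).symm)
      (congrArg Prod.snd (τ.co_act _ _ τ.zero_mem_Dp).symm)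
    have h7 := DFunLike.congr_fun
      ((τ.uniqueMDiffOn_cover 0 ⟨mem_univ _, τ.zero_mem_Dp⟩).eq h5 h6) b'
    refine h7.trans (Eq.trans ?_ h2)
    exact congrArg (mfderiv (𝓡∂ n) 𝓘(ℝ, ℝ) (fun x ↦ (τ.co x).2) (τ.cover 0)) hbb'
  refine ⟨(0, (0, 1)) - b', ?_, by simp [h3]⟩
  rw [map_sub, hbb', ← heb, add_sub_cancel_right]
  exact he

/-- At the centre `E` contains the orbit direction and a vector with ∂_t-component 1, so it has a
complement inside the slice directions. Along the wall the form vanishes on the orbit direction, and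
Hadamard's lemma divides that coefficient by t. -/
theorem exists_boundaryForm {E : ∀ x : M, Submodule ℝ (TangentSpace (𝓡∂ n) x)}
    (hE : IsDistribution (𝓡∂ n) E) (h_orbit : A.ContainsOrbitTangents E)
    (h_trans : TransverseToBoundary E) :
    ∃ (K : Submodule ℝ (SliceSpace n)) (r : ℝ) (β : SliceSpace n × ℝ → SliceSpace n →L[ℝ] K)
      (g k : SliceSpace n × ℝ → K), τ.BoundaryForm E K.subtypeL r β g k := by
  set S := (E (τ.cover 0)).comap (τ.coverD 0).toLinearMap with hS
  obtain ⟨e, he, he1⟩ := τ.exists_coverD_transverse h_trans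
  replace he : e ∈ S := he
  have h1 : ((1, 0) : ℝ × (SliceSpace n × ℝ)) ∈ S := τ.coverD_orbit_mem h_orbit τ.zero_mem_Dp rfl
  let j : SliceSpace n →L[ℝ] ℝ × (SliceSpace n × ℝ) :=
    (ContinuousLinearMap.inr ℝ ℝ _).comp (ContinuousLinearMap.inl ℝ _ ℝ)
  obtain ⟨K, hK⟩ := Submodule.exists_isCompl (S.comap j.toLinearMap)
  have hc : IsCompl S (LinearMap.range (j.comp K.subtypeL).toLinearMap) := by
    constructor
    · rw [Submodule.disjoint_def]
      rintro _ hx ⟨κ, rfl⟩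
      have := (Submodule.disjoint_def.1 hK.disjoint) κ hx κ.2
      change j κ = 0
      rw [this, map_zero]
    · rw [codisjoint_iff, eq_top_iff]
      rintro ⟨t, η, s⟩ -
      obtain ⟨y, hy, κ, hκ, hyκ⟩ := Submodule.mem_sup.1
        (show η - s • e.2.1 ∈ S.comap j.toLinearMap ⊔ K by rw [hK.sup_eq_top]; trivial)
      refine Submodule.mem_sup.2 ⟨s • e + ((t - s * e.1) • (1, 0) + j y),
        S.add_mem (S.smul_mem _ he) (S.add_mem (S.smul_mem _ h1) hy), j κ, ⟨⟨κ, hκ⟩, rfl⟩, ?_⟩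
      refine Prod.ext ?_ (Prod.ext ?_ ?_)
      · simp [j]
      · simp only [j, Prod.snd_add, Prod.fst_add, Prod.smul_snd, Prod.smul_fst,
          ContinuousLinearMap.comp_apply, ContinuousLinearMap.inr_apply,
          ContinuousLinearMap.inl_apply, smul_zero, zero_add, add_assoc, hyκ]
        abel
      · simp [j, he1]
  have hc' := hc
  have hD0 : S = (E (τ.boundaryParam.ψ 0)).comap (τ.boundaryParam.D 0).toLinearMap := by
    rw [τ.boundaryParam_D τ.zero_mem_paramDomain]
    rfl
  rw [hD0] at hc'
  obtain ⟨O', hO', α, h0O', hα⟩ := LocalParam.exists_hasForm_restrict hE τ.zero_mem_paramDomain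
    (fun a b hab ↦ by simpa [j] using hab) hc'
  have hcont : Continuous fun d : SliceSpace n × ℝ ↦ ((0 : ℝ), d) := by fun_prop
  obtain ⟨r, hr, hball⟩ := Metric.isOpen_iff.1 (τ.isOpen_D.inter (hO'.preimage hcont)) 0
    ⟨τ.zero_mem, h0O'⟩
  have hmem : ∀ d ∈ Metric.ball 0 r ∩ {d : SliceSpace n × ℝ | 0 ≤ d.2},
      ((0 : ℝ), d) ∈ (τ.boundaryParam.restrict hO').S := fun d hd ↦
    ⟨⟨⟨mem_univ _, (hball hd.1).1, hd.2⟩, ⟨⟨by simp [Real.pi_pos], by simp [Real.pi_pos]⟩,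
      mem_univ _⟩⟩, (hball hd.1).2⟩
  have hα0 : ContDiffOn ℝ ∞ (fun d ↦ α (0, d)) (Metric.ball 0 r ∩ {d | 0 ≤ d.2}) :=
    hα.isForm.contDiffOn.comp (contDiff_prodMk_right (0 : ℝ)).contDiffOn hmem
  have hiff : ∀ d ∈ Metric.ball 0 r ∩ {d : SliceSpace n × ℝ | 0 ≤ d.2}, ∀ u,
      τ.coverD (0, d) u ∈ E (τ.cover (0, d)) ↔ α (0, d) u = 0 := by
    intro d hd u
    have := hα.mem_iff _ (hmem d hd) u
    rwa [LocalParam.restrict_D _ _ (hmem d hd).2, τ.boundaryParam_D (hmem d hd).1] at this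
  have hproj : ∀ d ∈ Metric.ball (0 : SliceSpace n × ℝ) r, 0 ≤ d.2 →
      (d.1, (0 : ℝ)) ∈ Metric.ball (0 : SliceSpace n × ℝ) r := by
    intro d hd _
    rw [mem_ball_zero_iff] at hd ⊢
    refine lt_of_le_of_lt ?_ hd
    simp [Prod.norm_def]
  obtain ⟨g, hg, hgα, -⟩ := exists_contDiffOn_eq_smul_of_vanishing Metric.isOpen_ball
    (convex_ball (0 : SliceSpace n × ℝ) r) hproj
    (f := fun d ↦ α (0, d) (1, 0)) (hα0.clm_apply contDiffOn_const) fun d hd hd0 ↦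
      (hiff d ⟨hd, hd0.ge⟩ _).1 (τ.coverD_orbit_mem h_orbit ⟨(hball hd).1, hd0.ge⟩ hd0)
  refine ⟨K, r, fun d ↦ (α (0, d)).comp j, g, fun d ↦ α (0, d) (0, (0, 1)), hr,
    fun d hd ↦ (hball hd).1, hα0.clm_comp contDiffOn_const, hg, hα0.clm_apply contDiffOn_const,
    fun d hd κ ↦ hα.isForm.apply_ι _ (hmem d hd) κ, fun d hd u ↦ (hiff d hd u).trans ?_⟩
  have h2 : u = u.1 • (1, 0) + j u.2.1 + u.2.2 • (0, (0, 1)) := by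
    refine Prod.ext ?_ (Prod.ext ?_ ?_) <;> simp [j]
  have h3 : α (0, d) u = u.1 • d.2 • g d + α (0, d) (j u.2.1) + u.2.2 • α (0, d) (0, (0, 1)) := by
    rw [← hgα d hd]
    conv_lhs => rw [h2]
    simp only [map_add, map_smul]
  rw [h3]
  rfl

end Tube
end FreeCircleActionNearBoundary
end

/-! ### Combined forms, the linear algebra of non-degeneracy, and density -/

noncomputable section

open Set Filter Topology VectorField

section CombinedForm
variable {F Z Y K : Type*} [NormedAddCommGroup F] [NormedSpace ℝ F] [NormedAddCommGroup Z]
  [NormedSpace ℝ Z] [NormedAddCommGroup Y] [NormedSpace ℝ Y] [NormedAddCommGroup K]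
  [NormedSpace ℝ K]

/-- The form with values in `K` that is built from two real forms `φ`, `ψ` and the pull-backs
of `β`, `g` and `k` by a map `d`. -/
def combinedForm (d : F → Z) (q : F →L[ℝ] Y) (φ ψ : F → F →L[ℝ] ℝ) (β : Z → Y →L[ℝ] K)
    (g k : Z → K) (v : F) : F →L[ℝ] K :=
  (φ v).smulRight (g (d v)) + (β (d v)).comp q + (ψ v).smulRight (k (d v))

variable {d : F → Z} {q : F →L[ℝ] Y} {φ ψ : F → F →L[ℝ] ℝ} {β : Z → Y →L[ℝ] K} {g k : Z → K}
  {S : Set F} {R : Set Z}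

theorem contDiffOn_combinedForm (hd : ContDiffOn ℝ ∞ d S) (hS : MapsTo d S R)
    (hφ : ContDiffOn ℝ ∞ φ S) (hψ : ContDiffOn ℝ ∞ ψ S) (hβ : ContDiffOn ℝ ∞ β R)
    (hg : ContDiffOn ℝ ∞ g R) (hk : ContDiffOn ℝ ∞ k R) :
    ContDiffOn ℝ ∞ (combinedForm d q φ ψ β g k) S :=
  ((hφ.smulRight (hg.comp hd hS)).add ((hβ.comp hd hS).clm_comp contDiffOn_const)).add
    (hψ.smulRight (hk.comp hd hS))

theorem fderivWithin_combinedForm (hS : UniqueDiffOn ℝ S) (hR : MapsTo d S R) {v : F} (hv : v ∈ S)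
    {w : F} {d' : F →L[ℝ] Z} {φ' ψ' : F →L[ℝ] ℝ} (hd : HasFDerivWithinAt d d' S v)
    (hφ : HasFDerivWithinAt (fun v ↦ φ v w) φ' S v) (hψ : HasFDerivWithinAt (fun v ↦ ψ v w) ψ' S v)
    (hα : DifferentiableWithinAt ℝ (combinedForm d q φ ψ β g k) S v)
    (hβ : DifferentiableWithinAt ℝ β R (d v)) (hg : DifferentiableWithinAt ℝ g R (d v))
    (hk : DifferentiableWithinAt ℝ k R (d v)) (u : F) :
    fderivWithin ℝ (combinedForm d q φ ψ β g k) S v u w =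
      (φ' u • g (d v) + φ v w • fderivWithin ℝ g R (d v) (d' u)) +
        fderivWithin ℝ β R (d v) (d' u) (q w) +
        (ψ' u • k (d v) + ψ v w • fderivWithin ℝ k R (d v) (d' u)) := by
  have h1 := hα.hasFDerivWithinAt.clm_apply (hasFDerivWithinAt_const w v S)
  have h2 := ((hφ.smul (hg.hasFDerivWithinAt.comp v hd hR)).add
    ((hβ.hasFDerivWithinAt.comp v hd hR).clm_apply (hasFDerivWithinAt_const (q w) v S))).add
    (hψ.smul (hk.hasFDerivWithinAt.comp v hd hR))
  have h3 := DFunLike.congr_fun ((hS v hv).eq h1 h2) u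
  simp only [_root_.add_apply, ContinuousLinearMap.comp_apply,
    ContinuousLinearMap.flip_apply, _root_.zero_apply, map_zero, zero_add,
    _root_.smul_apply, ContinuousLinearMap.smulRight_apply, Function.comp_apply] at h3
  rw [h3]
  abel

end CombinedForm

section LinearAlgebra
variable {Y K : Type*} [NormedAddCommGroup Y] [NormedSpace ℝ Y] [NormedAddCommGroup K]
  [NormedSpace ℝ K] {β : Y →L[ℝ] K} {ι : K →L[ℝ] Y} {b : Y × ℝ →L[ℝ] Y →L[ℝ] K} {g k : K}
  {k' : Y × ℝ →L[ℝ] K}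

variable (β b) in
/-- The exterior derivative `b` is non-degenerate on the kernel of the form `β`. -/
def NondegenerateOnKer : Prop :=
  ∀ η, β η = 0 → (∀ η', β η' = 0 → b (η, 0) η' - b (η', 0) η = 0) → η = 0

/-- The pairing is block diagonal: on ℂ it is `g` times twice the area form, and on ker β it is the
alternation of `b`. The vector (0, iz) detects z. -/
theorem nondegenerate_cut_iff :
    (∀ u : Y × ℂ, β u.1 = 0 → (∀ w : Y × ℂ, β w.1 = 0 →
      (inner ℝ (Complex.I * u.2) w.2 • g + b (u.1, 0) w.1) -
        (inner ℝ (Complex.I * w.2) u.2 • g + b (w.1, 0) u.1) = 0) → u = 0) ↔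
      g ≠ 0 ∧ NondegenerateOnKer β b := by
  constructor
  · intro h
    refine ⟨?_, fun η hη hη' ↦ ?_⟩
    · rintro rfl
      have h1 := h (0, 1) (by simp) fun w _ ↦ by simp [Prod.mk_zero_zero]
      simp at h1
    · have h1 := h (η, 0) hη fun w hw ↦ by
        simpa using hη' w.1 hw
      exact congrArg Prod.fst h1
  · rintro ⟨hg, hN⟩ ⟨η, z⟩ hu h
    have h1 := h (0, Complex.I * z) (by simp)
    have h2 : z = 0 := by
      have h3 : inner ℝ (Complex.I * z) (Complex.I * z) -
          inner ℝ (Complex.I * (Complex.I * z)) z = 2 * ‖z‖ ^ 2 := by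
        rw [← mul_assoc, Complex.I_mul_I, neg_one_mul, inner_neg_left, real_inner_self_eq_norm_sq,
          real_inner_self_eq_norm_sq, norm_mul, Complex.norm_I]
        ring
      simp only [Prod.mk_zero_zero, map_zero, _root_.zero_apply, add_zero,
        ← sub_smul] at h1
      rw [h3, smul_eq_zero] at h1
      simpa [hg] using h1
    subst h2
    rw [hN η hu fun η' hη' ↦ by simpa using h (η', 0) hη']
    rfl

/-- The kernel is spanned by the orbit vector, ker β and the transverse vector (−ιk, 1). The orbit
vector pairs only with vectors having a transverse component s, with value −s·g. -/
theorem nondegenerate_boundary_iff (hβ : ∀ κ, β (ι κ) = κ) (hK : Module.finrank ℝ K = 1) :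
    (∀ u : ℝ × (Y × ℝ), β u.2.1 + u.2.2 • k = 0 → (∀ w : ℝ × (Y × ℝ), β w.2.1 + w.2.2 • k = 0 →
      ((w.1 * u.2.2) • g + b u.2 w.2.1 + w.2.2 • k' u.2) -
        ((u.1 * w.2.2) • g + b w.2 u.2.1 + u.2.2 • k' w.2) = 0) → u = 0) ↔
      g ≠ 0 ∧ NondegenerateOnKer β b := by
  constructor
  · intro h
    have hg : g ≠ 0 := by
      rintro rfl
      have h1 := h (1, 0) (by simp) fun w _ ↦ by simp
      simp at h1
    refine ⟨hg, fun η hη hη' ↦ ?_⟩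
    -- As `K` is a line spanned by `g`, a multiple `t` of the orbit vector can be added to `η` to
    -- cancel its pairing with (−ιk, 1).
    obtain ⟨t, ht⟩ := (finrank_eq_one_iff_of_nonzero' g hg).1 hK
      (b (η, 0) (-ι k) - b (-ι k, 1) η + k' (η, 0))
    have h1 := h (t, (η, 0)) (by simpa using hη) fun w hw ↦ by
      have hw' : β (w.2.1 + w.2.2 • ι k) = 0 := by
        rw [map_add, map_smul, hβ, hw]
      have h2 := hη' _ hw'
      have h3 : w.2 = (w.2.1 + w.2.2 • ι k, 0) + w.2.2 • (-ι k, 1) := by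
        refine Prod.ext ?_ ?_ <;> simp
      have h4 : w.2.1 = (w.2.1 + w.2.2 • ι k) + w.2.2 • (-ι k) := by simp
      generalize w.2.1 + w.2.2 • ι k = η' at h2 h3 h4
      have h5 : b w.2 η = b (η', 0) η + w.2.2 • b (-ι k, 1) η := by
        conv_lhs => rw [h3, map_add, map_smul]
        rfl
      have h6 : b (η, 0) w.2.1 = b (η, 0) η' + w.2.2 • b (η, 0) (-ι k) := by
        rw [h4, map_add, map_smul]
      simp only [mul_zero, zero_smul, zero_add, add_zero]
      rw [h5, h6, sub_eq_zero.1 h2, mul_comm, mul_smul, ht]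
      module
    exact congrArg (fun u : ℝ × (Y × ℝ) ↦ u.2.1) h1
  · rintro ⟨hg, hN⟩ ⟨t, η, s⟩ hu h
    have h1 := h (1, 0) (by simp)
    have hs : s = 0 := by
      simpa [Prod.mk_zero_zero, hg] using h1
    subst hs
    have h2 := hN η (by simpa using hu) fun η' hη' ↦ by
      simpa using h (0, (η', 0)) (by simpa using hη')
    subst h2
    have h3 := h (0, (-ι k, 1)) (by simp [hβ])
    have h4 : t = 0 := by
      simpa [Prod.mk_zero_zero, hg] using h3
    rw [h4]
    rfl

end LinearAlgebra

section Density
variable {V H : Type*} [NormedAddCommGroup V] [NormedSpace ℝ V] [TopologicalSpace H]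
  {I : ModelWithCorners ℝ V H} {N : Type*} [TopologicalSpace N] [ChartedSpace H N]
  [IsManifold I ∞ N] {F : Type*} [NormedAddCommGroup F] [NormedSpace ℝ F] (P : LocalParam I N F)

theorem LocalParam.HasForm.distributionClosure_eq [FiniteDimensional ℝ F] [CompleteSpace V]
    {K : Type*} [NormedAddCommGroup K] [NormedSpace ℝ K] {ι : K →L[ℝ] F} {α : F → F →L[ℝ] K}
    {P : LocalParam I N F} {E : ∀ x : N, Submodule ℝ (TangentSpace I x)} (h : P.HasForm ι α E)
    {Q : Set N} (hQ : ∀ v ∈ P.S, v ∈ closure {v' ∈ P.S | P.ψ v' ∈ Q}) {v : F} (hv : v ∈ P.S) :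
    distributionClosure I E Q (P.ψ v) = E (P.ψ v) := by
  have h1 := P.hasForm_distributionClosure (E := E) h.isForm hQ fun w hw _ u ↦ h.mem_iff w hw u
  ext y
  obtain ⟨u, rfl⟩ : ∃ u, P.D v u = y := ⟨_, (P.isInvertible_D hv).self_apply_inverse y⟩
  exact (h1.mem_iff v hv u).trans (h.mem_iff v hv u).symm

theorem LocalParam.mem_closure_restrict {Q : Set N}
    (hQ : ∀ v ∈ P.S, v ∈ closure {v' ∈ P.S | P.ψ v' ∈ Q}) {O' : Set F} (hO' : IsOpen O') :
    ∀ v ∈ (P.restrict hO').S,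
      v ∈ closure {v' ∈ (P.restrict hO').S | (P.restrict hO').ψ v' ∈ Q} := by
  rintro w ⟨hw, hw'⟩
  refine closure_mono ?_ (hO'.inter_closure ⟨hw', hQ w hw⟩)
  rintro z ⟨hz, hz', hz''⟩
  exact ⟨⟨hz', hz⟩, hz''⟩

/-- A distribution is determined by its values on a dense set. -/
theorem LocalParam.distributionClosure_eq [FiniteDimensional ℝ F] [CompleteSpace V]
    {E : ∀ x : N, Submodule ℝ (TangentSpace I x)} (hE : IsDistribution I E) {Q : Set N}
    (hQ : ∀ v ∈ P.S, v ∈ closure {v' ∈ P.S | P.ψ v' ∈ Q}) {v : F} (hv : v ∈ P.S) :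
    distributionClosure I E Q (P.ψ v) = E (P.ψ v) := by
  obtain ⟨K, hK⟩ := Submodule.exists_isCompl ((E (P.ψ v)).comap (P.D v).toLinearMap)
  have hK' : IsCompl ((E (P.ψ v)).comap (P.D v).toLinearMap)
      (LinearMap.range K.subtypeL.toLinearMap) := by
    have : LinearMap.range K.subtypeL.toLinearMap = K := Submodule.range_subtype K
    rwa [this]
  obtain ⟨O', hO', α, hvO, hα⟩ := P.exists_hasForm_restrict hE hv Subtype.val_injective hK'
  exact hα.distributionClosure_eq (P.mem_closure_restrict hQ hO')
    (show v ∈ (P.restrict hO').S from ⟨hv, hvO⟩)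

end Density
end

/-! ### The form on the manifold and the form on the cut space -/

noncomputable section

open Set Filter Topology VectorField

namespace FreeCircleActionNearBoundary

variable {n : ℕ} [NeZero n] {M : Type*} [TopologicalSpace M]
  [ChartedSpace (EuclideanHalfSpace n) M] [IsManifold (𝓡∂ n) ∞ M]
  {A : FreeCircleActionNearBoundary n M}

namespace Tube.BoundaryForm
variable {τ : A.Tube} {E : ∀ x : M, Submodule ℝ (TangentSpace (𝓡∂ n) x)} {K : Type*}
  [NormedAddCommGroup K] [NormedSpace ℝ K] {ι : K →L[ℝ] SliceSpace n} {r : ℝ}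
  {β : SliceSpace n × ℝ → SliceSpace n →L[ℝ] K} {g k : SliceSpace n × ℝ → K}

theorem isOpen_preimage_snd (r : ℝ) :
    IsOpen ((Prod.snd : ℝ × (SliceSpace n × ℝ) → _) ⁻¹' Metric.ball 0 r) :=
  Metric.isOpen_ball.preimage continuous_snd

theorem isOpen_preimage_sq (r : ℝ) :
    IsOpen ((fun v : SliceSpace n × ℂ ↦ (v.1, ‖v.2‖ ^ 2)) ⁻¹' Metric.ball 0 r) :=
  Metric.isOpen_ball.preimage contDiff_sq.continuous

variable (β g k) in
/-- The form on the manifold. -/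
def form : ℝ × (SliceSpace n × ℝ) → ℝ × (SliceSpace n × ℝ) →L[ℝ] K :=
  combinedForm Prod.snd ((ContinuousLinearMap.fst ℝ _ ℝ).comp (ContinuousLinearMap.snd ℝ ℝ _))
    (fun p ↦ p.2.2 • ContinuousLinearMap.fst ℝ ℝ _)
    (fun _ ↦ (ContinuousLinearMap.snd ℝ _ ℝ).comp (ContinuousLinearMap.snd ℝ ℝ _)) β g k

variable (β g k) in
/-- The form on the cut space. -/
def cutForm : SliceSpace n × ℂ → SliceSpace n × ℂ →L[ℝ] K :=
  combinedForm (fun v ↦ (v.1, ‖v.2‖ ^ 2)) (ContinuousLinearMap.fst ℝ _ ℂ)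
    (fun v ↦ (innerSL ℝ (Complex.I * v.2)).comp (ContinuousLinearMap.snd ℝ _ ℂ))
    (fun v ↦ (2 : ℝ) • (innerSL ℝ v.2).comp (ContinuousLinearMap.snd ℝ _ ℂ)) β g k

theorem form_apply (p u) : form β g k p u =
    (p.2.2 * u.1) • g p.2 + β p.2 u.2.1 + u.2.2 • k p.2 := rfl

theorem cutForm_apply (v u) : cutForm β g k v u =
    inner ℝ (Complex.I * v.2) u.2 • g (v.1, ‖v.2‖ ^ 2) + β (v.1, ‖v.2‖ ^ 2) u.1 +
      (2 * inner ℝ v.2 u.2) • k (v.1, ‖v.2‖ ^ 2) := rfl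

variable (ι) in
/-- The right inverse of `form`. -/
def formι : K →L[ℝ] ℝ × (SliceSpace n × ℝ) :=
  ((ContinuousLinearMap.inr ℝ ℝ _).comp (ContinuousLinearMap.inl ℝ _ ℝ)).comp ι

variable (ι) in
/-- The right inverse of `cutForm`. -/
def cutFormι : K →L[ℝ] SliceSpace n × ℂ := (ContinuousLinearMap.inl ℝ _ ℂ).comp ι

variable (τ) in
theorem mapsTo_snd (r : ℝ) : MapsTo Prod.snd (τ.boundaryParam.restrict (isOpen_preimage_snd r)).S
    (Metric.ball 0 r ∩ {d : SliceSpace n × ℝ | 0 ≤ d.2}) :=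
  fun _ hp ↦ ⟨hp.2, hp.1.1.2.2⟩

theorem mapsTo_sq (r : ℝ) : MapsTo (fun v : SliceSpace n × ℂ ↦ (v.1, ‖v.2‖ ^ 2))
    ((fun v : SliceSpace n × ℂ ↦ (v.1, ‖v.2‖ ^ 2)) ⁻¹' Metric.ball 0 r)
    (Metric.ball 0 r ∩ {d : SliceSpace n × ℝ | 0 ≤ d.2}) :=
  fun v hv ↦ ⟨hv, sq_nonneg ‖v.2‖⟩

variable (B : τ.BoundaryForm E ι r β g k)
include B

theorem isForm_form :
    IsForm (τ.boundaryParam.restrict (isOpen_preimage_snd r)).S (formι ι) (form β g k) := by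
  refine ⟨contDiffOn_combinedForm contDiff_snd.contDiffOn (mapsTo_snd τ r) ?_ contDiffOn_const
    B.contDiffOn_β B.contDiffOn_g B.contDiffOn_k, fun p hp κ ↦ ?_⟩
  · exact (contDiff_snd.comp contDiff_snd).contDiffOn.smul contDiffOn_const
  · rw [form_apply]
    simp [formι, B.apply_ι _ (mapsTo_snd τ r hp)]

theorem isForm_cutForm : IsForm ((fun v : SliceSpace n × ℂ ↦ (v.1, ‖v.2‖ ^ 2)) ⁻¹'
    Metric.ball 0 r) (cutFormι ι) (cutForm β g k) := by
  refine ⟨contDiffOn_combinedForm contDiff_sq.contDiffOn (mapsTo_sq r) ?_ ?_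
    B.contDiffOn_β B.contDiffOn_g B.contDiffOn_k, fun p hp κ ↦ ?_⟩
  · have h1 : ContDiff ℝ ∞ fun v : SliceSpace n × ℂ ↦ Complex.I * v.2 :=
      contDiff_const.mul contDiff_snd
    exact (((innerSL ℝ (E := ℂ)).contDiff.comp h1).clm_comp contDiff_const).contDiffOn
  · have h1 : ContDiff ℝ ∞ fun v : SliceSpace n × ℂ ↦ innerSL ℝ v.2 :=
      (innerSL ℝ (E := ℂ)).contDiff.comp contDiff_snd
    exact ((h1.clm_comp contDiff_const).const_smul (2 : ℝ)).contDiffOn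
  · rw [cutForm_apply]
    simp [cutFormι, B.apply_ι _ (mapsTo_sq r hp)]

variable {V : Set M} (hV : τ.T ⊆ V) (hE : ∀ a, ∀ x ∈ V,
      (E x).map (mfderiv (𝓡∂ n) (𝓡∂ n) (A.act a) x).toLinearMap = E (A.act a x))
include hV hE

theorem hasForm : (τ.boundaryParam.restrict (isOpen_preimage_snd r)).HasForm (formι ι)
    (form β g k) E := by
  refine ⟨B.isForm_form, fun p hp u ↦ ?_⟩
  have hD : (τ.boundaryParam.restrict (isOpen_preimage_snd r)).D p = τ.coverD p :=
    (LocalParam.restrict_D _ _ hp.2).trans (τ.boundaryParam_D hp.1)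
  have h1 := τ.coverD_mem_iff hV hE p.1 hp.1.1.2 u
  have h2 := B.mem_iff p.2 (mapsTo_snd τ r hp) u
  rw [smul_smul, mul_comm u.1] at h2
  rw [hD]
  exact h1.trans h2

section Cut
variable [T2Space M] [SecondCountableTopology M]
  [ChartedSpace (EuclideanSpace ℝ (Fin n)) A.Cut] [IsManifold (𝓡 n) ∞ A.Cut]
  (hA : A.IsCutStructure) {f : M → ℝ} (hf : A.IsInvariantBoundaryDefining f) {γ}
  (hτ : τ.IsFactor f γ)
include hA hf hτ

omit B hV hE in
theorem cutParam_mem_closure : ∀ v ∈ (hA.cutParam hf hτ).S, v ∈ closure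
    {v' ∈ (hA.cutParam hf hτ).S | (hA.cutParam hf hτ).ψ v' ∈ A.c '' (𝓡∂ n).interior M} := by
  intro v hv
  have h1 : Dense {v : SliceSpace n × ℂ | v.2 ≠ 0} := by
    have : {v : SliceSpace n × ℂ | v.2 ≠ 0} = univ ×ˢ {0}ᶜ := by ext; simp
    rw [this]
    exact dense_univ.prod (dense_compl_singleton (0 : ℂ))
  refine closure_mono ?_ (τ.isOpen_cutD.inter_closure ⟨hv, h1 v⟩)
  rintro w ⟨hw, hw0⟩
  exact ⟨hw, mem_image_of_mem _ ((τ.lift_mem_interior_iff hw).2 hw0)⟩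

/-- The same coefficients describe both distributions, and the form on the cut space is smooth at z
= 0. This makes the closure of the distribution given over the interior a kernel there as well. -/
theorem hasForm_cut {E' : ∀ y : A.Cut, Submodule ℝ (TangentSpace (𝓡 n) y)}
    (hag : A.AgreesOnInterior E E') :
    ((hA.cutParam hf hτ).restrict (isOpen_preimage_sq r)).HasForm (cutFormι ι) (cutForm β g k)
      (distributionClosure (𝓡 n) E' (A.c '' (𝓡∂ n).interior M)) := by
  refine LocalParam.hasForm_distributionClosure (B.isForm_cutForm.mono inter_subset_right)
    (LocalParam.mem_closure_restrict _ (cutParam_mem_closure hA hf hτ) _) ?_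
  rintro v hv ⟨x, hx, hxv⟩ u
  have h1 : τ.lift v ∈ (𝓡∂ n).interior M := by
    rw [← A.eq_of_c_eq_of_interior hx hxv]
    exact hx
  have h0 : v.2 ≠ 0 := (τ.lift_mem_interior_iff hv.1).1 h1
  rw [LocalParam.restrict_D _ _ hv.2]
  refine (τ.cutParam_D_mem_iff hA hf hτ hag hV hE hv.1 h0 u).trans
    ((B.mem_iff _ (mapsTo_sq r hv.2) _).trans ?_)
  -- This is |z|² dθ = ⟨iz, dz⟩: the factor t supplied by Hadamard's lemma removes the singularity
  -- of dθ.
  have h2 : (u.2 / v.2).im * ‖v.2‖ ^ 2 = inner ℝ (Complex.I * v.2) u.2 := by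
    have : ‖v.2‖ ^ 2 ≠ 0 := pow_ne_zero 2 (norm_ne_zero_iff.2 h0)
    rw [Complex.div_im, Complex.normSq_eq_norm_sq, Complex.inner]
    field_simp
    simp
  rw [cutForm_apply, smul_smul, h2]

end Cut

end Tube.BoundaryForm
end FreeCircleActionNearBoundary
end

/-! ### Non-degeneracy at the boundary -/

noncomputable section

open Set Filter Topology VectorField

namespace FreeCircleActionNearBoundary

variable {n : ℕ} [NeZero n] {M : Type*} [TopologicalSpace M]
  [ChartedSpace (EuclideanHalfSpace n) M] [IsManifold (𝓡∂ n) ∞ M]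
  {A : FreeCircleActionNearBoundary n M}

namespace Tube.BoundaryForm
variable {τ : A.Tube} {E : ∀ x : M, Submodule ℝ (TangentSpace (𝓡∂ n) x)} {K : Type*}
  [NormedAddCommGroup K] [NormedSpace ℝ K] {ι : K →L[ℝ] SliceSpace n} {r : ℝ}
  {β : SliceSpace n × ℝ → SliceSpace n →L[ℝ] K} {g k : SliceSpace n × ℝ → K}
  (B : τ.BoundaryForm E ι r β g k)
include B

theorem zero_mem_ball : (0 : SliceSpace n × ℝ) ∈ Metric.ball 0 r ∩ {d : SliceSpace n × ℝ | 0 ≤ d.2} :=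
  ⟨Metric.mem_ball_self B.pos, le_refl (0 : ℝ)⟩

theorem zero_mem_S : (0 : ℝ × (SliceSpace n × ℝ)) ∈
    (τ.boundaryParam.restrict (isOpen_preimage_snd r)).S :=
  ⟨τ.zero_mem_paramDomain, B.zero_mem_ball.1⟩

theorem zero_mem_cut : (0 : SliceSpace n × ℂ) ∈
    τ.cutD ∩ (fun v : SliceSpace n × ℂ ↦ (v.1, ‖v.2‖ ^ 2)) ⁻¹' Metric.ball 0 r := by
  have h1 : (((0 : SliceSpace n × ℂ).1, ‖(0 : SliceSpace n × ℂ).2‖ ^ 2) : SliceSpace n × ℝ) = 0 := by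
    simp
  refine ⟨?_, ?_⟩
  · change _ ∈ τ.D
    rw [h1]
    exact τ.zero_mem
  · rw [mem_preimage, h1]
    exact B.zero_mem_ball.1

/-- At the centre t = 0, so t dθ contributes only through its own derivative and the derivative of
`g` drops out. -/
theorem dForm_form (u w : ℝ × (SliceSpace n × ℝ)) :
    dForm (form β g k) (τ.boundaryParam.restrict (isOpen_preimage_snd r)).S 0 u w =
      ((w.1 * u.2.2) • g 0 +
        fderivWithin ℝ β (Metric.ball 0 r ∩ {d | 0 ≤ d.2}) 0 u.2 w.2.1 +
        w.2.2 • fderivWithin ℝ k (Metric.ball 0 r ∩ {d | 0 ≤ d.2}) 0 u.2) -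
      ((u.1 * w.2.2) • g 0 +
        fderivWithin ℝ β (Metric.ball 0 r ∩ {d | 0 ≤ d.2}) 0 w.2 u.2.1 +
        u.2.2 • fderivWithin ℝ k (Metric.ball 0 r ∩ {d | 0 ≤ d.2}) 0 w.2) := by
  have key : ∀ u w : ℝ × (SliceSpace n × ℝ),
      fderivWithin ℝ (form β g k) (τ.boundaryParam.restrict (isOpen_preimage_snd r)).S 0 u w =
      (w.1 * u.2.2) • g 0 +
        fderivWithin ℝ β (Metric.ball 0 r ∩ {d | 0 ≤ d.2}) 0 u.2 w.2.1 +
        w.2.2 • fderivWithin ℝ k (Metric.ball 0 r ∩ {d | 0 ≤ d.2}) 0 u.2 := by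
    intro u w
    have hφ : HasFDerivWithinAt (fun p : ℝ × (SliceSpace n × ℝ) ↦
        (p.2.2 • ContinuousLinearMap.fst ℝ ℝ (SliceSpace n × ℝ)) w)
        (w.1 • (ContinuousLinearMap.snd ℝ (SliceSpace n) ℝ).comp (ContinuousLinearMap.snd ℝ ℝ _))
        (τ.boundaryParam.restrict (isOpen_preimage_snd r)).S 0 := by
      refine (ContinuousLinearMap.hasFDerivWithinAt _).congr_of_eventuallyEq
        (Eventually.of_forall fun p ↦ ?_) ?_ <;> simp [mul_comm]
    have h1 := fderivWithin_combinedForm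
      (τ.boundaryParam.restrict (isOpen_preimage_snd r)).uniqueDiffOn (mapsTo_snd τ r) B.zero_mem_S
      (w := w) (d' := ContinuousLinearMap.snd ℝ ℝ _) hasFDerivWithinAt_snd hφ
      (hasFDerivWithinAt_const _ _ _)
      ((B.isForm_form.contDiffOn _ B.zero_mem_S).differentiableWithinAt (by simp))
      ((B.contDiffOn_β _ B.zero_mem_ball).differentiableWithinAt (by simp))
      ((B.contDiffOn_g _ B.zero_mem_ball).differentiableWithinAt (by simp))
      ((B.contDiffOn_k _ B.zero_mem_ball).differentiableWithinAt (by simp)) u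
    refine h1.trans ?_
    simp
  rw [dForm, key, key]

/-- The derivative of |z|² vanishes at z = 0, so transversal derivatives of the coefficients drop
out; the term with `k` is symmetric in the two vectors and cancels. -/
theorem dForm_cutForm {S : Set (SliceSpace n × ℂ)} (hS : IsOpen S) (h0 : 0 ∈ S)
    (hSr : S ⊆ (fun v : SliceSpace n × ℂ ↦ (v.1, ‖v.2‖ ^ 2)) ⁻¹' Metric.ball 0 r)
    (u w : SliceSpace n × ℂ) : dForm (cutForm β g k) S 0 u w =
      (inner ℝ (Complex.I * u.2) w.2 • g 0 +
        fderivWithin ℝ β (Metric.ball 0 r ∩ {d | 0 ≤ d.2}) 0 (u.1, 0) w.1) -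
      (inner ℝ (Complex.I * w.2) u.2 • g 0 +
        fderivWithin ℝ β (Metric.ball 0 r ∩ {d | 0 ≤ d.2}) 0 (w.1, 0) u.1) := by
  have h00 : (((0 : SliceSpace n × ℂ).1, ‖(0 : SliceSpace n × ℂ).2‖ ^ 2) : SliceSpace n × ℝ) = 0 := by
    simp
  have hd : HasFDerivWithinAt (fun v : SliceSpace n × ℂ ↦ (v.1, ‖v.2‖ ^ 2))
      ((ContinuousLinearMap.inl ℝ (SliceSpace n) ℝ).comp (ContinuousLinearMap.fst ℝ _ ℂ)) S 0 := by
    have h1 : HasFDerivAt (fun v : SliceSpace n × ℂ ↦ (v.1, ‖v.2‖ ^ 2)) _ 0 :=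
      hasFDerivAt_fst.prodMk ((hasStrictFDerivAt_norm_sq (0 : SliceSpace n × ℂ).2).hasFDerivAt.comp
        (0 : SliceSpace n × ℂ) hasFDerivAt_snd)
    refine (h1.congr_fderiv ?_).hasFDerivWithinAt
    ext v <;> simp
  have key : ∀ u w : SliceSpace n × ℂ, fderivWithin ℝ (cutForm β g k) S 0 u w =
      inner ℝ (Complex.I * u.2) w.2 • g 0 +
        fderivWithin ℝ β (Metric.ball 0 r ∩ {d | 0 ≤ d.2}) 0 (u.1, 0) w.1 +
        (2 * inner ℝ u.2 w.2) • k 0 := by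
    intro u w
    have hφ : HasFDerivWithinAt (fun v : SliceSpace n × ℂ ↦
        ((innerSL ℝ (Complex.I * v.2)).comp (ContinuousLinearMap.snd ℝ (SliceSpace n) ℂ)) w)
        ((innerSL ℝ w.2).comp ((ContinuousLinearMap.mul ℝ ℂ Complex.I).comp
          (ContinuousLinearMap.snd ℝ (SliceSpace n) ℂ))) S 0 :=
      (ContinuousLinearMap.hasFDerivWithinAt _).congr_of_eventuallyEq
        (Eventually.of_forall fun p ↦ real_inner_comm w.2 (Complex.I * p.2))
        (real_inner_comm w.2 (Complex.I * (0 : SliceSpace n × ℂ).2))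
    have hψ : HasFDerivWithinAt (fun v : SliceSpace n × ℂ ↦
        ((2 : ℝ) • (innerSL ℝ v.2).comp (ContinuousLinearMap.snd ℝ (SliceSpace n) ℂ)) w)
        ((2 : ℝ) • (innerSL ℝ w.2).comp (ContinuousLinearMap.snd ℝ (SliceSpace n) ℂ)) S 0 :=
      (ContinuousLinearMap.hasFDerivWithinAt _).congr_of_eventuallyEq
        (Eventually.of_forall fun p ↦ congrArg ((2 : ℝ) * ·) (real_inner_comm w.2 p.2))
        (congrArg ((2 : ℝ) * ·) (real_inner_comm w.2 (0 : SliceSpace n × ℂ).2))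
    have h1 := fderivWithin_combinedForm (q := ContinuousLinearMap.fst ℝ (SliceSpace n) ℂ)
      (β := β) (g := g) (k := k) hS.uniqueDiffOn ((mapsTo_sq r).mono_left hSr) h0
      (w := w) hd hφ hψ
      (((B.isForm_cutForm.mono hSr).contDiffOn _ h0).differentiableWithinAt (by simp))
      ((B.contDiffOn_β _ (h00 ▸ B.zero_mem_ball)).differentiableWithinAt (by simp))
      ((B.contDiffOn_g _ (h00 ▸ B.zero_mem_ball)).differentiableWithinAt (by simp))
      ((B.contDiffOn_k _ (h00 ▸ B.zero_mem_ball)).differentiableWithinAt (by simp)) u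
    refine h1.trans ?_
    rw [h00]
    simp only [ContinuousLinearMap.comp_apply, smul_apply, innerSL_apply_apply,
      ContinuousLinearMap.coe_fst', ContinuousLinearMap.coe_snd', ContinuousLinearMap.inl_apply,
      ContinuousLinearMap.mul_apply', Prod.snd_zero, mul_zero, inner_zero_right, zero_smul,
      add_zero, smul_eq_mul, real_inner_comm w.2]
  rw [dForm, key, key, real_inner_comm u.2 w.2]
  abel

variable {V : Set M} (hV : τ.T ⊆ V) (hE : ∀ a, ∀ x ∈ V,
      (E x).map (mfderiv (𝓡∂ n) (𝓡∂ n) (A.act a) x).toLinearMap = E (A.act a x))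
include hV hE

theorem nondegenerateAt_iff (hK : Module.finrank ℝ K = 1) :
    NondegenerateAt (𝓡∂ n) E (τ.cover 0) ↔ g 0 ≠ 0 ∧
      NondegenerateOnKer (β 0) (fderivWithin ℝ β (Metric.ball 0 r ∩ {d | 0 ≤ d.2}) 0) := by
  rw [← nondegenerate_boundary_iff (B.apply_ι 0 B.zero_mem_ball) hK (k := k 0)
    (k' := fderivWithin ℝ k (Metric.ball 0 r ∩ {d | 0 ≤ d.2}) 0)]
  refine ((B.hasForm hV hE).nondegenerateAt_iff B.zero_mem_S).trans ?_
  have h1 : ∀ u, form β g k 0 u = β 0 u.2.1 + u.2.2 • k 0 := fun u ↦ by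
    rw [form_apply]
    simp
  simp only [h1, B.dForm_form]

section Cut
variable [T2Space M] [SecondCountableTopology M]
  [ChartedSpace (EuclideanSpace ℝ (Fin n)) A.Cut] [IsManifold (𝓡 n) ∞ A.Cut]
  (hA : A.IsCutStructure) {f : M → ℝ} (hf : A.IsInvariantBoundaryDefining f) {γ}
  (hτ : τ.IsFactor f γ)
include hA hf hτ

omit B hV hE in
theorem cutParam_zero : (hA.cutParam hf hτ).ψ 0 = A.c (τ.cover 0) := by
  change A.c (τ.lift 0) = _
  rw [Tube.lift]
  simp [cover_zero, A.one_act _ (τ.σ_mem 0 τ.zero_mem_Dp), ← Prod.zero_eq_mk]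

variable {E' : ∀ y : A.Cut, Submodule ℝ (TangentSpace (𝓡 n) y)} (hag : A.AgreesOnInterior E E')
  (hcl : distributionClosure (𝓡 n) E' (A.c '' (𝓡∂ n).interior M) = E')
include hag hcl

/-- The right-hand side is the criterion found for `E` itself, here without a condition on the
dimension of `K`. -/
theorem cut_nondegenerateAt_iff :
    NondegenerateAt (𝓡 n) E' (A.c (τ.cover 0)) ↔ g 0 ≠ 0 ∧
      NondegenerateOnKer (β 0) (fderivWithin ℝ β (Metric.ball 0 r ∩ {d | 0 ≤ d.2}) 0) := by
  have h1 := B.hasForm_cut hV hE hA hf hτ hag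
  rw [hcl] at h1
  have h2 := h1.nondegenerateAt_iff B.zero_mem_cut
  rw [← cutParam_zero hA hf hτ, ← nondegenerate_cut_iff]
  refine h2.trans ?_
  have h3 : ∀ u, cutForm β g k 0 u = β 0 u.1 := fun u ↦ by
    rw [cutForm_apply]
    simp [← Prod.zero_eq_mk]
  have h4 := B.dForm_cutForm (τ.isOpen_cutD.inter (isOpen_preimage_sq r)) B.zero_mem_cut
    inter_subset_right
  simp only [h3]
  refine forall_congr' fun u ↦ imp_congr_right fun _ ↦ imp_congr_left ?_
  refine forall_congr' fun w ↦ imp_congr_right fun _ ↦ ?_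
  rw [← h4]
  rfl

theorem finrank_quotient_eq :
    Module.finrank ℝ (TangentSpace (𝓡∂ n) (τ.cover 0) ⧸ E (τ.cover 0)) = Module.finrank ℝ K ∧
    Module.finrank ℝ (TangentSpace (𝓡 n) (A.c (τ.cover 0)) ⧸ E' (A.c (τ.cover 0))) =
      Module.finrank ℝ K := by
  have h1 := B.hasForm_cut hV hE hA hf hτ hag
  rw [hcl] at h1
  rw [← cutParam_zero hA hf hτ]
  exact ⟨(B.hasForm hV hE).finrank_quotient B.zero_mem_S, h1.finrank_quotient B.zero_mem_cut⟩

end Cut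

end Tube.BoundaryForm
end FreeCircleActionNearBoundary
end

/-! ### Existence, uniqueness and comparison of the cut distribution -/

noncomputable section

open Set Filter Topology VectorField

namespace FreeCircleActionNearBoundary

variable {n : ℕ} [NeZero n] {M : Type*} [TopologicalSpace M]
  [ChartedSpace (EuclideanHalfSpace n) M] [IsManifold (𝓡∂ n) ∞ M]
  {A : FreeCircleActionNearBoundary n M}

theorem Tube.BoundaryForm.zero_mem_closure {τ : A.Tube}
    {E : ∀ x : M, Submodule ℝ (TangentSpace (𝓡∂ n) x)} {K : Type*}
    [NormedAddCommGroup K] [NormedSpace ℝ K] {ι : K →L[ℝ] SliceSpace n} {r : ℝ}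
    {β : SliceSpace n × ℝ → SliceSpace n →L[ℝ] K} {g k : SliceSpace n × ℝ → K}
    (B : τ.BoundaryForm E ι r β g k) : (0 : ℝ × (SliceSpace n × ℝ)) ∈
      closure {v ∈ (τ.boundaryParam.restrict (isOpen_preimage_snd r)).S |
        τ.cover v ∈ (𝓡∂ n).interior M} := by
  have h1 : Continuous fun t : ℝ ↦ ((0, (0, t)) : ℝ × (SliceSpace n × ℝ)) := by fun_prop
  have h2 : (0 : ℝ) ∈ closure (Ioo 0 r) := by
    rw [closure_Ioo B.pos.ne]
    exact left_mem_Icc.2 B.pos.le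
  refine map_mem_closure (f := fun t : ℝ ↦ ((0, (0, t)) : ℝ × (SliceSpace n × ℝ))) h1 h2
    fun t ht ↦ ?_
  have hball : ((0, t) : SliceSpace n × ℝ) ∈ Metric.ball 0 r := by
    rw [mem_ball_zero_iff, Prod.norm_def, norm_zero, Real.norm_of_nonneg ht.1.le]
    exact max_lt B.pos ht.2
  have hDp : ((0, t) : SliceSpace n × ℝ) ∈ τ.Dp := ⟨B.ball_subset hball, ht.1.le⟩
  exact ⟨⟨⟨⟨mem_univ _, hDp⟩, ⟨by simp [Real.pi_pos], by simp [Real.pi_pos]⟩, mem_univ _⟩, hball⟩,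
    (τ.cover_mem_interior_iff (v := (0, (0, t))) hDp).2 ht.1⟩

variable [T2Space M]

theorem exists_tube_cover {V : Set M} (hV : A.IsInvariantNhd V) {f : M → ℝ}
    (hf : A.IsInvariantBoundaryDefining f) {x : M} (hx : x ∈ (𝓡∂ n).boundary M) :
    ∃ τ : A.Tube, τ.cover 0 = x ∧ τ.T ⊆ V ∧ ∃ γ, τ.IsFactor f γ := by
  obtain ⟨τ, h0, hT, γ, hτ⟩ := hf.exists_tube hV hx
  exact ⟨τ, τ.cover_zero.trans h0, hT, γ, hτ⟩

variable [SecondCountableTopology M]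
  [ChartedSpace (EuclideanSpace ℝ (Fin n)) A.Cut] [IsManifold (𝓡 n) ∞ A.Cut]

theorem IsCutStructure.interiorParam_mem_closure (hA : A.IsCutStructure) (x : M) :
    ∀ v ∈ (hA.interiorParam x).S, v ∈ closure
      {v' ∈ (hA.interiorParam x).S | (hA.interiorParam x).ψ v' ∈ A.c '' (𝓡∂ n).interior M} :=
  fun v hv ↦ subset_closure ⟨hv, mem_image_of_mem _ ((A.interiorParam x).ψ_mem v hv).1⟩

theorem interior_or_boundary (x : M) :
    x ∈ (𝓡∂ n).interior M ∨ x ∈ (𝓡∂ n).boundary M := by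
  rw [← ModelWithCorners.compl_interior]
  exact em _

/-- The image of the interior is dense, so a distribution on the cut space is recovered from its
values there; this is the source of uniqueness. -/
theorem IsCutStructure.distributionClosure_eq (hA : A.IsCutStructure)
    {E' : ∀ y : A.Cut, Submodule ℝ (TangentSpace (𝓡 n) y)} (hE' : IsDistribution (𝓡 n) E') :
    distributionClosure (𝓡 n) E' (A.c '' (𝓡∂ n).interior M) = E' := by
  funext p
  obtain ⟨x, rfl⟩ := A.surjective_c p
  rcases interior_or_boundary (n := n) x with hx | hx
  · obtain ⟨v, hv, hvx⟩ := exists_interiorParam (A := A) hx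
    have h1 := (hA.interiorParam x).distributionClosure_eq hE' (hA.interiorParam_mem_closure x) hv
    have h2 : (hA.interiorParam x).ψ v = A.c x := congrArg A.c hvx
    rwa [h2] at h1
  · obtain ⟨f, hf⟩ := A.exists_isInvariantBoundaryDefining
    obtain ⟨τ, rfl, -, γ, hτ⟩ := exists_tube_cover A.isInvariantNhd_U hf hx
    have h1 := (hA.cutParam hf hτ).distributionClosure_eq hE'
      (Tube.BoundaryForm.cutParam_mem_closure hA hf hτ) (v := 0) (by
        change _ ∈ τ.D
        simpa [← Prod.zero_eq_mk] using τ.zero_mem)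
    rwa [Tube.BoundaryForm.cutParam_zero hA hf hτ] at h1

theorem IsCutStructure.eq_of_agrees (hA : A.IsCutStructure)
    {E : ∀ x : M, Submodule ℝ (TangentSpace (𝓡∂ n) x)}
    {E₁ E₂ : ∀ y : A.Cut, Submodule ℝ (TangentSpace (𝓡 n) y)} (h₁ : A.AgreesOnInterior E E₁)
    (h₂ : A.AgreesOnInterior E E₂) : ∀ p ∈ A.c '' (𝓡∂ n).interior M, E₁ p = E₂ p := by
  rintro _ ⟨x, hx, rfl⟩
  ext y
  obtain ⟨u, rfl⟩ : ∃ u, mfderiv (𝓡∂ n) (𝓡 n) A.c x u = y :=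
    ⟨_, (hA.isInvertible_mfderiv_c hx).self_apply_inverse y⟩
  rw [mem_iff_of_agrees h₁ hx, mem_iff_of_agrees h₂ hx]

/-- The image of a distribution on the interior of `M`. -/
def cutImage (E : ∀ x : M, Submodule ℝ (TangentSpace (𝓡∂ n) x)) (y : A.Cut) :
    Submodule ℝ (TangentSpace (𝓡 n) y) :=
  A.c_out y ▸ (E (A.out y)).map (mfderiv (𝓡∂ n) (𝓡 n) A.c (A.out y)).toLinearMap

/-- The cut of a distribution. -/
def cutDistribution (E : ∀ x : M, Submodule ℝ (TangentSpace (𝓡∂ n) x)) :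
    ∀ y : A.Cut, Submodule ℝ (TangentSpace (𝓡 n) y) :=
  distributionClosure (𝓡 n) (cutImage E) (A.c '' (𝓡∂ n).interior M)

theorem IsCutStructure.agreesOnInterior_cutImage (hA : A.IsCutStructure)
    (E : ∀ x : M, Submodule ℝ (TangentSpace (𝓡∂ n) x)) : A.AgreesOnInterior E (cutImage E) := by
  intro x hx
  -- Generalising the representative makes the transport along `c_out` disappear.
  have key : ∀ z (h : A.c z = A.c x), z = x →
      (h ▸ (E z).map (mfderiv (𝓡∂ n) (𝓡 n) A.c z).toLinearMap : Submodule ℝ (TangentSpace (𝓡 n)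
        (A.c x))) = (E x).map (mfderiv (𝓡∂ n) (𝓡 n) A.c x).toLinearMap := by
    rintro z h rfl
    rfl
  have h1 : cutImage E (A.c x) = (E x).map (mfderiv (𝓡∂ n) (𝓡 n) A.c x).toLinearMap :=
    key _ _ (A.out_c_of_interior hx)
  rw [h1]
  refine Submodule.comap_map_eq_of_injective (fun u w huw ↦ ?_) _
  have := congrArg (mfderiv (𝓡∂ n) (𝓡 n) A.c x).inverse huw
  change (mfderiv (𝓡∂ n) (𝓡 n) A.c x).inverse (mfderiv (𝓡∂ n) (𝓡 n) A.c x u) =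
    (mfderiv (𝓡∂ n) (𝓡 n) A.c x).inverse (mfderiv (𝓡∂ n) (𝓡 n) A.c x w) at this
  rwa [(hA.isInvertible_mfderiv_c hx).inverse_apply_self,
    (hA.isInvertible_mfderiv_c hx).inverse_apply_self] at this

variable {E : ∀ x : M, Submodule ℝ (TangentSpace (𝓡∂ n) x)} (hE : IsDistribution (𝓡∂ n) E)
  (h_orbit : A.ContainsOrbitTangents E) (h_inv : A.InvariantNearBoundary E)
  (h_trans : TransverseToBoundary E)
include hE

theorem IsCutStructure.agreesOnInterior_cutDistribution (hA : A.IsCutStructure) :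
    A.AgreesOnInterior E (cutDistribution E) := by
  intro x hx
  obtain ⟨K, O', hO', α, v, hv, hvx, hα⟩ := exists_hasForm_interior (A := A) hE hx
  have h1 := hA.hasForm_interior (hA.agreesOnInterior_cutImage E) hO' hα
  have h2 := h1.distributionClosure_eq
    (LocalParam.mem_closure_restrict _ (hA.interiorParam_mem_closure x) hO') hv
  have h3 : ((hA.interiorParam x).restrict hO').ψ v = A.c x := congrArg A.c hvx
  rw [h3] at h2
  rw [cutDistribution, h2]
  exact hA.agreesOnInterior_cutImage E x hx

include h_orbit h_inv h_trans

/-- Over interior and boundary points alike the closure is the kernel of a smooth form, and such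
kernels have smooth frames. -/
theorem IsCutStructure.isDistribution_cutDistribution (hA : A.IsCutStructure) :
    IsDistribution (𝓡 n) (cutDistribution (A := A) E) := by
  intro p
  obtain ⟨x, rfl⟩ := A.surjective_c p
  rcases interior_or_boundary (n := n) x with hx | hx
  · obtain ⟨K, O', hO', α, v, hv, hvx, hα⟩ := exists_hasForm_interior (A := A) hE hx
    have h1 := hA.hasForm_interior (hA.agreesOnInterior_cutImage E) hO' hα
    have h2 := LocalParam.hasForm_distributionClosure (E := cutImage E) h1.isForm
      (LocalParam.mem_closure_restrict _ (hA.interiorParam_mem_closure x) hO')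
      fun w hw _ u ↦ h1.mem_iff w hw u
    have h3 : ((hA.interiorParam x).restrict hO').ψ v = A.c x := congrArg A.c hvx
    rw [← h3]
    exact h2.exists_frame (((hA.interiorParam x).restrict hO').ψ_mem v hv)
  · obtain ⟨f, hf⟩ := A.exists_isInvariantBoundaryDefining
    obtain ⟨V, hV, hEV⟩ := h_inv
    obtain ⟨τ, rfl, hT, γ, hτ⟩ := exists_tube_cover hV hf hx
    obtain ⟨K, r, β, g, k, B⟩ := τ.exists_boundaryForm hE h_orbit h_trans
    have h1 := B.hasForm_cut hT hEV hA hf hτ (hA.agreesOnInterior_cutImage E)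
    rw [← Tube.BoundaryForm.cutParam_zero hA hf hτ]
    exact h1.exists_frame (((hA.cutParam hf hτ).restrict _).ψ_mem 0 B.zero_mem_cut)

variable {E' : ∀ y : A.Cut, Submodule ℝ (TangentSpace (𝓡 n) y)}
  (hE' : IsDistribution (𝓡 n) E') (hag : A.AgreesOnInterior E E')
include hE' hag

/-- Involutivity is a closed condition and both interiors are dense, so agreement over the interior
suffices. -/
theorem IsCutStructure.isInvolutive_iff (hA : A.IsCutStructure) :
    IsInvolutive (𝓡∂ n) E ↔ IsInvolutive (𝓡 n) E' := by
  rw [_root_.isInvolutive_iff, _root_.isInvolutive_iff]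
  obtain ⟨f, hf⟩ := A.exists_isInvariantBoundaryDefining
  obtain ⟨V, hV, hEV⟩ := h_inv
  constructor
  · intro h p
    obtain ⟨x, rfl⟩ := A.surjective_c p
    rcases interior_or_boundary (n := n) x with hx | hx
    · exact (hA.interior_iff hE hag hx).1.1 (h x)
    · obtain ⟨τ, rfl, hT, γ, hτ⟩ := exists_tube_cover hV hf hx
      obtain ⟨K, r, β, g, k, B⟩ := τ.exists_boundaryForm hE h_orbit h_trans
      have h1 := B.hasForm_cut hT hEV hA hf hτ hag
      rw [hA.distributionClosure_eq hE'] at h1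
      rw [← Tube.BoundaryForm.cutParam_zero hA hf hτ]
      refine h1.involutiveAt_of_mem_closure B.zero_mem_cut (closure_mono ?_
        (LocalParam.mem_closure_restrict _ (Tube.BoundaryForm.cutParam_mem_closure hA hf hτ)
          (Tube.BoundaryForm.isOpen_preimage_sq r) 0 B.zero_mem_cut))
      rintro v ⟨hv, y, hy, hyv⟩
      refine ⟨hv, ?_⟩
      rw [← hyv]
      exact (hA.interior_iff hE hag hy).1.1 (h y)
  · intro h x
    rcases interior_or_boundary (n := n) x with hx | hx
    · exact (hA.interior_iff hE hag hx).1.2 (h _)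
    · obtain ⟨τ, rfl, hT, γ, hτ⟩ := exists_tube_cover hV hf hx
      obtain ⟨K, r, β, g, k, B⟩ := τ.exists_boundaryForm hE h_orbit h_trans
      refine (B.hasForm hT hEV).involutiveAt_of_mem_closure B.zero_mem_S
        (closure_mono ?_ B.zero_mem_closure)
      rintro v ⟨hv, hv'⟩
      exact ⟨hv, (hA.interior_iff hE hag hv').1.2 (h _)⟩

/-- Non-degeneracy does not pass to limits, so density is of no use at the boundary; there both
sides are compared through their common criterion. On M that criterion requires codimension one,
hence the implication in `key`. -/
theorem IsCutStructure.isContact_iff (hA : A.IsCutStructure) :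
    IsContact (𝓡∂ n) E ↔ IsContact (𝓡 n) E' := by
  obtain ⟨f, hf⟩ := A.exists_isInvariantBoundaryDefining
  obtain ⟨V, hV, hEV⟩ := h_inv
  have hcl := hA.distributionClosure_eq hE'
  have key : ∀ x : M, Module.finrank ℝ (TangentSpace (𝓡∂ n) x ⧸ E x) =
      Module.finrank ℝ (TangentSpace (𝓡 n) (A.c x) ⧸ E' (A.c x)) ∧
      (Module.finrank ℝ (TangentSpace (𝓡∂ n) x ⧸ E x) = 1 →
        (NondegenerateAt (𝓡∂ n) E x ↔ NondegenerateAt (𝓡 n) E' (A.c x))) := by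
    intro x
    rcases interior_or_boundary (n := n) x with hx | hx
    · have h1 := hA.interior_iff hE hag hx
      exact ⟨h1.2.2, fun _ ↦ h1.2.1⟩
    · obtain ⟨τ, rfl, hT, γ, hτ⟩ := exists_tube_cover hV hf hx
      obtain ⟨K, r, β, g, k, B⟩ := τ.exists_boundaryForm hE h_orbit h_trans
      obtain ⟨h1, h2⟩ := B.finrank_quotient_eq hT hEV hA hf hτ hag hcl
      refine ⟨h1.trans h2.symm, fun h ↦ ?_⟩
      rw [B.cut_nondegenerateAt_iff hT hEV hA hf hτ hag hcl,
        B.nondegenerateAt_iff hT hEV (h1.symm.trans h)]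
  constructor
  · rintro ⟨h1, h2⟩
    refine ⟨fun p ↦ ?_, fun p ↦ ?_⟩ <;> obtain ⟨x, rfl⟩ := A.surjective_c p
    · exact (key x).1.symm.trans (h1 x)
    · exact ((key x).2 (h1 x)).1 (h2 x)
  · rintro ⟨h1, h2⟩
    have h3 : ∀ x, Module.finrank ℝ (TangentSpace (𝓡∂ n) x ⧸ E x) = 1 :=
      fun x ↦ (key x).1.trans (h1 _)
    exact ⟨h3, fun x ↦ ((key x).2 (h3 x)).2 (h2 _)⟩

end FreeCircleActionNearBoundary
end

theorem mainTheorem9 {n : ℕ} [NeZero n] {M : Type*} [TopologicalSpace M] [T2Space M]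
    [SecondCountableTopology M] [ChartedSpace (EuclideanHalfSpace n) M]
    [IsManifold (𝓡∂ n) ∞ M] (A : FreeCircleActionNearBoundary n M)
    (E : ∀ x : M, Submodule ℝ (TangentSpace (𝓡∂ n) x))
    (hE : IsDistribution (𝓡∂ n) E)
    (h_orbit : A.ContainsOrbitTangents E)
    (h_inv : A.InvariantNearBoundary E)
    (h_trans : TransverseToBoundary E) :
    (T2Space A.Cut ∧ SecondCountableTopology A.Cut ∧
      ∃ _ : ChartedSpace (EuclideanSpace ℝ (Fin n)) A.Cut,
        IsManifold (𝓡 n) ∞ A.Cut ∧ A.IsCutStructure) ∧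
    ∀ [ChartedSpace (EuclideanSpace ℝ (Fin n)) A.Cut] [IsManifold (𝓡 n) ∞ A.Cut],
      A.IsCutStructure →
      (∃! E' : ∀ y : A.Cut, Submodule ℝ (TangentSpace (𝓡 n) y),
        IsDistribution (𝓡 n) E' ∧ A.AgreesOnInterior E E') ∧
      ∀ E' : ∀ y : A.Cut, Submodule ℝ (TangentSpace (𝓡 n) y),
        IsDistribution (𝓡 n) E' → A.AgreesOnInterior E E' →
          (IsInvolutive (𝓡∂ n) E ↔ IsInvolutive (𝓡 n) E') ∧
          (IsContact (𝓡∂ n) E ↔ IsContact (𝓡 n) E') := by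
  refine ⟨⟨A.t2Space_cut, A.secondCountableTopology_cut, A.exists_isCutStructure⟩, ?_⟩
  intro _ _ hA
  refine ⟨⟨A.cutDistribution E, ⟨hA.isDistribution_cutDistribution hE h_orbit h_inv h_trans,
    hA.agreesOnInterior_cutDistribution hE⟩, fun E' hE' ↦ ?_⟩, fun E' hE' hag ↦
    ⟨hA.isInvolutive_iff hE h_orbit h_inv h_trans hE' hag,
      hA.isContact_iff hE h_orbit h_inv h_trans hE' hag⟩⟩
  -- `E'` is the closure of its restriction to the image of the interior, where it coincides with
  -- `cutImage E`.
  rw [← hA.distributionClosure_eq hE'.1]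
  exact distributionClosure_congr _ (hA.eq_of_agrees hE'.2 (hA.agreesOnInterior_cutImage E))
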